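/- **Setting.** Let $d_1,d_2,r\ge 1$, let $\mathcal A\subset\{A\in\mathbb R^{d_1\times d_2}:\|A\|_{\mathrm{op}}\le 1\}$, and let $\pi$ be a probability distribution concentrated on $\mathcal A$ whose population covariance $Q=\mathbb E_{a\sim\pi}[\mathrm{vec}(a)\mathrm{vec}(a)^\top]$ is invertible ($\mathrm{vec}$ stacks columns, $\mathrm{reshape}$ is its inverse). Let $$B(Q)=\max\Big(\lambda_{\max}\big(\textstyle\sum_{j=1}^{d_2}D_j^{(\mathrm{col})}\big),\ \lambda_{\max}\big(\sum_{i=1}^{d_1}D_i^{(\mathrm{row})}\big)\Big),$$ where $D_j^{(\mathrm{col})}\in\mathbb R^{d_1\times d_1}$ (resp. $D_i^{(\mathrm{row})}\in\mathbb R^{d_2\times d_2}$) is the principal submatrix of $Q^{-1}$ on the coordinates of the entries in column $j$ (resp. row $i$). Let $\Theta^*\in\mathbb R^{d_1\times d_2}$ have rank at most $r$ and nuclear norm at most $S_*$, and let $\sigma>0$, $0<\delta<1$. Observe $Y_i=\langle\Theta^*,X_i\rangle+\eta_i$, where the pairs $(X_i,\eta_i)$ are independent, $X_i\sim\pi$,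 and $\mathbb E[e^{t\eta_i}\mid X_i]\le e^{\sigma^2t^2/2}$ for all $t\in\mathbb R$. **LowPopArt.** With $n$ samples, a pilot $\Theta_0$, a bound $R_0$ and a failure rate $\delta$, put $$\tilde\Theta_i=\mathrm{reshape}\big(Q^{-1}(Y_i-\langle\Theta_0,X_i\rangle)\mathrm{vec}(X_i)\big),\qquad \nu=\sqrt{\frac{\ln(2(d_1+d_2)/\delta)}{(\sigma^2+R_0^2)B(Q)\,n}},$$ $$\Theta_1=\Theta_0+\frac1{n\nu}\Big(\sum_{i=1}^n\phi\big(\nu\,\mathcal H(\tilde\Theta_i)\big)\Big)_{\mathsf{ht}},$$ where $\mathcal H(A)=\begin{bmatrix}0&A\\A^\top&0\end{bmatrix}$, $\phi(x)=\mathrm{sign}(x)\ln(1+|x|+x^2/2)$ acts on the spectrum of a symmetric matrix, and $(\cdot)_{\mathsf{ht}}$ is the upper right $d_1\times d_2$ block. The output is obtained from $\Theta_1$ by setting to zero every singular value that is at most $$\lambda_{\mathrm{th}}(n,R_0,\delta)=2\sqrt{\frac{(\sigma^2+R_0^2)\,B(Q)\,\ln(2(d_1+d_2)/\delta)}{n}}.$$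 **Warm start.** The samples are split into a first batch of size $m$ and a second batch of size $k$. The pilot $\Theta_0$ is LowPopArt on the first batch with initial pilot $0$, bound $S_*$ and failure rate $\delta/2$. The final estimator $\hat\Theta$ is LowPopArt on the second batch with pilot $\Theta_0$, bound $\sigma$ and failure rate $\delta/2$. **Theorem.** For every $\kappa\ge 1$ there is a constant $C>0$, depending only on $\kappa$, such that the following holds in the setting above. Suppose $n_0\le\kappa m$ and $n_0\le\kappa k$ (for example $m=k=n_0$ with $\kappa=1$, or the two halves of $n_0\ge2$ samples with $\kappa=3$), and $$n_0\ \ge\ C\,r^2\,B(Q)\Big(\frac{\sigma+S_*}{\sigma}\Big)^2\ln\frac{4(d_1+d_2)}{\delta}.$$ Then, with probability at least $1-\delta$, all of the following hold: 1. $|\langle\Theta_0-\Theta^*,A\rangle|\le\sigma$ for all $A\in\mathcal A$; 2. $\mathrm{rank}(\hat\Theta)\le r$ and $\|\hat\Theta-\Theta^*\|_{\mathrm{op}}\le 2\lambda_{\mathrm{th}}(k,\sigma,\delta/2)$, which is the LowPopArt guarantee with $R_0=\sigma$; 3. $\displaystyle\|\hat\Theta-\Theta^*\|_{\mathrm{op}}\le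 C\,\sigma\sqrt{\frac{B(Q)\ln(4(d_1+d_2)/\delta)}{n_0}}.$ -/

import Mathlib

open MeasureTheory ProbabilityTheory
open scoped Matrix

/-- Real matrices carry the product (equivalently Borel) sigma-algebra of their entries. -/
instance Matrix.instMeasurableSpaceRealEntries {m n : Type*} :
    MeasurableSpace (Matrix m n ℝ) :=
  inferInstanceAs (MeasurableSpace (m → n → ℝ))

noncomputable section

namespace LowPop

variable {d₁ d₂ : ℕ}

/-- The trace inner product `⟨A, B⟩ = tr (Aᵀ B)`. -/
def matInner (A B : Matrix (Fin d₁) (Fin d₂) ℝ) : ℝ :=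
  (Aᵀ * B).trace

/-- The operator norm with respect to the Euclidean norms. -/
def opNorm (A : Matrix (Fin d₁) (Fin d₂) ℝ) : ℝ :=
  ‖LinearMap.toContinuousLinearMap (Matrix.toEuclideanLin A)‖

/-- The nuclear norm: the sum of the singular values. -/
def nuclearNorm (A : Matrix (Fin d₁) (Fin d₂) ℝ) : ℝ :=
  (Matrix.toEuclideanLin A).singularValues.sum fun _ s => s

/-- The largest eigenvalue of a real symmetric matrix. -/
def lambdaMax {n : Type*} [Fintype n] [DecidableEq n] (M : Matrix n n ℝ) : ℝ :=
  sSup (spectrum ℝ M)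

/-- The inverse of the column-stacking map `Matrix.vec`. -/
def reshape (v : Fin d₂ × Fin d₁ → ℝ) : Matrix (Fin d₁) (Fin d₂) ℝ :=
  Matrix.of fun i j => v (j, i)

/-- The population covariance `Q(π) = 𝔼_{a ∼ π} [vec(a) vec(a)ᵀ]` of the vectorized arms. -/
def covMatrix (π : Measure (Matrix (Fin d₁) (Fin d₂) ℝ)) :
    Matrix (Fin d₂ × Fin d₁) (Fin d₂ × Fin d₁) ℝ :=
  Matrix.of fun p q => ∫ a, Matrix.vec a p * Matrix.vec a q ∂π

/-- The `d₁ × d₁` diagonal block of `Q⁻¹` that belongs to column `j` of an arm. -/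
def colBlock (Q : Matrix (Fin d₂ × Fin d₁) (Fin d₂ × Fin d₁) ℝ) (j : Fin d₂) :
    Matrix (Fin d₁) (Fin d₁) ℝ :=
  Q⁻¹.submatrix (fun i => (j, i)) (fun i => (j, i))

/-- The `d₂ × d₂` submatrix of `Q⁻¹` that belongs to row `i` of an arm. -/
def rowBlock (Q : Matrix (Fin d₂ × Fin d₁) (Fin d₂ × Fin d₁) ℝ) (i : Fin d₁) :
    Matrix (Fin d₂) (Fin d₂) ℝ :=
  Q⁻¹.submatrix (fun j => (j, i)) (fun j => (j, i))

/-- `B(Q) = max (λ_max (∑ⱼ Dⱼ^(col)), λ_max (∑ᵢ Dᵢ^(row)))`. -/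
def bQ (Q : Matrix (Fin d₂ × Fin d₁) (Fin d₂ × Fin d₁) ℝ) : ℝ :=
  max (lambdaMax (∑ j, colBlock Q j)) (lambdaMax (∑ i, rowBlock Q i))

/-- The influence function `φ(x) = sign(x) log(1 + |x| + x² / 2)`. -/
def influence (x : ℝ) : ℝ :=
  Real.sign x * Real.log (1 + |x| + x ^ 2 / 2)

/-- The symmetric dilation `H(A) = [[0, A], [Aᵀ, 0]]`. -/
def dilation (A : Matrix (Fin d₁) (Fin d₂) ℝ) :
    Matrix (Fin d₁ ⊕ Fin d₂) (Fin d₁ ⊕ Fin d₂) ℝ :=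
  Matrix.fromBlocks 0 A Aᵀ 0

/-- Hard thresholding of singular values: if `A = U diag(s) Vᵀ` is a singular value
decomposition, every `sᵢ ≤ τ` is replaced by `0`. Here this is written as `A P`, where `P` is the
spectral projection of `Aᵀ A` onto the eigenvalues `s²` with `τ < s`, that is, the orthogonal
projection onto the span of the right singular vectors that are kept. -/
def hardThreshold (τ : ℝ) (A : Matrix (Fin d₁) (Fin d₂) ℝ) : Matrix (Fin d₁) (Fin d₂) ℝ :=
  A * cfc (fun x : ℝ => if τ < √x then (1 : ℝ) else 0) (Aᵀ * A)

/-- The one-sample estimator `reshape (Q⁻¹ (y - ⟨Θ₀, x⟩) vec(x))`. -/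
def oneSample (Q : Matrix (Fin d₂ × Fin d₁) (Fin d₂ × Fin d₁) ℝ)
    (Θ₀ x : Matrix (Fin d₁) (Fin d₂) ℝ) (y : ℝ) : Matrix (Fin d₁) (Fin d₂) ℝ :=
  reshape (Q⁻¹ *ᵥ ((y - matInner Θ₀ x) • Matrix.vec x))

/-- The singular value threshold `2 √((σ² + R₀²) B(Q) log(2 (d₁ + d₂) / δ) / n)`. -/
def threshold (Q : Matrix (Fin d₂ × Fin d₁) (Fin d₂ × Fin d₁) ℝ) (n : ℕ) (R₀ σ δ : ℝ) : ℝ :=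
  2 * √((σ ^ 2 + R₀ ^ 2) * bQ Q * Real.log (2 * ((d₁ : ℝ) + d₂) / δ) / n)

/-- The scale `ν` at which the influence function is applied. -/
def influenceScale (Q : Matrix (Fin d₂ × Fin d₁) (Fin d₂ × Fin d₁) ℝ) (n : ℕ)
    (R₀ σ δ : ℝ) : ℝ :=
  √(Real.log (2 * ((d₁ : ℝ) + d₂) / δ) / ((σ ^ 2 + R₀ ^ 2) * bQ Q * n))

/-- The estimate of the algorithm before hard thresholding,
`Θ₁ = Θ₀ + (1 / (n ν)) (∑ᵢ φ(ν H(Θ̃ᵢ)))_ht`, where `φ` acts through the spectral functional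
calculus and `(·)_ht` is the upper right `d₁ × d₂` block. -/
def lowPopArtPre {n : ℕ} (Q : Matrix (Fin d₂ × Fin d₁) (Fin d₂ × Fin d₁) ℝ)
    (Θ₀ : Matrix (Fin d₁) (Fin d₂) ℝ) (R₀ σ δ : ℝ)
    (x : Fin n → Matrix (Fin d₁) (Fin d₂) ℝ) (y : Fin n → ℝ) : Matrix (Fin d₁) (Fin d₂) ℝ :=
  let ν := influenceScale Q n R₀ σ δ
  Θ₀ + (1 / ((n : ℝ) * ν)) •
    (∑ i, cfc influence (ν • dilation (oneSample Q Θ₀ (x i) (y i)))).toBlocks₁₂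

/-- LowPopArt with samples `(xᵢ, yᵢ)`, pilot `Θ₀`, pilot error bound `R₀`, noise level `σ` and
failure rate `δ`. -/
def lowPopArt {n : ℕ} (Q : Matrix (Fin d₂ × Fin d₁) (Fin d₂ × Fin d₁) ℝ)
    (Θ₀ : Matrix (Fin d₁) (Fin d₂) ℝ) (R₀ σ δ : ℝ)
    (x : Fin n → Matrix (Fin d₁) (Fin d₂) ℝ) (y : Fin n → ℝ) : Matrix (Fin d₁) (Fin d₂) ℝ :=
  hardThreshold (threshold Q n R₀ σ δ) (lowPopArtPre Q Θ₀ R₀ σ δ x y)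

/-- The pilot estimate of Warm-LowPopArt: LowPopArt on the first `m` samples, started at `0`, with
pilot error bound `S` and failure rate `δ / 2`. -/
def warmPilot {m k : ℕ} (Q : Matrix (Fin d₂ × Fin d₁) (Fin d₂ × Fin d₁) ℝ) (S σ δ : ℝ)
    (x : Fin (m + k) → Matrix (Fin d₁) (Fin d₂) ℝ) (y : Fin (m + k) → ℝ) :
    Matrix (Fin d₁) (Fin d₂) ℝ :=
  lowPopArt Q 0 S σ (δ / 2) (fun i : Fin m => x (Fin.castAdd k i))
    (fun i : Fin m => y (Fin.castAdd k i))

/-- Warm-LowPopArt: LowPopArt on the last `k` samples, started at the pilot estimate, with pilot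
error bound `σ` and failure rate `δ / 2`. -/
def warmLowPopArt {m k : ℕ} (Q : Matrix (Fin d₂ × Fin d₁) (Fin d₂ × Fin d₁) ℝ) (S σ δ : ℝ)
    (x : Fin (m + k) → Matrix (Fin d₁) (Fin d₂) ℝ) (y : Fin (m + k) → ℝ) :
    Matrix (Fin d₁) (Fin d₂) ℝ :=
  lowPopArt Q (warmPilot Q S σ δ x y) σ σ (δ / 2) (fun i : Fin k => x (Fin.natAdd m i))
    (fun i : Fin k => y (Fin.natAdd m i))

/-- The noise `η` is `σ`-sub-Gaussian conditionally on the arm `X`: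
`𝔼[exp(t η) | X] ≤ exp(σ² t² / 2)` for every real `t` (which forces `𝔼[η | X] = 0`). -/
def IsCondSubgaussian {Ω : Type*} [MeasurableSpace Ω] (μ : Measure Ω)
    (X : Ω → Matrix (Fin d₁) (Fin d₂) ℝ) (η : Ω → ℝ) (σ : ℝ) : Prop :=
  ∀ t : ℝ, Integrable (fun ω => Real.exp (t * η ω)) μ ∧
    μ[fun ω => Real.exp (t * η ω) | MeasurableSpace.comap X inferInstance]
      ≤ᵐ[μ] fun _ => Real.exp (σ ^ 2 * t ^ 2 / 2)

/-- The trace regression model: the pairs `(Xᵢ, ηᵢ)` of arm and noise are independent, every arm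
`Xᵢ` has law `π`, every `ηᵢ` is `σ`-sub-Gaussian given `Xᵢ`, and `Yᵢ = ⟨Θstar, Xᵢ⟩ + ηᵢ`. -/
structure IsSample {Ω : Type*} [MeasurableSpace Ω] (μ : Measure Ω)
    (π : Measure (Matrix (Fin d₁) (Fin d₂) ℝ)) (Θstar : Matrix (Fin d₁) (Fin d₂) ℝ) (σ : ℝ)
    {n : ℕ} (X : Fin n → Ω → Matrix (Fin d₁) (Fin d₂) ℝ) (η Y : Fin n → Ω → ℝ) : Prop where
  measurable_arm : ∀ i, Measurable (X i)
  measurable_noise : ∀ i, Measurable (η i)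
  law_arm : ∀ i, μ.map (X i) = π
  indep : iIndepFun (fun i ω => (X i ω, η i ω)) μ
  subgaussian : ∀ i, IsCondSubgaussian μ (X i) (η i) σ
  reward : ∀ i ω, Y i ω = matInner Θstar (X i ω) + η i ω

end LowPop

end

/-! For a fixed pilot, `Q⁻¹` undoes the second moment of the arm, so the one-sample matrix is an
unbiased estimate of `Θstar - Θ₀`. If `|⟨Θstar - Θ₀, A⟩| ≤ R` for almost every arm, its dilation has
second moment at most `(σ² + R²) B(Q)`: the noise is conditionally centred with variance at most
`σ²`, and the second moment of the dilated whitened arm is block diagonal, its blocks being the two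
sums in `B(Q)` (`hasMoments_dilation_oneSample`).

Two moments suffice for an exponential tail because `φ(x) ≤ log (1 + x + x²/2)`: exponentiating `φ`
produces nothing beyond a quadratic. Since the matrices do not commute, the samples are integrated
out one at a time inside `tr exp` by Lieb's concavity theorem and Jensen's inequality
(`lintegral_trace_exp_sum_le`). Markov's inequality, applied to the dilations and to their
negatives, bounds the operator norm error by the threshold (`measure_threshold_lt_opNorm_le`).

Lieb's theorem (`liebTrace_concave`) comes from Gibbs' principle: `tr exp (H + log A)` is the
maximum over positive definite `T` of `tr (T H) - D(T‖A) + tr A`. The relative entropy `D` is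
jointly convex, being an integral of quasi-entropies, each a supremum of functionals linear in `(T,
A)`; partial maximization of a jointly concave function is concave.

The rest is deterministic. Thresholding at a level that dominates the error costs a factor two and
cannot exceed the rank of the target (`rank_hardThreshold_le`). The pilot error thus has rank at
most `2r` and small operator norm, and trace duality bounds it against every arm; the sample size
condition makes that bound at most `σ`. The first stage may use `R = S` by duality of the nuclear
and operator norms. The second batch is independent of the pilot, so conditionally on a good pilot
the fixed-pilot guarantee applies with `R = σ`, and a union bound finishes. -/

namespace LowPop

/-! ### Trace inequalities for the functional calculus of symmetric matrices. -/

section TraceInequalities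

variable {n : Type*} [Fintype n] [DecidableEq n]

/-- The orthogonal change of basis between the eigenbases of two symmetric matrices. -/
noncomputable def eigenOverlap {A B : Matrix n n ℝ} (hA : A.IsHermitian) (hB : B.IsHermitian) :
    Matrix n n ℝ :=
  (hA.eigenvectorUnitary : Matrix n n ℝ)ᵀ * (hB.eigenvectorUnitary : Matrix n n ℝ)

lemma transpose_mul_eigenvectorUnitary {A : Matrix n n ℝ} (hA : A.IsHermitian) :
    (hA.eigenvectorUnitary : Matrix n n ℝ)ᵀ * (hA.eigenvectorUnitary : Matrix n n ℝ) = 1 := by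
  have h := Unitary.coe_star_mul_self hA.eigenvectorUnitary
  rwa [Matrix.star_eq_conjTranspose, Matrix.conjTranspose_eq_transpose_of_trivial] at h

lemma eigenvectorUnitary_mul_transpose {A : Matrix n n ℝ} (hA : A.IsHermitian) :
    (hA.eigenvectorUnitary : Matrix n n ℝ) * (hA.eigenvectorUnitary : Matrix n n ℝ)ᵀ = 1 :=
  mul_eq_one_comm.mp (transpose_mul_eigenvectorUnitary hA)

lemma cfc_eq_mul_diagonal_mul {A : Matrix n n ℝ} (hA : A.IsHermitian) (f : ℝ → ℝ) :
    cfc f A = (hA.eigenvectorUnitary : Matrix n n ℝ) * Matrix.diagonal (f ∘ hA.eigenvalues) *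
      (hA.eigenvectorUnitary : Matrix n n ℝ)ᵀ := by
  rw [hA.cfc_eq, Matrix.IsHermitian.cfc, Unitary.conjStarAlgAut_apply,
    Matrix.star_eq_conjTranspose, Matrix.conjTranspose_eq_transpose_of_trivial]
  rfl

lemma cfc_id_eq_self {A : Matrix n n ℝ} (hA : A.IsHermitian) : cfc (fun x : ℝ => x) A = A :=
  cfc_id' ℝ A (show IsSelfAdjoint A from hA)

lemma eq_mul_diagonal_mul {A : Matrix n n ℝ} (hA : A.IsHermitian) :
    A = (hA.eigenvectorUnitary : Matrix n n ℝ) * Matrix.diagonal hA.eigenvalues *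
      (hA.eigenvectorUnitary : Matrix n n ℝ)ᵀ := by
  have h := cfc_eq_mul_diagonal_mul hA fun x => x
  rwa [cfc_id_eq_self hA] at h

lemma eigenOverlap_mul_transpose {A B : Matrix n n ℝ} (hA : A.IsHermitian) (hB : B.IsHermitian) :
    eigenOverlap hA hB * (eigenOverlap hA hB)ᵀ = 1 := by
  rw [eigenOverlap, Matrix.transpose_mul, Matrix.transpose_transpose, Matrix.mul_assoc,
    ← Matrix.mul_assoc _ _ (hA.eigenvectorUnitary : Matrix n n ℝ),
    eigenvectorUnitary_mul_transpose, Matrix.one_mul, transpose_mul_eigenvectorUnitary]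

/-- Orthogonality makes the squared overlaps a doubly stochastic array. These are the weights that
turn noncommutative traces into averages of scalar expressions. -/
lemma sum_eigenOverlap_sq_row {A B : Matrix n n ℝ} (hA : A.IsHermitian) (hB : B.IsHermitian)
    (i : n) : ∑ j, eigenOverlap hA hB i j ^ 2 = 1 := by
  have h := congrFun (congrFun (eigenOverlap_mul_transpose hA hB) i) i
  rw [Matrix.mul_apply] at h
  simpa [sq] using h

lemma sum_eigenOverlap_sq_col {A B : Matrix n n ℝ} (hA : A.IsHermitian) (hB : B.IsHermitian)
    (j : n) : ∑ i, eigenOverlap hA hB i j ^ 2 = 1 := by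
  have h1 := mul_eq_one_comm.mp (eigenOverlap_mul_transpose hA hB)
  have h := congrFun (congrFun h1 j) j
  rw [Matrix.mul_apply] at h
  simpa [sq] using h

lemma trace_transpose_mul {m : Type*} [Fintype m] (A B : Matrix m m ℝ) : (Aᵀ * B).trace = ∑ i, ∑ j, A i j * B i j := by
  simp only [Matrix.trace, Matrix.diag_apply, Matrix.mul_apply, Matrix.transpose_apply]
  rw [Finset.sum_comm]

/-- In the two eigenbases only squared overlaps survive, so an inequality between traces of this
kind can be checked on pairs of eigenvalues. -/
lemma trace_cfc_mul_cfc {A B : Matrix n n ℝ} (hA : A.IsHermitian) (hB : B.IsHermitian)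
    (f g : ℝ → ℝ) :
    (cfc f A * cfc g B).trace =
      ∑ i, ∑ j, eigenOverlap hA hB i j ^ 2 * (f (hA.eigenvalues i) * g (hB.eigenvalues j)) := by
  rw [cfc_eq_mul_diagonal_mul hA, cfc_eq_mul_diagonal_mul hB]
  set U : Matrix n n ℝ := (hA.eigenvectorUnitary : Matrix n n ℝ) with hU
  set V : Matrix n n ℝ := (hB.eigenvectorUnitary : Matrix n n ℝ) with hV
  have h : (U * Matrix.diagonal (f ∘ hA.eigenvalues) * Uᵀ *
      (V * Matrix.diagonal (g ∘ hB.eigenvalues) * Vᵀ)).trace =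
      ((eigenOverlap hA hB)ᵀ * (Matrix.diagonal (f ∘ hA.eigenvalues) * eigenOverlap hA hB *
        Matrix.diagonal (g ∘ hB.eigenvalues))).trace := by
    rw [← Matrix.mul_assoc, Matrix.trace_mul_comm]
    simp only [eigenOverlap, Matrix.transpose_mul, Matrix.transpose_transpose, Matrix.mul_assoc,
      ← hU, ← hV]
  rw [h, trace_transpose_mul]
  refine Finset.sum_congr rfl fun i _ => Finset.sum_congr rfl fun j _ => ?_
  rw [Matrix.mul_diagonal, Matrix.diagonal_mul]
  simp only [Function.comp_apply]
  ring

lemma trace_cfc {A : Matrix n n ℝ} (hA : A.IsHermitian) (f : ℝ → ℝ) :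
    (cfc f A).trace = ∑ i, f (hA.eigenvalues i) := by
  rw [cfc_eq_mul_diagonal_mul hA, Matrix.trace_mul_comm, ← Matrix.mul_assoc,
    transpose_mul_eigenvectorUnitary, Matrix.one_mul, Matrix.trace_diagonal]
  rfl

/-- Padding with weights of total mass one puts a trace in one matrix under the same double sum as
the mixed traces, ready for a termwise comparison. -/
lemma trace_cfc_left {A B : Matrix n n ℝ} (hA : A.IsHermitian) (hB : B.IsHermitian)
    (f : ℝ → ℝ) :
    (cfc f A).trace = ∑ i, ∑ j, eigenOverlap hA hB i j ^ 2 * f (hA.eigenvalues i) := by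
  simp_rw [trace_cfc hA, ← Finset.sum_mul, sum_eigenOverlap_sq_row, one_mul]

lemma trace_cfc_right {A B : Matrix n n ℝ} (hA : A.IsHermitian) (hB : B.IsHermitian)
    (f : ℝ → ℝ) :
    (cfc f B).trace = ∑ i, ∑ j, eigenOverlap hA hB i j ^ 2 * f (hB.eigenvalues j) := by
  rw [Finset.sum_comm]
  simp_rw [trace_cfc hB, ← Finset.sum_mul, sum_eigenOverlap_sq_col, one_mul]

lemma isHermitian_cfc (f : ℝ → ℝ) (A : Matrix n n ℝ) : (cfc f A).IsHermitian :=
  (cfc_predicate f A : IsSelfAdjoint (cfc f A))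

/-- The spectrum is finite, so continuity is automatic. This is what allows `log` near zero, the
influence function and indicator functions in the functional calculus. -/
lemma continuousOn_spectrum (f : ℝ → ℝ) (A : Matrix n n ℝ) : ContinuousOn f (spectrum ℝ A) :=
  (Matrix.finite_real_spectrum (A := A)).continuousOn f

lemma posSemidef_cfc {A : Matrix n n ℝ} (hA : A.IsHermitian) {f : ℝ → ℝ}
    (hf : ∀ i, 0 ≤ f (hA.eigenvalues i)) : (cfc f A).PosSemidef := by
  rw [cfc_eq_mul_diagonal_mul hA, ← Matrix.conjTranspose_eq_transpose_of_trivial]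
  exact (Matrix.PosSemidef.diagonal fun i => hf i).mul_mul_conjTranspose_same _

lemma posDef_cfc {A : Matrix n n ℝ} (hA : A.IsHermitian) {f : ℝ → ℝ}
    (hf : ∀ i, 0 < f (hA.eigenvalues i)) : (cfc f A).PosDef := by
  rw [(posSemidef_cfc hA fun i => (hf i).le).posDef_iff_det_ne_zero,
    cfc_eq_mul_diagonal_mul hA, Matrix.det_mul_right_comm, eigenvectorUnitary_mul_transpose,
    Matrix.one_mul, Matrix.det_diagonal]
  exact Finset.prod_ne_zero_iff.mpr fun i _ => (hf i).ne'

lemma cfc_log_cfc_exp {A : Matrix n n ℝ} (hA : A.IsHermitian) :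
    cfc Real.log (cfc Real.exp A) = A := by
  have h : cfc (fun x => Real.log (Real.exp x)) A = cfc Real.log (cfc Real.exp A) :=
    cfc_comp' Real.log Real.exp A
      ((((Matrix.finite_real_spectrum (A := A)).image _)).continuousOn _)
      (continuousOn_spectrum _ _) (show IsSelfAdjoint A from hA)
  rw [← h]
  simp only [Real.log_exp]
  exact cfc_id_eq_self hA

/-- Multiplication by the matrix itself inside the functional calculus. -/
lemma self_mul_cfc {A : Matrix n n ℝ} (hA : A.IsHermitian) (f : ℝ → ℝ) :
    A * cfc f A = cfc (fun x => x * f x) A := by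
  rw [cfc_mul (fun x : ℝ => x) f A (continuousOn_spectrum _ _) (continuousOn_spectrum _ _),
    cfc_id_eq_self hA]

/-- **Gibbs variational inequality.** -/
lemma gibbs_le {T K : Matrix n n ℝ} (hT : T.PosDef) (hK : K.IsHermitian) :
    (T * K).trace - (T * cfc Real.log T).trace + T.trace ≤ (cfc Real.exp K).trace := by
  have h1 := trace_cfc_mul_cfc hT.1 hK (fun x => x) fun x => x
  have h3 := trace_cfc_left hT.1 hK fun x => x
  rw [cfc_id_eq_self hT.1, cfc_id_eq_self hK] at h1
  rw [cfc_id_eq_self hT.1] at h3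
  rw [h1, self_mul_cfc hT.1, h3, trace_cfc_left hT.1 hK, trace_cfc_right hT.1 hK]
  simp_rw [← Finset.sum_sub_distrib, ← Finset.sum_add_distrib]
  refine Finset.sum_le_sum fun i _ => Finset.sum_le_sum fun j _ => ?_
  have hτ := hT.eigenvalues_pos i
  set τ := hT.1.eigenvalues i
  set k := hK.eigenvalues j
  -- This is `1 + x ≤ exp x` at `x = k - log τ`, multiplied by `τ`.
  have h4 : τ * k - τ * Real.log τ + τ ≤ Real.exp k := by
    have := Real.add_one_le_exp (k - Real.log τ)
    rw [Real.exp_sub, Real.exp_log hτ, le_div_iff₀ hτ] at this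
    linarith
  nlinarith [mul_le_mul_of_nonneg_left h4 (sq_nonneg (eigenOverlap hT.1 hK i j))]

/-- The maximizer in Gibbs' principle is `T = exp K`, where the logarithm cancels against `K`. -/
lemma gibbs_eq {K : Matrix n n ℝ} (hK : K.IsHermitian) :
    (cfc Real.exp K).trace = (cfc Real.exp K * K).trace -
      (cfc Real.exp K * cfc Real.log (cfc Real.exp K)).trace + (cfc Real.exp K).trace := by
  rw [cfc_log_cfc_exp hK]; ring

lemma posDef_cfc_exp {K : Matrix n n ℝ} (hK : K.IsHermitian) : (cfc Real.exp K).PosDef :=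
  posDef_cfc hK fun _ => Real.exp_pos _

lemma trace_mul_nonneg {A B : Matrix n n ℝ} (hA : A.PosSemidef) (hB : B.PosSemidef) :
    0 ≤ (A * B).trace := by
  have h := trace_cfc_mul_cfc hA.1 hB.1 (fun x => x) fun x => x
  rw [cfc_id_eq_self hA.1, cfc_id_eq_self hB.1] at h
  rw [h]
  exact Finset.sum_nonneg fun i _ => Finset.sum_nonneg fun j _ =>
    mul_nonneg (sq_nonneg _) (mul_nonneg (hA.eigenvalues_nonneg i) (hB.eigenvalues_nonneg j))

/-- The trace exponential is monotone in the Loewner order. -/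
lemma trace_exp_mono {A B : Matrix n n ℝ} (hA : A.IsHermitian) (hB : B.IsHermitian)
    (h : (B - A).PosSemidef) : (cfc Real.exp A).trace ≤ (cfc Real.exp B).trace := by
  -- The maximizer `exp A` for `A` serves as a trial state for `B`; the two Gibbs functionals differ
  -- by `tr (exp A (B - A)) ≥ 0`.
  have hT := posDef_cfc_exp hA
  have h1 := gibbs_le hT hB
  have h2 := gibbs_eq hA
  have h3 := trace_mul_nonneg hT.posSemidef h
  rw [Matrix.mul_sub, Matrix.trace_sub] at h3
  linarith

end TraceInequalities

end LowPop

/-! ### Joint convexity of relative entropy and Lieb's concavity theorem. -/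

namespace LowPop

section Lieb

variable {n : Type*} [Fintype n] [DecidableEq n]

/-- The quantum relative entropy `tr (T log T - T log A - T + A)`. -/
noncomputable def relEntropy (T A : Matrix n n ℝ) : ℝ :=
  (T * cfc Real.log T).trace - (T * cfc Real.log A).trace - T.trace + A.trace

/-- The quadratic quasi-entropy that represents the relative entropy as a mixture. -/
noncomputable def quasiEntropy (t : ℝ) {T A : Matrix n n ℝ} (hT : T.IsHermitian)
    (hA : A.IsHermitian) : ℝ :=
  ∑ i, ∑ j, eigenOverlap hT hA i j ^ 2 *
    ((hA.eigenvalues j - hT.eigenvalues i) ^ 2 / (hA.eigenvalues j + t * hT.eigenvalues i))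

/-- The trial functional whose supremum over `Z` is the quasi-entropy. -/
noncomputable def trialFunctional (t : ℝ) (Z T A : Matrix n n ℝ) : ℝ :=
  2 * (Zᵀ * (T - A)).trace - (Zᵀ * (Z * A)).trace - t * (Zᵀ * (T * Z)).trace

/-- Writing the trial matrix as `U Y Vᵀ` in the eigenbases of `T` and `A` decouples the functional
into one concave quadratic for each entry of `Y`. -/
lemma trialFunctional_eq (t : ℝ) (Y : Matrix n n ℝ) {T A : Matrix n n ℝ} (hT : T.IsHermitian)
    (hA : A.IsHermitian) :
    trialFunctional t ((hT.eigenvectorUnitary : Matrix n n ℝ) * Y *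
      (hA.eigenvectorUnitary : Matrix n n ℝ)ᵀ) T A =
    ∑ i, ∑ j, (2 * (Y i j * (eigenOverlap hT hA i j *
      (hT.eigenvalues i - hA.eigenvalues j))) -
      Y i j ^ 2 * (hA.eigenvalues j + t * hT.eigenvalues i)) := by
  have hT' := eq_mul_diagonal_mul hT
  have hA' := eq_mul_diagonal_mul hA
  have hU := transpose_mul_eigenvectorUnitary hT
  have hV := transpose_mul_eigenvectorUnitary hA
  have hW : eigenOverlap hT hA = (hT.eigenvectorUnitary : Matrix n n ℝ)ᵀ *
    (hA.eigenvectorUnitary : Matrix n n ℝ) := rfl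
  set U : Matrix n n ℝ := (hT.eigenvectorUnitary : Matrix n n ℝ)
  set V : Matrix n n ℝ := (hA.eigenvectorUnitary : Matrix n n ℝ)
  set W := eigenOverlap hT hA
  set τ := hT.eigenvalues
  set a := hA.eigenvalues
  have hUX : ∀ X : Matrix n n ℝ, Uᵀ * (U * X) = X := fun X => by
    rw [← Matrix.mul_assoc, hU, Matrix.one_mul]
  have hVX : ∀ X : Matrix n n ℝ, Vᵀ * (V * X) = X := fun X => by
    rw [← Matrix.mul_assoc, hV, Matrix.one_mul]
  have cyc : ∀ X : Matrix n n ℝ, (V * X).trace = (X * V).trace := fun X => Matrix.trace_mul_comm _ _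
  have e1 : ((U * Y * Vᵀ)ᵀ * T).trace = (Yᵀ * (Matrix.diagonal τ * W)).trace := by
    rw [hT', Matrix.transpose_mul, Matrix.transpose_mul, Matrix.transpose_transpose,
      Matrix.mul_assoc, cyc, hW]
    simp only [Matrix.mul_assoc, hUX]
  have e2 : ((U * Y * Vᵀ)ᵀ * A).trace = (Yᵀ * (W * Matrix.diagonal a)).trace := by
    rw [hA', Matrix.transpose_mul, Matrix.transpose_mul, Matrix.transpose_transpose,
      Matrix.mul_assoc, cyc, hW]
    simp only [Matrix.mul_assoc, hV, Matrix.mul_one]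
  have e3 : ((U * Y * Vᵀ)ᵀ * ((U * Y * Vᵀ) * A)).trace = (Yᵀ * (Y * Matrix.diagonal a)).trace := by
    rw [hA', Matrix.transpose_mul, Matrix.transpose_mul, Matrix.transpose_transpose,
      Matrix.mul_assoc, cyc]
    simp only [Matrix.mul_assoc, hV, hUX, hVX, Matrix.mul_one]
  have e4 : ((U * Y * Vᵀ)ᵀ * (T * (U * Y * Vᵀ))).trace = (Yᵀ * (Matrix.diagonal τ * Y)).trace := by
    rw [hT', Matrix.transpose_mul, Matrix.transpose_mul, Matrix.transpose_transpose,
      Matrix.mul_assoc, cyc]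
    simp only [Matrix.mul_assoc, hV, hUX, Matrix.mul_one]
  rw [trialFunctional, Matrix.mul_sub, Matrix.trace_sub, e1, e2, e3, e4]
  simp only [trace_transpose_mul, Matrix.mul_diagonal, Matrix.diagonal_mul, Finset.mul_sum,
    ← Finset.sum_sub_distrib]
  refine Finset.sum_congr rfl fun i _ => Finset.sum_congr rfl fun j _ => ?_
  ring

/-- Every matrix has the form `U Y Vᵀ`, and completing the square in each entry of `Y` bounds the
quadratic by the matching term of the quasi-entropy. -/
lemma trialFunctional_le {t : ℝ} (ht : 0 ≤ t) (Z : Matrix n n ℝ) {T A : Matrix n n ℝ}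
    (hT : T.PosDef) (hA : A.PosDef) :
    trialFunctional t Z T A ≤ quasiEntropy t hT.1 hA.1 := by
  have hZ : Z = (hT.1.eigenvectorUnitary : Matrix n n ℝ) *
      ((hT.1.eigenvectorUnitary : Matrix n n ℝ)ᵀ * Z * (hA.1.eigenvectorUnitary : Matrix n n ℝ)) *
      (hA.1.eigenvectorUnitary : Matrix n n ℝ)ᵀ := by
    simp only [← Matrix.mul_assoc, eigenvectorUnitary_mul_transpose, Matrix.one_mul]
    rw [Matrix.mul_assoc, eigenvectorUnitary_mul_transpose, Matrix.mul_one]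
  rw [hZ, trialFunctional_eq, quasiEntropy]
  refine Finset.sum_le_sum fun i _ => Finset.sum_le_sum fun j _ => ?_
  have hτ := hT.eigenvalues_pos i
  have ha := hA.eigenvalues_pos j
  have hp : 0 < hA.1.eigenvalues j + t * hT.1.eigenvalues i := by positivity
  rw [← mul_div_assoc, le_div_iff₀ hp]
  generalize ((hT.1.eigenvectorUnitary : Matrix n n ℝ)ᵀ * Z *
    (hA.1.eigenvectorUnitary : Matrix n n ℝ)) i j = y
  nlinarith [sq_nonneg (y * (hA.1.eigenvalues j + t * hT.1.eigenvalues i) -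
    eigenOverlap hT.1 hA.1 i j * (hT.1.eigenvalues i - hA.1.eigenvalues j))]

/-- The entrywise vertex `y = w (τ - a) / (a + t τ)` of the quadratics attains the bound. -/
lemma exists_trialFunctional_eq {t : ℝ} (ht : 0 ≤ t) {T A : Matrix n n ℝ}
    (hT : T.PosDef) (hA : A.PosDef) :
    ∃ Z, trialFunctional t Z T A = quasiEntropy t hT.1 hA.1 := by
  refine ⟨_, (trialFunctional_eq t (Matrix.of fun i j => eigenOverlap hT.1 hA.1 i j *
    (hT.1.eigenvalues i - hA.1.eigenvalues j) /
    (hA.1.eigenvalues j + t * hT.1.eigenvalues i)) hT.1 hA.1).trans ?_⟩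
  rw [quasiEntropy]
  refine Finset.sum_congr rfl fun i _ => Finset.sum_congr rfl fun j _ => ?_
  have hτ := hT.eigenvalues_pos i
  have ha := hA.eigenvalues_pos j
  have hp : hA.1.eigenvalues j + t * hT.1.eigenvalues i ≠ 0 := by positivity
  simp only [Matrix.of_apply]
  field_simp
  ring

/-- For fixed `Z` the trial functional is linear in `(T, A)` jointly, so its supremum over `Z` is
convex. Here `Z` is optimal for the combination and merely admissible at the endpoints. -/
lemma quasiEntropy_convex {t : ℝ} (ht : 0 ≤ t) {T₁ T₂ A₁ A₂ : Matrix n n ℝ}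
    (hT₁ : T₁.PosDef) (hT₂ : T₂.PosDef) (hA₁ : A₁.PosDef) (hA₂ : A₂.PosDef) {a b : ℝ}
    (ha : 0 ≤ a) (hb : 0 ≤ b) (hT : (a • T₁ + b • T₂).PosDef) (hA : (a • A₁ + b • A₂).PosDef) :
    quasiEntropy t hT.1 hA.1 ≤
      a * quasiEntropy t hT₁.1 hA₁.1 + b * quasiEntropy t hT₂.1 hA₂.1 := by
  obtain ⟨Z, hZ⟩ := exists_trialFunctional_eq ht hT hA
  have h : trialFunctional t Z (a • T₁ + b • T₂) (a • A₁ + b • A₂) =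
      a * trialFunctional t Z T₁ A₁ + b * trialFunctional t Z T₂ A₂ := by
    simp only [trialFunctional, Matrix.mul_sub, Matrix.mul_add, Matrix.add_mul, Matrix.mul_smul,
      Matrix.smul_mul, Matrix.trace_add, Matrix.trace_sub, Matrix.trace_smul, smul_eq_mul]
    ring
  rw [← hZ, h]
  gcongr
  · exact trialFunctional_le ht Z hT₁ hA₁
  · exact trialFunctional_le ht Z hT₂ hA₂

open Set Filter Topology in
-- Scalar relative entropy is a positive mixture over `t` of the fractions in the quasi-entropy. An
-- explicit antiderivative with a limit at infinity gives integrability, as the integrand is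
-- nonnegative, together with the value.
lemma integrableOn_and_integral_sq_div {τ a : ℝ} (hτ : 0 < τ) (ha : 0 < a) :
    IntegrableOn (fun t : ℝ => (a - τ) ^ 2 / (a + t * τ) * ((1 + t) ^ 2)⁻¹) (Ioi 0) ∧
    ∫ t in Ioi (0 : ℝ), (a - τ) ^ 2 / (a + t * τ) * ((1 + t) ^ 2)⁻¹ =
      τ * Real.log τ - τ * Real.log a - τ + a := by
  -- `F` tends to `τ log τ` at infinity and equals `τ log a - (a - τ)` at `0`; the difference is the
  -- claimed integral.
  set F : ℝ → ℝ := fun t => τ * Real.log ((a + t * τ) / (1 + t)) - (a - τ) / (1 + t) with hF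
  have hd : ∀ t ∈ Ici (0 : ℝ),
      HasDerivAt F ((a - τ) ^ 2 / (a + t * τ) * ((1 + t) ^ 2)⁻¹) t := by
    intro t ht
    have ht : 0 ≤ t := ht
    have h1 : (1 + t) ≠ 0 := by positivity
    have h2 : a + t * τ ≠ 0 := by positivity
    have d1 : HasDerivAt (fun t : ℝ => 1 + t) 1 t := (hasDerivAt_id t).const_add 1
    have d2 : HasDerivAt (fun t : ℝ => a + t * τ) τ t := by
      simpa using ((hasDerivAt_id t).mul_const τ).const_add a
    have d3 := (((d2.div d1 h1).log (div_ne_zero h2 h1)).const_mul τ).sub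
      ((hasDerivAt_const t (a - τ)).div d1 h1)
    refine d3.congr_deriv ?_
    simp only [Pi.div_apply]
    field_simp
    ring
  have hnn : ∀ t ∈ Ioi (0 : ℝ), 0 ≤ (a - τ) ^ 2 / (a + t * τ) * ((1 + t) ^ 2)⁻¹ := by
    intro t ht
    have ht : 0 < t := ht
    positivity
  have hlim : Tendsto F atTop (𝓝 (τ * Real.log τ - 0)) := by
    have h1 : Tendsto (fun t : ℝ => 1 + t) atTop atTop := tendsto_atTop_add_const_left _ _ tendsto_id
    have h2 : Tendsto (fun t : ℝ => (a - τ) / (1 + t)) atTop (𝓝 0) := h1.const_div_atTop _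
    have h3 : Tendsto (fun t : ℝ => (a + t * τ) / (1 + t)) atTop (𝓝 τ) := by
      have : Tendsto (fun t : ℝ => τ + (a - τ) / (1 + t)) atTop (𝓝 (τ + 0)) := h2.const_add τ
      rw [add_zero] at this
      refine this.congr' ?_
      filter_upwards [eventually_gt_atTop 0] with t ht
      field_simp
      ring
    exact ((h3.log hτ.ne').const_mul τ).sub h2
  refine ⟨integrableOn_Ioi_deriv_of_nonneg' hd hnn hlim, ?_⟩
  rw [integral_Ioi_of_hasDerivAt_of_nonneg' hd hnn hlim]
  simp only [hF]
  norm_num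
  ring

open Set in
lemma integrableOn_and_integral_quasiEntropy {T A : Matrix n n ℝ} (hT : T.PosDef)
    (hA : A.PosDef) :
    IntegrableOn (fun t : ℝ => quasiEntropy t hT.1 hA.1 * ((1 + t) ^ 2)⁻¹) (Ioi 0) ∧
    ∫ t in Ioi (0 : ℝ), quasiEntropy t hT.1 hA.1 * ((1 + t) ^ 2)⁻¹ = relEntropy T A := by
  have hint := fun i j => (integrableOn_and_integral_sq_div (hT.eigenvalues_pos i)
    (hA.eigenvalues_pos j)).1.const_mul (eigenOverlap hT.1 hA.1 i j ^ 2)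
  have hval := fun i j => (integrableOn_and_integral_sq_div (hT.eigenvalues_pos i)
    (hA.eigenvalues_pos j)).2
  simp only [quasiEntropy, Finset.sum_mul, mul_assoc]
  refine ⟨integrable_finsetSum _ fun i _ => integrable_finsetSum _ fun j _ => hint i j, ?_⟩
  rw [integral_finsetSum _ fun i _ => integrable_finsetSum _ fun j _ => hint i j]
  simp_rw [integral_finsetSum _ fun j _ => hint _ j, integral_const_mul, hval]
  have h1 := trace_cfc_mul_cfc hT.1 hA.1 (fun x => x) Real.log
  have h2 := trace_cfc_left hT.1 hA.1 fun x => x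
  have h3 := trace_cfc_right hT.1 hA.1 fun x => x
  rw [cfc_id_eq_self hT.1] at h1 h2
  rw [cfc_id_eq_self hA.1] at h3
  rw [relEntropy, self_mul_cfc hT.1, h1, h2, h3, trace_cfc_left hT.1 hA.1]
  simp only [← Finset.sum_sub_distrib, ← Finset.sum_add_distrib]
  refine Finset.sum_congr rfl fun i _ => Finset.sum_congr rfl fun j _ => ?_
  ring

/-- Joint convexity of the relative entropy. -/
lemma relEntropy_convex {T₁ T₂ A₁ A₂ : Matrix n n ℝ}
    (hT₁ : T₁.PosDef) (hT₂ : T₂.PosDef) (hA₁ : A₁.PosDef) (hA₂ : A₂.PosDef) {a b : ℝ}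
    (ha : 0 ≤ a) (hb : 0 ≤ b) (hT : (a • T₁ + b • T₂).PosDef) (hA : (a • A₁ + b • A₂).PosDef) :
    relEntropy (a • T₁ + b • T₂) (a • A₁ + b • A₂) ≤
      a * relEntropy T₁ A₁ + b * relEntropy T₂ A₂ := by
  obtain ⟨i₁, e₁⟩ := integrableOn_and_integral_quasiEntropy hT₁ hA₁
  obtain ⟨i₂, e₂⟩ := integrableOn_and_integral_quasiEntropy hT₂ hA₂
  obtain ⟨i, e⟩ := integrableOn_and_integral_quasiEntropy hT hA
  rw [← e, ← e₁, ← e₂, ← integral_const_mul, ← integral_const_mul,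
    ← integral_add (i₁.const_mul a) (i₂.const_mul b)]
  refine setIntegral_mono_on i ((i₁.const_mul a).add (i₂.const_mul b)) measurableSet_Ioi
    fun t ht => ?_
  have h := quasiEntropy_convex (le_of_lt ht) hT₁ hT₂ hA₁ hA₂ ha hb hT hA
  have := mul_le_mul_of_nonneg_right h (inv_nonneg.mpr (sq_nonneg (1 + t)))
  linarith

/-- The function `A ↦ tr exp (H + log A)` of Lieb's theorem. -/
noncomputable def liebTrace (H A : Matrix n n ℝ) : ℝ :=
  (cfc Real.exp (H + cfc Real.log A)).trace

lemma posDef_convex_combination {m : Type*} {A₁ A₂ : Matrix m m ℝ} (hA₁ : A₁.PosDef) (hA₂ : A₂.PosDef)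
    {a b : ℝ} (ha : 0 ≤ a) (hb : 0 ≤ b) (hab : a + b = 1) : (a • A₁ + b • A₂).PosDef := by
  rcases ha.eq_or_lt with rfl | ha
  · have : b = 1 := by linarith
    simpa [this] using hA₂
  · exact (hA₁.smul ha).add_posSemidef (hA₂.posSemidef.smul hb)

/-- **Lieb's concavity theorem** for `A ↦ tr exp (H + log A)`. -/
theorem liebTrace_concave {H A₁ A₂ : Matrix n n ℝ} (hH : H.IsHermitian) (hA₁ : A₁.PosDef)
    (hA₂ : A₂.PosDef) {a b : ℝ} (ha : 0 ≤ a) (hb : 0 ≤ b) (hab : a + b = 1) :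
    a * liebTrace H A₁ + b * liebTrace H A₂ ≤ liebTrace H (a • A₁ + b • A₂) := by
  have hK : ∀ A, (H + cfc Real.log A).IsHermitian := fun A => hH.add (isHermitian_cfc _ _)
  -- The equality case of Gibbs' principle for `K = H + log A`, with the logarithmic terms regrouped
  -- into the relative entropy.
  have key : ∀ A, liebTrace H A = (cfc Real.exp (H + cfc Real.log A) * H).trace -
      relEntropy (cfc Real.exp (H + cfc Real.log A)) A + A.trace := by
    intro A
    have := gibbs_eq (hK A)
    rw [Matrix.mul_add, Matrix.trace_add] at this
    rw [liebTrace, relEntropy]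
    linarith
  have hT₁ := posDef_cfc_exp (hK A₁)
  have hT₂ := posDef_cfc_exp (hK A₂)
  have hT := posDef_convex_combination hT₁ hT₂ ha hb hab
  have hA := posDef_convex_combination hA₁ hA₂ ha hb hab
  have h1 := relEntropy_convex hT₁ hT₂ hA₁ hA₂ ha hb hT hA
  -- The same combination of the two endpoint maximizers is a trial state for the combined matrix;
  -- joint convexity of the entropy compares the values.
  have h2 := gibbs_le hT (hK (a • A₁ + b • A₂))
  rw [Matrix.mul_add, Matrix.trace_add] at h2
  rw [key A₁, key A₂, liebTrace]
  rw [relEntropy] at h1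
  simp only [Matrix.add_mul, Matrix.smul_mul, Matrix.trace_add, Matrix.trace_smul,
    smul_eq_mul] at h1 h2
  linarith

end Lieb

end LowPop

/-! ### Measurability of the functional calculus. -/

namespace LowPop

section Measurability

variable {m n : Type*} [Fintype m] [Fintype n]

instance : BorelSpace (Matrix m n ℝ) := inferInstanceAs (BorelSpace (m → n → ℝ))

instance : SecondCountableTopology (Matrix m n ℝ) :=
  inferInstanceAs (SecondCountableTopology (m → n → ℝ))

instance : TopologicalSpace.PseudoMetrizableSpace (Matrix m n ℝ) :=
  inferInstanceAs (TopologicalSpace.PseudoMetrizableSpace (m → n → ℝ))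

variable [DecidableEq n] {Ω : Type*} [MeasurableSpace Ω] {A : Ω → Matrix n n ℝ}

/-- For a fixed matrix the eigenvectors do not move, so only finitely many scalar values have to
converge. Pointwise limits of functions therefore preserve measurability, with no measurable choice
of eigenvectors. -/
lemma tendsto_cfc {M : Matrix n n ℝ} (hM : M.IsHermitian) {F : ℕ → ℝ → ℝ} {f : ℝ → ℝ}
    (h : ∀ x, Filter.Tendsto (fun k => F k x) Filter.atTop (nhds (f x))) :
    Filter.Tendsto (fun k => cfc (F k) M) Filter.atTop (nhds (cfc f M)) := by
  simp_rw [cfc_eq_mul_diagonal_mul hM]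
  have hc : Continuous fun d : n → ℝ => (hM.eigenvectorUnitary : Matrix n n ℝ) *
      Matrix.diagonal d * (hM.eigenvectorUnitary : Matrix n n ℝ)ᵀ := by fun_prop
  exact (hc.tendsto _).comp (tendsto_pi_nhds.mpr fun i => h _)

lemma measurable_cfc_of_tendsto (hA : ∀ ω, (A ω).IsHermitian) {F : ℕ → ℝ → ℝ} {f : ℝ → ℝ}
    (hF : ∀ k, Measurable fun ω => cfc (F k) (A ω))
    (h : ∀ x, Filter.Tendsto (fun k => F k x) Filter.atTop (nhds (f x))) :
    Measurable fun ω => cfc f (A ω) :=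
  measurable_of_tendsto_metrizable hF (tendsto_pi_nhds.mpr fun ω => tendsto_cfc (hA ω) h)

/-- Polynomials in a matrix are continuous in it. Approximation within `1 / (k + 1)` on `[-k, k]`
gives pointwise convergence on the whole line. -/
lemma measurable_cfc_of_continuous (hm : Measurable A) (hA : ∀ ω, (A ω).IsHermitian)
    {f : ℝ → ℝ} (hf : Continuous f) : Measurable fun ω => cfc f (A ω) := by
  have hp : ∀ k : ℕ, ∃ p : Polynomial ℝ, ∀ x ∈ Set.Icc (-(k : ℝ)) k,
      |p.eval x - f x| < 1 / ((k : ℝ) + 1) := fun k =>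
    exists_polynomial_near_of_continuousOn _ _ f hf.continuousOn _ (by positivity)
  choose p hp using hp
  refine measurable_cfc_of_tendsto hA (F := fun k => (p k).eval) (fun k => ?_) fun x => ?_
  · have : (fun ω => cfc (p k).eval (A ω)) = fun ω => Polynomial.aeval (A ω) (p k) :=
      funext fun ω => cfc_polynomial (p k) (A ω) (show IsSelfAdjoint (A ω) from hA ω)
    rw [this]
    exact (Polynomial.continuous_aeval (p k)).measurable.comp hm
  · rw [tendsto_iff_dist_tendsto_zero]
    refine squeeze_zero' (Filter.Eventually.of_forall fun _ => dist_nonneg) ?_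
      tendsto_one_div_add_atTop_nhds_zero_nat
    obtain ⟨N, hN⟩ := exists_nat_ge |x|
    filter_upwards [Filter.eventually_ge_atTop N] with k hk
    have : |x| ≤ k := hN.trans (by exact_mod_cast hk)
    exact (hp k x (abs_le.mp this)).le

lemma measurable_cfc_add {f g : ℝ → ℝ} (hf : Measurable fun ω => cfc f (A ω))
    (hg : Measurable fun ω => cfc g (A ω)) : Measurable fun ω => cfc (f + g) (A ω) := by
  have : (fun ω => cfc (f + g) (A ω)) = fun ω => cfc f (A ω) + cfc g (A ω) := funext fun ω =>
    cfc_add (A ω) f g (continuousOn_spectrum _ _) (continuousOn_spectrum _ _)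
  rw [this]
  have hc : Continuous fun p : Matrix n n ℝ × Matrix n n ℝ => p.1 + p.2 := by fun_prop
  exact hc.measurable.comp (hf.prodMk hg)

lemma measurable_cfc_const_mul {f : ℝ → ℝ} (c : ℝ) (hf : Measurable fun ω => cfc f (A ω)) :
    Measurable fun ω => cfc (fun x => c * f x) (A ω) := by
  have : (fun ω => cfc (fun x => c * f x) (A ω)) = fun ω => c • cfc f (A ω) := funext fun ω =>
    cfc_const_mul c f (A ω) (continuousOn_spectrum _ _)
  rw [this]
  have hc : Continuous fun p : Matrix n n ℝ => c • p := by fun_prop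
  exact hc.measurable.comp hf

open Set in
-- A π-λ induction from half-lines: complements use linearity, disjoint unions use partial sums and
-- a pointwise limit.
lemma measurable_cfc_indicator (hm : Measurable A) (hA : ∀ ω, (A ω).IsHermitian) {s : Set ℝ}
    (hs : MeasurableSet s) : Measurable fun ω => cfc (s.indicator 1) (A ω) := by
  induction s, hs using MeasurableSpace.induction_on_inter
      (borel_eq_generateFrom_Iic ℝ ▸ BorelSpace.measurable_eq) isPiSystem_Iic with
  | empty =>
    simp
  | basic t ht =>
    obtain ⟨a, rfl⟩ := ht
    refine measurable_cfc_of_tendsto hA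
      -- Continuous ramps equal to `1` up to `a` and to `0` beyond `a + 1/k` for `k > 0`.
      (F := fun (k : ℕ) x => max 0 (1 - (k : ℝ) * max 0 (x - a)))
      (fun k => measurable_cfc_of_continuous hm hA (by fun_prop)) fun x => ?_
    by_cases hx : x ≤ a
    · simp [hx]
    · have hx' : 0 < x - a := by linarith [not_le.mp hx]
      rw [indicator_of_notMem (by simpa using hx)]
      obtain ⟨N, hN⟩ := exists_nat_ge (1 / (x - a))
      refine tendsto_const_nhds.congr' ?_
      filter_upwards [Filter.eventually_ge_atTop N] with k hk
      rw [max_eq_right hx'.le, max_eq_left]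
      have : 1 / (x - a) ≤ k := hN.trans (by exact_mod_cast hk)
      rw [div_le_iff₀ hx'] at this
      linarith
  | compl t ht ih =>
    have h := measurable_cfc_add
      (measurable_cfc_of_continuous hm hA (f := fun _ => 1) continuous_const)
      (measurable_cfc_const_mul (-1) ih)
    convert h using 4
    ext x
    by_cases hx : x ∈ t <;> simp [hx]
  | iUnion f hd hf ih =>
    refine measurable_cfc_of_tendsto hA
      (F := fun k => ∑ i ∈ Finset.range k, (f i).indicator 1) (fun k => ?_) fun x => ?_
    · induction k with
      | zero => simp
      | succ k ihk =>
        rw [Finset.sum_range_succ]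
        exact measurable_cfc_add ihk (ih k)
    · simp only [Finset.sum_apply]
      by_cases hx : ∃ i, x ∈ f i
      · obtain ⟨i, hi⟩ := hx
        rw [indicator_of_mem (mem_iUnion.mpr ⟨i, hi⟩)]
        refine tendsto_const_nhds.congr' ?_
        filter_upwards [Filter.eventually_gt_atTop i] with k hk
        rw [Finset.sum_eq_single_of_mem i (Finset.mem_range.mpr hk), indicator_of_mem hi]
        intro j _ hj
        exact indicator_of_notMem (fun h => (disjoint_left.mp (hd hj) h hi)) _
      · rw [indicator_of_notMem (by simpa using hx)]
        push Not at hx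
        simp [indicator_of_notMem (hx _)]

/-- The functional calculus of a measurable symmetric matrix is measurable. -/
theorem measurable_cfc (hm : Measurable A) (hA : ∀ ω, (A ω).IsHermitian) {f : ℝ → ℝ}
    (hf : Measurable f) : Measurable fun ω => cfc f (A ω) := by
  refine measurable_cfc_of_tendsto hA (F := fun k => hf.stronglyMeasurable.approx k)
    (fun k => ?_) hf.stronglyMeasurable.tendsto_approx
  induction hf.stronglyMeasurable.approx k using SimpleFunc.induction with
  | @const c s hs =>
    convert measurable_cfc_const_mul c (measurable_cfc_indicator hm hA hs) using 4
    rename_i x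
    by_cases hx : x ∈ s <;> simp [hx]
  | add _ hf hg => exact measurable_cfc_add hf hg

end Measurability
end LowPop

/-! ### Jensen's inequality for Lieb's function. -/

namespace LowPop

section Jensen

variable {n : Type*} [Fintype n] [DecidableEq n]

lemma liebTrace_nonneg {H A : Matrix n n ℝ} (hH : H.IsHermitian) : 0 ≤ liebTrace H A :=
  (posDef_cfc_exp (hH.add (isHermitian_cfc _ _))).posSemidef.trace_nonneg

lemma cfc_exp_add_smul_one {H : Matrix n n ℝ} (hH : H.IsHermitian) (c : ℝ) :
    cfc Real.exp (H + c • (1 : Matrix n n ℝ)) = Real.exp c • cfc Real.exp H := by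
  have h1 : H + c • (1 : Matrix n n ℝ) = cfc (fun x : ℝ => x + c) H := by
    rw [cfc_add_const c (fun x => x) H (continuousOn_spectrum _ _)
      (show IsSelfAdjoint H from hH), cfc_id_eq_self hH, Algebra.algebraMap_eq_smul_one]
  have h2 : cfc (fun x => Real.exp (x + c)) H = cfc Real.exp (cfc (fun x : ℝ => x + c) H) :=
    cfc_comp' Real.exp (fun x : ℝ => x + c) H Real.continuous_exp.continuousOn
      (continuousOn_spectrum _ _) (show IsSelfAdjoint H from hH)
  rw [h1, ← h2]
  have h3 : (fun x : ℝ => Real.exp (x + c)) = fun x => Real.exp c * Real.exp x := by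
    ext x; rw [add_comm, Real.exp_add]
  rw [h3]
  exact cfc_const_mul _ _ _ (continuousOn_spectrum _ _)

lemma cfc_const_eq_smul_one {A : Matrix n n ℝ} (hA : A.IsHermitian) (c : ℝ) :
    cfc (fun _ : ℝ => c) A = c • (1 : Matrix n n ℝ) := by
  rw [cfc_const c A (show IsSelfAdjoint A from hA), Algebra.algebraMap_eq_smul_one]

lemma cfc_sub_eq (f g : ℝ → ℝ) (A : Matrix n n ℝ) :
    cfc (fun x => f x - g x) A = cfc f A - cfc g A :=
  cfc_sub f g A (continuousOn_spectrum _ _) (continuousOn_spectrum _ _)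

/-- Each eigenvalue of `A` is at most its trace, so `log A ≤ log (tr A)` and the trace exponential
is monotone. The bound is linear in `A`, hence an integrable majorant in Jensen's inequality. -/
lemma liebTrace_le_trace_mul {H A : Matrix n n ℝ} (hH : H.IsHermitian) (hA : A.PosDef) :
    liebTrace H A ≤ A.trace * (cfc Real.exp H).trace := by
  rcases isEmpty_or_nonempty n with hn | hn
  · simp [liebTrace, Matrix.trace]
  have hpos : 0 < A.trace := hA.trace_pos
  have h : (H + Real.log A.trace • (1 : Matrix n n ℝ) - (H + cfc Real.log A)).PosSemidef := by
    rw [add_sub_add_left_eq_sub, ← cfc_const_eq_smul_one hA.1, ← cfc_sub_eq]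
    refine posSemidef_cfc hA.1 fun i => sub_nonneg.mpr (Real.log_le_log (hA.eigenvalues_pos i) ?_)
    have h1 := trace_cfc hA.1 fun x => x
    rw [cfc_id_eq_self hA.1] at h1
    rw [h1]
    exact Finset.single_le_sum (fun j _ => (hA.eigenvalues_pos j).le) (Finset.mem_univ i)
  have h2 := trace_exp_mono (hH.add (isHermitian_cfc _ _))
    (hH.add (Matrix.isHermitian_one.smul (IsSelfAdjoint.all _))) h
  rwa [cfc_exp_add_smul_one hH, Matrix.trace_smul, Real.exp_log hpos] at h2

/-- The symmetric part of a matrix. -/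
noncomputable def symPart {m : Type*} (M : Matrix m m ℝ) : Matrix m m ℝ := (1 / 2 : ℝ) • (M + Mᵀ)

lemma isHermitian_symPart {m : Type*} (M : Matrix m m ℝ) : (symPart M).IsHermitian := by
  rw [Matrix.IsHermitian, Matrix.conjTranspose_eq_transpose_of_trivial, symPart,
    Matrix.transpose_smul, Matrix.transpose_add, Matrix.transpose_transpose, add_comm]

lemma symPart_eq_self {m : Type*} {M : Matrix m m ℝ} (hM : M.IsHermitian) : symPart M = M := by
  rw [Matrix.IsHermitian, Matrix.conjTranspose_eq_transpose_of_trivial] at hM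
  rw [symPart, hM, ← two_smul ℝ M, smul_smul]
  norm_num

lemma dotProduct_symPart {m : Type*} [Fintype m] (M : Matrix m m ℝ) (v : m → ℝ) :
    v ⬝ᵥ (symPart M *ᵥ v) = v ⬝ᵥ (M *ᵥ v) := by
  have h : v ⬝ᵥ (Mᵀ *ᵥ v) = v ⬝ᵥ (M *ᵥ v) := by
    rw [Matrix.mulVec_transpose, dotProduct_comm, Matrix.dotProduct_mulVec]
  rw [symPart, Matrix.smul_mulVec, dotProduct_smul, Matrix.add_mulVec, dotProduct_add, h,
    smul_eq_mul]
  ring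

lemma symPart_combination {m : Type*} (a b : ℝ) (M N : Matrix m m ℝ) :
    symPart (a • M + b • N) = a • symPart M + b • symPart N := by
  ext i j
  simp [symPart]
  ring

lemma posSemidef_iff_dotProduct {m : Type*} [Fintype m] {M : Matrix m m ℝ} (hM : M.IsHermitian) :
    M.PosSemidef ↔ ∀ v, 0 ≤ v ⬝ᵥ (M *ᵥ v) := by
  simp only [Matrix.posSemidef_iff_dotProduct_mulVec, hM, true_and, star_trivial]

lemma posDef_of_forall_le {m : Type*} [Fintype m] {M : Matrix m m ℝ} (hM : M.IsHermitian) {ε : ℝ} (hε : 0 < ε)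
    (h : ∀ v, ε * (v ⬝ᵥ v) ≤ v ⬝ᵥ (M *ᵥ v)) : M.PosDef := by
  refine Matrix.PosDef.of_dotProduct_mulVec_pos hM fun v hv => ?_
  rw [star_trivial]
  refine lt_of_lt_of_le (mul_pos hε ?_) (h v)
  simpa using Matrix.dotProduct_star_self_pos_iff.mpr hv

lemma forall_le_dotProduct_iff {M : Matrix n n ℝ} (hM : M.IsHermitian) (ε : ℝ) :
    (M - ε • (1 : Matrix n n ℝ)).PosSemidef ↔ ∀ v, ε * (v ⬝ᵥ v) ≤ v ⬝ᵥ (M *ᵥ v) := by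
  rw [posSemidef_iff_dotProduct
    (hM.sub (Matrix.isHermitian_one.smul (IsSelfAdjoint.all _)))]
  simp [Matrix.sub_mulVec, Matrix.smul_mulVec, dotProduct_sub]

/-- Symmetric matrices generally have empty interior among all matrices, so concavity there would
not yield continuity. Extending through the symmetric part gives a domain with interior, and the
uniform bound `ε` survives an entrywise perturbation of size `ε / (2 c)`, which changes the
quadratic form by at most `ε / 2` times the squared norm. -/
lemma setOf_le_subset_interior {m : Type*} [Fintype m] {ε : ℝ} (hε : 0 < ε) :
    {M : m → m → ℝ | ∀ v, ε * (v ⬝ᵥ v) ≤ v ⬝ᵥ (Matrix.of M *ᵥ v)} ⊆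
      interior {M : m → m → ℝ | (symPart (Matrix.of M)).PosDef} := by
  intro M hM
  rw [mem_interior_iff_mem_nhds, Metric.mem_nhds_iff]
  set c : ℝ := Fintype.card m + 1
  have hc : 0 < c := by positivity
  refine ⟨ε / (2 * c), by positivity, fun N hN => ?_⟩
  rw [mem_ball_iff_norm] at hN
  refine posDef_of_forall_le (isHermitian_symPart _) (half_pos hε) fun v => ?_
  rw [dotProduct_symPart]
  have h1 : |v ⬝ᵥ ((Matrix.of N - Matrix.of M) *ᵥ v)| ≤ ε / (2 * c) * (∑ i, |v i|) ^ 2 := by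
    rw [sq, Finset.sum_mul_sum, Finset.mul_sum]
    simp only [dotProduct, Matrix.mulVec, Finset.mul_sum]
    refine (Finset.abs_sum_le_sum_abs _ _).trans (Finset.sum_le_sum fun i _ => ?_)
    refine (Finset.abs_sum_le_sum_abs _ _).trans (Finset.sum_le_sum fun j _ => ?_)
    rw [abs_mul, abs_mul]
    have : |(Matrix.of N - Matrix.of M) i j| ≤ ε / (2 * c) :=
      ((norm_le_pi_norm ((N - M) i) j).trans (norm_le_pi_norm (N - M) i)).trans hN.le
    nlinarith [mul_le_mul_of_nonneg_right this (mul_nonneg (abs_nonneg (v i)) (abs_nonneg (v j)))]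
  have h2 : (∑ i, |v i|) ^ 2 ≤ Fintype.card m * (v ⬝ᵥ v) := by
    have := sq_sum_le_card_mul_sum_sq (s := Finset.univ) (f := fun i => |v i|)
    simpa [dotProduct, sq] using this
  have h0 : 0 ≤ v ⬝ᵥ v := by simpa using dotProduct_star_self_nonneg v
  have h3 : ε / (2 * c) * (∑ i, |v i|) ^ 2 ≤ ε / 2 * (v ⬝ᵥ v) := by
    calc ε / (2 * c) * (∑ i, |v i|) ^ 2 ≤ ε / (2 * c) * (c * (v ⬝ᵥ v)) := by
          gcongr
          refine h2.trans (mul_le_mul_of_nonneg_right ?_ h0)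
          simp [c]
      _ = ε / 2 * (v ⬝ᵥ v) := by field_simp
  have h4 := hM v
  have h5 := (abs_le.mp h1).1
  rw [Matrix.sub_mulVec, dotProduct_sub] at h5
  linarith

variable {α : Type*} [MeasurableSpace α]

lemma integral_dotProduct_mulVec {m : Type*} [Fintype m] {P : Measure α} {A : α → Matrix m m ℝ}
    (hi : ∀ i j, Integrable (fun x => A x i j) P) (v : m → ℝ) :
    Integrable (fun x => v ⬝ᵥ (A x *ᵥ v)) P ∧
    ∫ x, v ⬝ᵥ (A x *ᵥ v) ∂P = v ⬝ᵥ ((Matrix.of fun i j => ∫ x, A x i j ∂P) *ᵥ v) := by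
  have h : ∀ i j, Integrable (fun x => v i * (A x i j * v j)) P := fun i j =>
    ((hi i j).mul_const _).const_mul _
  simp only [dotProduct, Matrix.mulVec, Finset.mul_sum]
  refine ⟨integrable_finsetSum _ fun i _ => integrable_finsetSum _ fun j _ => h i j, ?_⟩
  rw [integral_finsetSum _ fun i _ => integrable_finsetSum _ fun j _ => h i j]
  simp_rw [integral_finsetSum _ fun j _ => h _ j, integral_const_mul, integral_mul_const]
  rfl

/-- Jensen's inequality for Lieb's function. -/
theorem lintegral_liebTrace_le {P : Measure α} [IsProbabilityMeasure P] {H : Matrix n n ℝ}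
    (hH : H.IsHermitian) {A : α → Matrix n n ℝ} (hm : Measurable A)
    (hA : ∀ x, (A x).IsHermitian) {ε : ℝ} (hε : 0 < ε)
    (hAε : ∀ x, (A x - ε • (1 : Matrix n n ℝ)).PosSemidef)
    (hi : ∀ i j, Integrable (fun x => A x i j) P) :
    ∫⁻ x, ENNReal.ofReal (liebTrace H (A x)) ∂P ≤
      ENNReal.ofReal (liebTrace H (Matrix.of fun i j => ∫ x, A x i j ∂P)) := by
  set g : (n → n → ℝ) → ℝ := fun M => liebTrace H (symPart (Matrix.of M)) with hg
  -- Jensen's inequality needs a closed convex set on which the function is continuous; the margin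
  -- `ε` keeps this one inside the interior of the concavity domain.
  set s : Set (n → n → ℝ) := {M | ∀ v, ε * (v ⬝ᵥ v) ≤ v ⬝ᵥ (Matrix.of M *ᵥ v)} with hs
  have hconv : Convex ℝ {M : n → n → ℝ | (symPart (Matrix.of M)).PosDef} := by
    intro M hM N hN a b ha hb hab
    change (symPart (a • Matrix.of M + b • Matrix.of N)).PosDef
    rw [symPart_combination]
    exact posDef_convex_combination hM hN ha hb hab
  have hsub := setOf_le_subset_interior (m := n) hε
  have hconcave : ConcaveOn ℝ {M : n → n → ℝ | (symPart (Matrix.of M)).PosDef} g := by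
    refine ⟨hconv, fun M hM N hN a b ha hb hab => ?_⟩
    have h : g (a • M + b • N) = liebTrace H (symPart (a • Matrix.of M + b • Matrix.of N)) := rfl
    rw [h, symPart_combination]
    exact liebTrace_concave hH hM hN ha hb hab
  have hcont : ContinuousOn g s := hconcave.continuousOn_interior.mono hsub
  have hsconv : Convex ℝ s := by
    intro M hM N hN a b ha hb hab v
    have h1 := mul_le_mul_of_nonneg_left (hM v) ha
    have h2 := mul_le_mul_of_nonneg_left (hN v) hb
    change _ ≤ v ⬝ᵥ ((a • Matrix.of M + b • Matrix.of N) *ᵥ v)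
    rw [Matrix.add_mulVec, Matrix.smul_mulVec, Matrix.smul_mulVec, dotProduct_add,
      dotProduct_smul, dotProduct_smul, smul_eq_mul, smul_eq_mul]
    calc ε * (v ⬝ᵥ v) = a * (ε * (v ⬝ᵥ v)) + b * (ε * (v ⬝ᵥ v)) := by rw [← add_mul, hab, one_mul]
      _ ≤ _ := by linarith
  have hclosed : IsClosed s := by
    simp only [hs, Set.ofPred_forall]
    refine isClosed_iInter fun v => isClosed_le continuous_const ?_
    fun_prop
  have hmem : ∀ x, A x ∈ s := fun x => (forall_le_dotProduct_iff (hA x) ε).mp (hAε x)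
  let A' : α → n → n → ℝ := A
  have hint : Integrable A' P := Integrable.of_eval fun i => Integrable.of_eval fun j => hi i j
  have hpd : ∀ x, (A x).PosDef := fun x => posDef_of_forall_le (hA x) hε (hmem x)
  have hgA : ∀ x, g (A x) = liebTrace H (A x) := fun x =>
    congrArg (liebTrace H) (symPart_eq_self (hA x))
  have hgm : Measurable fun x => liebTrace H (A x) := by
    have hlog := measurable_cfc hm hA Real.measurable_log
    have hadd : Measurable fun x => H + cfc Real.log (A x) :=
      (Continuous.measurable (by fun_prop : Continuous fun M : Matrix n n ℝ => H + M)).comp hlog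
    have hexp := measurable_cfc hadd (fun x => hH.add (isHermitian_cfc _ _)) Real.measurable_exp
    exact (Continuous.measurable
      (by fun_prop : Continuous fun M : Matrix n n ℝ => M.trace)).comp hexp
  have htr : Integrable (fun x => (A x).trace) P :=
    integrable_finsetSum _ fun i _ => hi i i
  have hgint : Integrable (fun x => liebTrace H (A x)) P := by
    refine (htr.mul_const (cfc Real.exp H).trace).mono' hgm.aestronglyMeasurable
      (Filter.Eventually.of_forall fun x => ?_)
    rw [Real.norm_of_nonneg (liebTrace_nonneg hH)]
    exact liebTrace_le_trace_mul hH (hpd x)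
  have hJ := (hconcave.subset (hsub.trans interior_subset) hsconv).le_map_integral hcont hclosed
    (Filter.Eventually.of_forall hmem) hint (g := g) (f := A')
    (hgint.congr (Filter.Eventually.of_forall fun x => (hgA x).symm))
  have hmean : ∫ x, A' x ∂P = fun i j => ∫ x, A x i j ∂P := by
    ext i j
    have h1 := eval_integral (μ := P) (f := A') (fun i => Integrable.of_eval fun j => hi i j) i
    have h2 := eval_integral (μ := P) (f := fun x => A' x i) (fun j => hi i j) j
    rw [← h2]
    exact congrFun h1 j
  have hherm : (Matrix.of fun i j => ∫ x, A x i j ∂P).IsHermitian := by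
    ext i j
    simp only [Matrix.conjTranspose_apply, Matrix.of_apply, star_trivial]
    exact integral_congr_ae (Filter.Eventually.of_forall fun x => by simpa using (hA x).apply i j)
  rw [hmean, integral_congr_ae (Filter.Eventually.of_forall hgA)] at hJ
  rw [← ofReal_integral_eq_lintegral_ofReal hgint
    (Filter.Eventually.of_forall fun x => liebTrace_nonneg hH)]
  refine ENNReal.ofReal_le_ofReal (hJ.trans (le_of_eq ?_))
  exact congrArg (liebTrace H) (symPart_eq_self hherm)

end Jensen

end LowPop

/-! ### Exponential tails for sums of influence-truncated matrices. -/

namespace LowPop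

section Tail

/-- For negative `x` this rests on `(1 + x + x²/2)(1 - x + x²/2) = 1 + x⁴/4 ≥ 1`. Oddness of
`influence` supplies the corresponding lower bound. -/
lemma influence_le_log (x : ℝ) : influence x ≤ Real.log (1 + x + x ^ 2 / 2) := by
  have hq : ∀ y : ℝ, 0 < 1 + y + y ^ 2 / 2 := fun y => by nlinarith [sq_nonneg (1 + y)]
  rcases lt_trichotomy x 0 with h | rfl | h
  · rw [influence, Real.sign_of_neg h, abs_of_neg h, neg_one_mul, ← Real.log_inv]
    have h1 := hq (-x)
    rw [neg_sq] at h1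
    refine Real.log_le_log (inv_pos.mpr h1) ?_
    rw [inv_le_iff_one_le_mul₀ h1]
    nlinarith [sq_nonneg (x ^ 2)]
  · simp [influence]
  · rw [influence, Real.sign_of_pos h, abs_of_pos h, one_mul]

lemma influence_neg (x : ℝ) : influence (-x) = -influence x := by
  rw [influence, influence, Real.sign_neg, abs_neg, neg_sq, neg_mul]

lemma measurable_influence : Measurable influence := by
  have hs : Measurable Real.sign := by
    unfold Real.sign
    exact Measurable.ite measurableSet_Iio measurable_const
      (Measurable.ite measurableSet_Ioi measurable_const measurable_const)
  unfold influence
  fun_prop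

variable {n : Type*} [Fintype n] {α : Type*} [MeasurableSpace α]

/-- First and second moment conditions on a random symmetric matrix: mean `M` and
`𝔼 Y² ≤ V`. -/
structure HasMoments (P : Measure α) (Y : α → Matrix n n ℝ) (M : Matrix n n ℝ) (V : ℝ) :
    Prop where
  measurable : Measurable Y
  isHermitian : ∀ x, (Y x).IsHermitian
  integrable : ∀ i j, Integrable (fun x => Y x i j) P
  integrable_sq : ∀ i j, Integrable (fun x => (Y x * Y x) i j) P
  mean : ∀ i j, ∫ x, Y x i j ∂P = M i j
  sq_le : ∀ v, v ⬝ᵥ ((Matrix.of fun i j => ∫ x, (Y x * Y x) i j ∂P) *ᵥ v) ≤ V * (v ⬝ᵥ v)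

namespace HasMoments

variable {P : Measure α} {Y : α → Matrix n n ℝ} {M : Matrix n n ℝ} {V : ℝ}

lemma isHermitian_mean (h : HasMoments P Y M V) : M.IsHermitian := by
  ext i j
  rw [Matrix.conjTranspose_apply, star_trivial, ← h.mean, ← h.mean]
  exact integral_congr_ae (Filter.Eventually.of_forall fun x => by
    simpa using (h.isHermitian x).apply i j)

lemma smul (h : HasMoments P Y M V) (c : ℝ) :
    HasMoments P (fun x => c • Y x) (c • M) (c ^ 2 * V) where
  measurable := (Continuous.measurable
    (by fun_prop : Continuous fun A : Matrix n n ℝ => c • A)).comp h.measurable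
  isHermitian x := (h.isHermitian x).smul (IsSelfAdjoint.all _)
  integrable i j := (h.integrable i j).const_mul c
  integrable_sq i j := by
    simp only [Matrix.smul_mul, Matrix.mul_smul, Matrix.smul_apply, smul_eq_mul]
    exact ((h.integrable_sq i j).const_mul c).const_mul c
  mean i j := by
    simp only [Matrix.smul_apply, smul_eq_mul, integral_const_mul, h.mean]
  sq_le v := by
    have : (Matrix.of fun i j => ∫ x, (c • Y x * c • Y x) i j ∂P) =
        c ^ 2 • Matrix.of fun i j => ∫ x, (Y x * Y x) i j ∂P := by
      ext i j
      simp only [Matrix.smul_mul, Matrix.mul_smul, Matrix.smul_apply, smul_eq_mul,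
        Matrix.of_apply, integral_const_mul]
      ring
    rw [this, Matrix.smul_mulVec, dotProduct_smul, smul_eq_mul, mul_assoc]
    exact mul_le_mul_of_nonneg_left (h.sq_le v) (sq_nonneg c)

lemma neg (h : HasMoments P Y M V) : HasMoments P (fun x => -Y x) (-M) V := by
  simpa using h.smul (-1)

variable [DecidableEq n]

lemma measurable_cfc_influence (h : HasMoments P Y M V) :
    Measurable fun x => cfc influence (Y x) :=
  LowPop.measurable_cfc h.measurable h.isHermitian measurable_influence

/-- One step of the matrix Laplace transform method. -/
lemma lintegral_trace_exp_le [IsProbabilityMeasure P] (h : HasMoments P Y M V)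
    {H : Matrix n n ℝ} (hH : H.IsHermitian) :
    ∫⁻ x, ENNReal.ofReal (cfc Real.exp (H + cfc influence (Y x))).trace ∂P ≤
      ENNReal.ofReal (cfc Real.exp (H + (M + (V / 2) • (1 : Matrix n n ℝ)))).trace := by
  set q : ℝ → ℝ := fun x => 1 + x + x ^ 2 / 2 with hq
  set A : α → Matrix n n ℝ := fun x => cfc q (Y x) with hA
  have hAeq : ∀ x, A x = 1 + Y x + (1 / 2 : ℝ) • (Y x * Y x) := by
    intro x
    have e : q = fun t => ((1 : ℝ) + t) + (1 / 2) * (t * t) := by ext t; simp only [hq]; ring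
    have hc := continuousOn_spectrum (n := n)
    simp only [hA, e]
    rw [cfc_add (Y x) (fun t => (1 : ℝ) + t) (fun t => (1 / 2) * (t * t)) (hc _ _) (hc _ _),
      cfc_add (Y x) (fun _ => (1 : ℝ)) (fun t => t) (hc _ _) (hc _ _),
      cfc_const_mul (1 / 2 : ℝ) (fun t => t * t) (Y x) (hc _ _),
      cfc_mul (fun t : ℝ => t) (fun t => t) (Y x) (hc _ _) (hc _ _),
      cfc_id_eq_self (h.isHermitian x), cfc_const_eq_smul_one (h.isHermitian x), one_smul]
  have hAm : Measurable A :=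
    LowPop.measurable_cfc h.measurable h.isHermitian (by fun_prop)
  have hAh : ∀ x, (A x).IsHermitian := fun x => isHermitian_cfc _ _
  -- Since `q(x) = ((1 + x)² + 1) / 2`, the uniform margin required by Jensen's inequality is `1/2`.
  have hAε : ∀ x, (A x - (1 / 2 : ℝ) • (1 : Matrix n n ℝ)).PosSemidef := by
    intro x
    rw [← cfc_const_eq_smul_one (h.isHermitian x), ← cfc_sub_eq]
    refine posSemidef_cfc (h.isHermitian x) fun i => ?_
    simp only [hq]
    nlinarith [sq_nonneg (1 + (h.isHermitian x).eigenvalues i)]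
  have hentry : ∀ i j x, A x i j = (1 : Matrix n n ℝ) i j + Y x i j + 1 / 2 * (Y x * Y x) i j := by
    intro i j x
    rw [hAeq]; simp
  have hi : ∀ i j, Integrable (fun x => A x i j) P := by
    intro i j
    simp only [hentry]
    exact ((integrable_const _).add (h.integrable i j)).add ((h.integrable_sq i j).const_mul _)
  set S : Matrix n n ℝ := Matrix.of fun i j => ∫ x, (Y x * Y x) i j ∂P with hS
  set Ab : Matrix n n ℝ := Matrix.of fun i j => ∫ x, A x i j ∂P with hAb
  have hAbeq : Ab = 1 + M + (1 / 2 : ℝ) • S := by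
    ext i j
    simp only [hAb, Matrix.of_apply, hentry]
    have h1 : Integrable (fun x => (1 : Matrix n n ℝ) i j + Y x i j) P :=
      (integrable_const _).add (h.integrable i j)
    rw [integral_add h1 ((h.integrable_sq i j).const_mul _), integral_add (integrable_const _) (h.integrable i j),
      integral_const, integral_const_mul, h.mean]
    simp [hS]
  have hAbh : Ab.IsHermitian := by
    ext i j
    simp only [hAb, Matrix.conjTranspose_apply, Matrix.of_apply, star_trivial]
    exact integral_congr_ae (Filter.Eventually.of_forall fun x => by
      simpa using (hAh x).apply i j)
  have hAbpos : Ab.PosDef := by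
    refine posDef_of_forall_le hAbh (ε := 1 / 2) (by norm_num) fun v => ?_
    obtain ⟨h1, h2⟩ := integral_dotProduct_mulVec hi v
    rw [← h2]
    calc (1 / 2 : ℝ) * (v ⬝ᵥ v) = ∫ _, (1 / 2 : ℝ) * (v ⬝ᵥ v) ∂P := by simp
      _ ≤ _ := integral_mono (integrable_const _) h1 fun x =>
        (forall_le_dotProduct_iff (hAh x) _).mp (hAε x) v
  calc ∫⁻ x, ENNReal.ofReal (cfc Real.exp (H + cfc influence (Y x))).trace ∂P
      ≤ ∫⁻ x, ENNReal.ofReal (liebTrace H (A x)) ∂P := by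
        refine lintegral_mono fun x => ENNReal.ofReal_le_ofReal ?_
        refine trace_exp_mono (hH.add (isHermitian_cfc _ _)) (hH.add (isHermitian_cfc _ _)) ?_
        have hcomp : cfc (fun t => Real.log (q t)) (Y x) = cfc Real.log (cfc q (Y x)) :=
          cfc_comp' Real.log q (Y x)
            (((Matrix.finite_real_spectrum (A := Y x)).image _).continuousOn _)
            (continuousOn_spectrum _ _) (show IsSelfAdjoint (Y x) from h.isHermitian x)
        rw [add_sub_add_left_eq_sub, hA, ← hcomp, ← cfc_sub_eq]
        exact posSemidef_cfc (h.isHermitian x) fun i => sub_nonneg.mpr (influence_le_log _)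
    _ ≤ ENNReal.ofReal (liebTrace H Ab) :=
        lintegral_liebTrace_le hH hAm hAh (by norm_num) hAε hi
    _ ≤ _ := by
        refine ENNReal.ofReal_le_ofReal ?_
        have hV : (M + (V / 2) • (1 : Matrix n n ℝ)).IsHermitian :=
          h.isHermitian_mean.add (Matrix.isHermitian_one.smul (IsSelfAdjoint.all _))
        refine trace_exp_mono (hH.add (isHermitian_cfc _ _)) (hH.add hV) ?_
        rw [add_sub_add_left_eq_sub]
        -- `log x ≤ x - 1` on the spectrum removes the logarithm of the mean and leaves only the
        -- first two moments.
        have h1 : (Ab - 1 - cfc Real.log Ab).PosSemidef := by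
          have e : Ab - 1 = cfc (fun x : ℝ => x - 1) Ab := by
            rw [cfc_sub_eq (fun x => x) (fun _ => 1), cfc_id_eq_self hAbh,
              cfc_const_eq_smul_one hAbh, one_smul]
          rw [e, ← cfc_sub_eq]
          exact posSemidef_cfc hAbh fun i =>
            sub_nonneg.mpr (Real.log_le_sub_one_of_pos (hAbpos.eigenvalues_pos i))
        have h2 : (M + (V / 2) • (1 : Matrix n n ℝ) - (Ab - 1)).PosSemidef := by
          rw [posSemidef_iff_dotProduct (hV.sub (hAbh.sub Matrix.isHermitian_one))]
          intro v
          have e : M + (V / 2) • (1 : Matrix n n ℝ) - (Ab - 1) =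
              (V / 2) • (1 : Matrix n n ℝ) - (1 / 2 : ℝ) • S := by
            rw [hAbeq]; abel
          rw [e, Matrix.sub_mulVec, Matrix.smul_mulVec, Matrix.smul_mulVec, Matrix.one_mulVec,
            dotProduct_sub, dotProduct_smul, dotProduct_smul, smul_eq_mul, smul_eq_mul]
          linarith [h.sq_le v]
        have := h1.add h2
        rwa [show Ab - 1 - cfc Real.log Ab + (M + (V / 2) • (1 : Matrix n n ℝ) - (Ab - 1)) =
          M + (V / 2) • (1 : Matrix n n ℝ) - cfc Real.log Ab by abel] at this

end HasMoments

variable [DecidableEq n]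

lemma cfc_influence_neg {A : Matrix n n ℝ} (hA : A.IsHermitian) :
    cfc influence (-A) = -cfc influence A := by
  have h : cfc (fun x => influence (-x)) A = cfc influence (cfc (fun x : ℝ => -x) A) :=
    cfc_comp' influence (fun x : ℝ => -x) A
      (((Matrix.finite_real_spectrum (A := A)).image _).continuousOn _)
      (continuousOn_spectrum _ _) (show IsSelfAdjoint A from hA)
  rw [cfc_neg, cfc_id_eq_self hA] at h
  rw [← h]
  simp only [influence_neg]
  exact cfc_neg _ _

lemma measurable_trace_exp {β : Type*} [MeasurableSpace β] {B : β → Matrix n n ℝ}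
    (hm : Measurable B) (hB : ∀ x, (B x).IsHermitian) :
    Measurable fun x => ENNReal.ofReal (cfc Real.exp (B x)).trace :=
  ((Continuous.measurable (by fun_prop : Continuous fun M : Matrix n n ℝ => M.trace)).comp
    (measurable_cfc hm hB Real.measurable_exp)).ennreal_ofReal

lemma measurable_matrix_add {β m' n' : Type*} [MeasurableSpace β] [Fintype m'] [Fintype n']
    {f g : β → Matrix m' n' ℝ}
    (hf : Measurable f) (hg : Measurable g) : Measurable fun x => f x + g x :=
  (Continuous.measurable (by fun_prop : Continuous fun p : Matrix m' n' ℝ × Matrix m' n' ℝ =>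
    p.1 + p.2)).comp (hf.prodMk hg)

lemma measurable_matrix_sum {β ι m' n' : Type*} [MeasurableSpace β] [Fintype m'] [Fintype n']
    (s : Finset ι) {f : ι → β → Matrix m' n' ℝ} (hf : ∀ i, Measurable (f i)) :
    Measurable fun x => ∑ i ∈ s, f i x := by
  classical
  induction s using Finset.induction_on with
  | empty => simp
  | insert a s ha ih =>
    simp only [Finset.sum_insert ha]
    exact measurable_matrix_add (hf a) ih

/-- The matrix moment generating function of a sum of independent influence-truncated matrices. -/
theorem lintegral_trace_exp_sum_le {k : ℕ} {P : Fin k → Measure α}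
    [∀ i, IsProbabilityMeasure (P i)] {Y : α → Matrix n n ℝ} {M : Matrix n n ℝ} {V : ℝ}
    (h : ∀ i, HasMoments (P i) Y M V) {H : Matrix n n ℝ} (hH : H.IsHermitian) :
    ∫⁻ z, ENNReal.ofReal (cfc Real.exp (H + ∑ i, cfc influence (Y (z i)))).trace
        ∂(Measure.pi P) ≤
      ENNReal.ofReal (cfc Real.exp (H + (k : ℝ) • (M + (V / 2) • (1 : Matrix n n ℝ)))).trace := by
  induction k generalizing H with
  | zero => simp
  | succ k ih =>
    set D := M + (V / 2) • (1 : Matrix n n ℝ) with hD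
    have hDh : D.IsHermitian := (h 0).isHermitian_mean.add
      (Matrix.isHermitian_one.smul (IsSelfAdjoint.all _))
    have hφ := (h 0).measurable_cfc_influence
    have hsum : ∀ z : Fin k → α, (∑ i, cfc influence (Y (z i))).IsHermitian := fun z =>
      isSelfAdjoint_sum _ fun i _ => isHermitian_cfc _ _
    -- Sample `0` is integrated first with the others frozen into `H`; its bound `D` is then
    -- absorbed into `H`, which is why the induction generalizes over `H`.
    have hmp := measurePreserving_piFinSuccAbove P 0
    have hmeas : Measurable fun p : α × (Fin k → α) => ENNReal.ofReal (cfc Real.exp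
        ((H + ∑ i, cfc influence (Y (p.2 i))) + cfc influence (Y p.1))).trace := by
      refine measurable_trace_exp (measurable_matrix_add (measurable_matrix_add measurable_const
        (measurable_matrix_sum _ fun i => hφ.comp (by fun_prop))) (hφ.comp measurable_fst))
        fun p => (hH.add (hsum _)).add (isHermitian_cfc _ _)
    have e : ∀ z : Fin (k + 1) → α,
        ENNReal.ofReal (cfc Real.exp (H + ∑ i, cfc influence (Y (z i)))).trace =
        (fun p : α × (Fin k → α) => ENNReal.ofReal (cfc Real.exp
          ((H + ∑ i, cfc influence (Y (p.2 i))) + cfc influence (Y p.1))).trace)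
          (MeasurableEquiv.piFinSuccAbove (fun _ => α) 0 z) := by
      intro z
      rw [Fin.sum_univ_succ, add_comm (cfc influence (Y (z 0))), ← add_assoc]
      rfl
    simp_rw [e]
    rw [hmp.lintegral_comp hmeas, lintegral_prod_symm _ hmeas.aemeasurable]
    calc _ ≤ ∫⁻ z : Fin k → α, ENNReal.ofReal (cfc Real.exp
          ((H + D) + ∑ i, cfc influence (Y (z i)))).trace
          ∂(Measure.pi fun j => P (Fin.succAbove 0 j)) := by
          refine lintegral_mono fun z => ?_
          refine ((h 0).lintegral_trace_exp_le (hH.add (hsum z))).trans (le_of_eq ?_)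
          rw [add_right_comm]
      _ ≤ _ := ih (fun i => h _) (hH.add hDh)
      _ = _ := by
          rw [Nat.cast_succ, add_smul, one_smul, add_assoc, add_comm D]

/-- If `s - W` is not positive semidefinite then the trace exponential of `W` exceeds `exp s`. -/
lemma exp_le_trace_exp {W : Matrix n n ℝ} (hW : W.IsHermitian) {s : ℝ}
    (h : ¬ (s • (1 : Matrix n n ℝ) - W).PosSemidef) :
    Real.exp s ≤ (cfc Real.exp W).trace := by
  have : ∃ i, s < hW.eigenvalues i := by
    by_contra hcon
    push Not at hcon
    refine h ?_
    have e := cfc_sub_eq (fun _ => s) (fun x => x) W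
    rw [cfc_id_eq_self hW, cfc_const_eq_smul_one hW] at e
    rw [← e]
    exact posSemidef_cfc hW fun i => sub_nonneg.mpr (hcon i)
  obtain ⟨i, hi⟩ := this
  rw [trace_cfc hW]
  exact (Real.exp_le_exp.mpr hi.le).trans
    (Finset.single_le_sum (f := fun j => Real.exp (hW.eigenvalues j))
      (fun j _ => (Real.exp_pos _).le) (Finset.mem_univ i))

/-- One-sided deviation bound for sums of influence-truncated random matrices. -/
theorem measure_not_posSemidef_le {k : ℕ} {P : Fin k → Measure α}
    [∀ i, IsProbabilityMeasure (P i)] {Y : α → Matrix n n ℝ} {M : Matrix n n ℝ} {V : ℝ}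
    (h : ∀ i, HasMoments (P i) Y M V) (hM : M.IsHermitian) (s : ℝ) :
    Measure.pi P {z | ¬ (s • (1 : Matrix n n ℝ) -
        (∑ i, cfc influence (Y (z i)) - (k : ℝ) • M)).PosSemidef} ≤
      ENNReal.ofReal (Fintype.card n * Real.exp (k * V / 2 - s)) := by
  -- Starting from `H = -k M` cancels the accumulated mean, so only the scalar matrix `k V / 2`
  -- remains in the exponent.
  have hH : (-((k : ℝ) • M)).IsHermitian := (hM.smul (IsSelfAdjoint.all _)).neg
  have hb := lintegral_trace_exp_sum_le h hH
  have e1 : -((k : ℝ) • M) + (k : ℝ) • (M + (V / 2) • (1 : Matrix n n ℝ)) =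
      0 + (k * V / 2) • (1 : Matrix n n ℝ) := by
    rw [smul_add, smul_smul, zero_add, ← mul_div_assoc]; abel
  have e2 : (cfc Real.exp (0 + (k * V / 2) • (1 : Matrix n n ℝ))).trace =
      Fintype.card n * Real.exp (k * V / 2) := by
    rw [cfc_exp_add_smul_one Matrix.isHermitian_zero, cfc_apply_zero, Real.exp_zero, map_one,
      Matrix.trace_smul, Matrix.trace_one, smul_eq_mul, mul_comm]
  rw [e1, e2] at hb
  have hsum : ∀ z : Fin k → α, (∑ i, cfc influence (Y (z i))).IsHermitian := fun z =>
    isSelfAdjoint_sum _ fun i _ => isHermitian_cfc _ _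
  have hsub : {z : Fin k → α | ¬ (s • (1 : Matrix n n ℝ) -
      (∑ i, cfc influence (Y (z i)) - (k : ℝ) • M)).PosSemidef} ⊆
      {z | ENNReal.ofReal (Real.exp s) ≤ ENNReal.ofReal (cfc Real.exp
        (-((k : ℝ) • M) + ∑ i, cfc influence (Y (z i)))).trace} := by
    intro z hz
    refine ENNReal.ofReal_le_ofReal (exp_le_trace_exp (hH.add (hsum z)) ?_)
    rwa [neg_add_eq_sub]
  refine (measure_mono hsub).trans ?_
  have hmeas : Measurable fun z : Fin k → α => ENNReal.ofReal (cfc Real.exp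
      (-((k : ℝ) • M) + ∑ i, cfc influence (Y (z i)))).trace := by
    refine measurable_trace_exp (measurable_matrix_add measurable_const
      (measurable_matrix_sum _ fun i => (h i).measurable_cfc_influence.comp (by fun_prop)))
      fun z => hH.add (hsum z)
  have hpos : ENNReal.ofReal (Real.exp s) ≠ 0 := by simp [Real.exp_pos]
  refine (meas_ge_le_lintegral_div hmeas.aemeasurable hpos ENNReal.ofReal_ne_top).trans ?_
  refine (ENNReal.div_le_div_right hb _).trans ?_
  rw [← ENNReal.ofReal_div_of_pos (Real.exp_pos s), mul_div_assoc, ← Real.exp_sub]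

end Tail

end LowPop

/-! ### Conditional moments of sub-Gaussian noise. -/

namespace LowPop

section Noise

variable {d₁ d₂ : ℕ} {Ω : Type*} [MeasurableSpace Ω]

/-- The right side is `4 sinh² (x/2)`, and `|sinh y| ≥ |y|`. -/
lemma sq_le_exp_add_exp (x : ℝ) : x ^ 2 ≤ Real.exp x + Real.exp (-x) - 2 := by
  have h1 : |x / 2| ≤ |Real.sinh (x / 2)| := by
    rw [Real.abs_sinh]
    exact Real.self_le_sinh_iff.mpr (abs_nonneg _)
  have h2 := sq_le_sq' (by linarith [abs_nonneg (x / 2), abs_nonneg (Real.sinh (x / 2))]) h1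
  rw [sq_abs, sq_abs, Real.sinh_eq] at h2
  have h3 : Real.exp (x / 2) * Real.exp (-(x / 2)) = 1 := by
    rw [← Real.exp_add, add_neg_cancel, Real.exp_zero]
  have h4 : Real.exp x = Real.exp (x / 2) ^ 2 := by rw [← Real.exp_nat_mul]; congr 1; push_cast; ring
  have h5 : Real.exp (-x) = Real.exp (-(x / 2)) ^ 2 := by
    rw [← Real.exp_nat_mul]; congr 1; push_cast; ring
  rw [h4, h5]
  nlinarith

variable {μ : Measure Ω} [IsProbabilityMeasure μ] {X : Ω → Matrix (Fin d₁) (Fin d₂) ℝ}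
  {η : Ω → ℝ} {σ : ℝ}

/-- The factor `g(X)` is measurable for the conditioning sigma-algebra and comes out of the
conditional expectation; its nonnegativity preserves the sub-Gaussian bound. -/
lemma IsCondSubgaussian.integral_exp_mul_le (hsub : IsCondSubgaussian μ X η σ)
    (hX : Measurable X) {g : Matrix (Fin d₁) (Fin d₂) ℝ → ℝ} (hg : Measurable g) {K : ℝ}
    (h0 : ∀ᵐ ω ∂μ, 0 ≤ g (X ω)) (hK : ∀ᵐ ω ∂μ, g (X ω) ≤ K) (t : ℝ) :
    Integrable (fun ω => Real.exp (t * η ω) * g (X ω)) μ ∧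
    ∫ ω, Real.exp (t * η ω) * g (X ω) ∂μ ≤
      Real.exp (σ ^ 2 * t ^ 2 / 2) * ∫ ω, g (X ω) ∂μ := by
  obtain ⟨hi, hc⟩ := hsub t
  have hgX : Measurable fun ω => g (X ω) := hg.comp hX
  have hbd : ∀ᵐ ω ∂μ, ‖g (X ω)‖ ≤ K := by
    filter_upwards [h0, hK] with ω h1 h2
    rwa [Real.norm_of_nonneg h1]
  have hi2 : Integrable (fun ω => Real.exp (t * η ω) * g (X ω)) μ :=
    hi.mul_bdd hgX.aestronglyMeasurable hbd
  have hgi : Integrable (fun ω => g (X ω)) μ :=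
    (integrable_const K).mono' hgX.aestronglyMeasurable hbd
  have hm : MeasurableSpace.comap X inferInstance ≤ (inferInstance : MeasurableSpace Ω) :=
    hX.comap_le
  have hgm : StronglyMeasurable[MeasurableSpace.comap X inferInstance] fun ω => g (X ω) :=
    (hg.comp (comap_measurable X)).stronglyMeasurable
  refine ⟨hi2, ?_⟩
  have hpull := condExp_mul_of_stronglyMeasurable_right hgm hi2 hi
  rw [← integral_condExp hm (f := fun ω => Real.exp (t * η ω) * g (X ω)),
    ← integral_const_mul]
  refine integral_mono_ae integrable_condExp (hgi.const_mul _) ?_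
  filter_upwards [hpull, hc, h0] with ω h1 h2 h3
  have h1' : (μ[fun ω => Real.exp (t * η ω) * g (X ω) | MeasurableSpace.comap X inferInstance]) ω =
    (μ[fun ω => Real.exp (t * η ω) | MeasurableSpace.comap X inferInstance]) ω * g (X ω) := h1
  rw [h1']
  exact mul_le_mul_of_nonneg_right h2 h3

lemma IsCondSubgaussian.integrable_sq (hsub : IsCondSubgaussian μ X η σ) (hη : Measurable η) :
    Integrable (fun ω => η ω ^ 2) μ := by
  refine (((hsub 1).1.add (hsub (-1)).1).sub (integrable_const 2)).mono'
    (hη.pow_const 2).aestronglyMeasurable (Filter.Eventually.of_forall fun ω => ?_)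
  rw [Real.norm_of_nonneg (sq_nonneg _)]
  simpa using sq_le_exp_add_exp (η ω)

lemma IsCondSubgaussian.integrable (hsub : IsCondSubgaussian μ X η σ) (hη : Measurable η) :
    Integrable η μ :=
  ((memLp_two_iff_integrable_sq hη.aestronglyMeasurable).mpr
    (hsub.integrable_sq hη)).integrable one_le_two

/-- Apply `x² ≤ exp x + exp (-x) - 2` at `x = t η`, divide by `t²` and let `t → 0`. The second-order
coefficient of the sub-Gaussian bound gives the sharp constant `σ²`. -/
lemma IsCondSubgaussian.integral_sq_mul_le (hsub : IsCondSubgaussian μ X η σ)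
    (hX : Measurable X) (hη : Measurable η) {g : Matrix (Fin d₁) (Fin d₂) ℝ → ℝ}
    (hg : Measurable g) {K : ℝ} (h0 : ∀ᵐ ω ∂μ, 0 ≤ g (X ω)) (hK : ∀ᵐ ω ∂μ, g (X ω) ≤ K) :
    ∫ ω, η ω ^ 2 * g (X ω) ∂μ ≤ σ ^ 2 * ∫ ω, g (X ω) ∂μ := by
  have hgX : Measurable fun ω => g (X ω) := hg.comp hX
  have hbd : ∀ᵐ ω ∂μ, ‖g (X ω)‖ ≤ K := by
    filter_upwards [h0, hK] with ω h1 h2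
    rwa [Real.norm_of_nonneg h1]
  have hgi : Integrable (fun ω => g (X ω)) μ :=
    (integrable_const K).mono' hgX.aestronglyMeasurable hbd
  have hi2 : Integrable (fun ω => η ω ^ 2 * g (X ω)) μ :=
    (hsub.integrable_sq hη).mul_bdd hgX.aestronglyMeasurable hbd
  set G := ∫ ω, g (X ω) ∂μ with hG
  set I := ∫ ω, η ω ^ 2 * g (X ω) ∂μ with hI
  have key : ∀ t : ℝ, t ≠ 0 → I ≤ 2 * ((Real.exp (σ ^ 2 * t ^ 2 / 2) - 1) / t ^ 2) * G := by
    intro t ht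
    obtain ⟨i1, e1⟩ := hsub.integral_exp_mul_le hX hg h0 hK t
    obtain ⟨i2, e2⟩ := hsub.integral_exp_mul_le hX hg h0 hK (-t)
    have h : t ^ 2 * I ≤ 2 * (Real.exp (σ ^ 2 * t ^ 2 / 2) - 1) * G := by
      have e3 : t ^ 2 * I ≤ ∫ ω, (Real.exp (t * η ω) * g (X ω) + Real.exp (-t * η ω) * g (X ω) -
          2 * g (X ω)) ∂μ := by
        rw [hI, ← integral_const_mul]
        refine integral_mono_ae (hi2.const_mul _) ((i1.add i2).sub (hgi.const_mul 2)) ?_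
        filter_upwards [h0] with ω hω
        have := mul_le_mul_of_nonneg_right (sq_le_exp_add_exp (t * η ω)) hω
        rw [← neg_mul] at this
        linarith
      have i12 : Integrable (fun ω => Real.exp (t * η ω) * g (X ω) +
        Real.exp (-t * η ω) * g (X ω)) μ := i1.add i2
      rw [integral_sub i12 (hgi.const_mul 2), integral_add i1 i2,
        integral_const_mul] at e3
      rw [neg_sq] at e2
      linarith
    have ht2 : 0 < t ^ 2 := by positivity
    rw [← mul_div_assoc, div_mul_eq_mul_div, le_div_iff₀ ht2]
    linarith
  have hd : Filter.Tendsto (fun t : ℝ => (Real.exp (σ ^ 2 * t ^ 2 / 2) - 1) / t ^ 2)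
      (nhdsWithin 0 {0}ᶜ) (nhds (σ ^ 2 / 2)) := by
    have h1 : HasDerivAt (fun u : ℝ => Real.exp (σ ^ 2 * u / 2)) (σ ^ 2 / 2) 0 := by
      have := ((((hasDerivAt_id (0 : ℝ)).const_mul (σ ^ 2)).div_const 2)).exp
      simpa using this
    have h2 := h1.tendsto_slope_zero
    have h3 : Filter.Tendsto (fun t : ℝ => t ^ 2) (nhdsWithin 0 {0}ᶜ) (nhdsWithin 0 {0}ᶜ) := by
      refine tendsto_nhdsWithin_iff.mpr ⟨?_, ?_⟩
      · have : Filter.Tendsto (fun t : ℝ => t ^ 2) (nhds 0) (nhds (0 ^ 2)) :=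
          (continuous_pow 2).tendsto 0
        rw [zero_pow two_ne_zero] at this
        exact this.mono_left nhdsWithin_le_nhds
      · filter_upwards [self_mem_nhdsWithin] with t ht
        exact pow_ne_zero 2 ht
    refine (h2.comp h3).congr fun t => ?_
    simp [div_eq_inv_mul]
  have hlim := ((hd.const_mul 2).mul_const G)
  have : 2 * (σ ^ 2 / 2) * G = σ ^ 2 * G := by ring
  rw [this] at hlim
  refine ge_of_tendsto hlim ?_
  filter_upwards [self_mem_nhdsWithin] with t ht using key t ht

/-- From `1 + tη ≤ exp (tη)`, the first moment times `t` is at most a quantity of second order in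
`t`. The difference is minimal at `t = 0`, so its derivative there, minus the first moment,
vanishes. -/
lemma IsCondSubgaussian.integral_mul_eq_zero (hsub : IsCondSubgaussian μ X η σ)
    (hX : Measurable X) (hη : Measurable η) {g : Matrix (Fin d₁) (Fin d₂) ℝ → ℝ}
    (hg : Measurable g) {K : ℝ} (h0 : ∀ᵐ ω ∂μ, 0 ≤ g (X ω)) (hK : ∀ᵐ ω ∂μ, g (X ω) ≤ K) :
    ∫ ω, η ω * g (X ω) ∂μ = 0 := by
  have hgX : Measurable fun ω => g (X ω) := hg.comp hX
  have hbd : ∀ᵐ ω ∂μ, ‖g (X ω)‖ ≤ K := by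
    filter_upwards [h0, hK] with ω h1 h2
    rwa [Real.norm_of_nonneg h1]
  have hgi : Integrable (fun ω => g (X ω)) μ :=
    (integrable_const K).mono' hgX.aestronglyMeasurable hbd
  have hi1 : Integrable (fun ω => η ω * g (X ω)) μ :=
    (hsub.integrable hη).mul_bdd hgX.aestronglyMeasurable hbd
  set G := ∫ ω, g (X ω) ∂μ with hG
  set I := ∫ ω, η ω * g (X ω) ∂μ with hI
  have key : ∀ t : ℝ, t * I ≤ (Real.exp (σ ^ 2 * t ^ 2 / 2) - 1) * G := by
    intro t
    obtain ⟨i1, e1⟩ := hsub.integral_exp_mul_le hX hg h0 hK t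
    have e3 : ∫ ω, (g (X ω) + t * (η ω * g (X ω))) ∂μ ≤ ∫ ω, Real.exp (t * η ω) * g (X ω) ∂μ := by
      refine integral_mono_ae (hgi.add (hi1.const_mul t)) i1 ?_
      filter_upwards [h0] with ω hω
      have := mul_le_mul_of_nonneg_right (Real.add_one_le_exp (t * η ω)) hω
      linarith
    rw [integral_add hgi (hi1.const_mul t), integral_const_mul] at e3
    linarith
  have hd : HasDerivAt (fun t : ℝ => (Real.exp (σ ^ 2 * t ^ 2 / 2) - 1) * G - t * I) (-I) 0 := by
    have h1 := ((((hasDerivAt_pow 2 (0 : ℝ)).const_mul (σ ^ 2)).div_const 2).exp.sub_const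
      1).mul_const G
    have h2 := h1.sub ((hasDerivAt_id (0 : ℝ)).mul_const I)
    refine (h2.congr_deriv (by simp)).congr_of_eventuallyEq
      (Filter.Eventually.of_forall fun t => by simp)
  have hmin : IsLocalMin (fun t : ℝ => (Real.exp (σ ^ 2 * t ^ 2 / 2) - 1) * G - t * I) 0 := by
    refine Filter.Eventually.of_forall fun t => ?_
    simpa using key t
  simpa using hmin.hasDerivAt_eq_zero hd

end Noise

end LowPop

/-! ### Mean and variance of the one-sample estimator. -/

namespace LowPop

section Moments

variable {d₁ d₂ : ℕ}

/-- The law of an arm-noise pair: the arm has law `π` and the noise is centred with variance proxy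
`σ²` given the arm. -/
structure IsNoiseLaw (P : Measure (Matrix (Fin d₁) (Fin d₂) ℝ × ℝ))
    (π : Measure (Matrix (Fin d₁) (Fin d₂) ℝ)) (σ : ℝ) : Prop where
  map_fst : P.map Prod.fst = π
  integrable_sq : Integrable (fun z => z.2 ^ 2) P
  integral_mul_eq_zero : ∀ g : Matrix (Fin d₁) (Fin d₂) ℝ → ℝ, Measurable g → ∀ K : ℝ,
    (∀ᵐ A ∂π, 0 ≤ g A) → (∀ᵐ A ∂π, g A ≤ K) → ∫ z, z.2 * g z.1 ∂P = 0
  integral_sq_mul_le : ∀ g : Matrix (Fin d₁) (Fin d₂) ℝ → ℝ, Measurable g → ∀ K : ℝ,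
    (∀ᵐ A ∂π, 0 ≤ g A) → (∀ᵐ A ∂π, g A ≤ K) →
    ∫ z, z.2 ^ 2 * g z.1 ∂P ≤ σ ^ 2 * ∫ A, g A ∂π

lemma isNoiseLaw_map {Ω : Type*} [MeasurableSpace Ω] {μ : Measure Ω} [IsProbabilityMeasure μ]
    {X : Ω → Matrix (Fin d₁) (Fin d₂) ℝ} {η : Ω → ℝ} {σ : ℝ} (hX : Measurable X)
    (hη : Measurable η) (hsub : IsCondSubgaussian μ X η σ) :
    IsNoiseLaw (μ.map fun ω => (X ω, η ω)) (μ.map X) σ where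
  map_fst := by
    rw [Measure.map_map measurable_fst (hX.prodMk hη)]
    rfl
  integrable_sq := by
    rw [integrable_map_measure (by fun_prop) (hX.prodMk hη).aemeasurable]
    exact hsub.integrable_sq hη
  integral_mul_eq_zero g hg K h0 hK := by
    rw [integral_map (hX.prodMk hη).aemeasurable
      (by fun_prop : Measurable fun z : Matrix (Fin d₁) (Fin d₂) ℝ × ℝ =>
        z.2 * g z.1).aestronglyMeasurable]
    exact hsub.integral_mul_eq_zero hX hη hg (ae_of_ae_map hX.aemeasurable h0)
      (ae_of_ae_map hX.aemeasurable hK)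
  integral_sq_mul_le g hg K h0 hK := by
    rw [integral_map (hX.prodMk hη).aemeasurable
      (by fun_prop : Measurable fun z : Matrix (Fin d₁) (Fin d₂) ℝ × ℝ =>
        z.2 ^ 2 * g z.1).aestronglyMeasurable,
      integral_map hX.aemeasurable hg.aestronglyMeasurable]
    exact hsub.integral_sq_mul_le hX hη hg (ae_of_ae_map hX.aemeasurable h0)
      (ae_of_ae_map hX.aemeasurable hK)

/-- Measurable functions that are almost surely bounded. -/
def AEBounded {β : Type*} [MeasurableSpace β] (π : Measure β) (g : β → ℝ) : Prop :=
  Measurable g ∧ ∃ K : ℝ, ∀ᵐ A ∂π, |g A| ≤ K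

namespace AEBounded

variable {β : Type*} [MeasurableSpace β] {π : Measure β} {f g : β → ℝ}

lemma const (c : ℝ) : AEBounded π fun _ => c :=
  ⟨measurable_const, |c|, Filter.Eventually.of_forall fun _ => le_rfl⟩

lemma add (hf : AEBounded π f) (hg : AEBounded π g) : AEBounded π fun x => f x + g x := by
  obtain ⟨mf, K, hK⟩ := hf
  obtain ⟨mg, L, hL⟩ := hg
  refine ⟨mf.add mg, K + L, ?_⟩
  filter_upwards [hK, hL] with x h1 h2
  exact (abs_add_le _ _).trans (add_le_add h1 h2)

lemma mul (hf : AEBounded π f) (hg : AEBounded π g) : AEBounded π fun x => f x * g x := by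
  obtain ⟨mf, K, hK⟩ := hf
  obtain ⟨mg, L, hL⟩ := hg
  refine ⟨mf.mul mg, K * L, ?_⟩
  filter_upwards [hK, hL] with x h1 h2
  rw [abs_mul]
  exact mul_le_mul h1 h2 (abs_nonneg _) ((abs_nonneg _).trans h1)

lemma sum {ι : Type*} (s : Finset ι) {F : ι → β → ℝ} (hF : ∀ i, AEBounded π (F i)) :
    AEBounded π fun x => ∑ i ∈ s, F i x := by
  classical
  induction s using Finset.induction_on with
  | empty => simpa using const 0
  | insert a s ha ih =>
    simp only [Finset.sum_insert ha]
    exact (hF a).add ih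

lemma integrable [IsFiniteMeasure π] (hf : AEBounded π f) : Integrable f π := by
  obtain ⟨mf, K, hK⟩ := hf
  exact (integrable_const K).mono' mf.aestronglyMeasurable hK

end AEBounded

lemma IsNoiseLaw.integral_comp_fst {P : Measure (Matrix (Fin d₁) (Fin d₂) ℝ × ℝ)}
    {π : Measure (Matrix (Fin d₁) (Fin d₂) ℝ)} {σ : ℝ} (h : IsNoiseLaw P π σ)
    {g : Matrix (Fin d₁) (Fin d₂) ℝ → ℝ} (hg : Measurable g) :
    ∫ z, g z.1 ∂P = ∫ A, g A ∂π := by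
  rw [← h.map_fst, integral_map measurable_fst.aemeasurable hg.aestronglyMeasurable]

lemma IsNoiseLaw.ae_fst {P : Measure (Matrix (Fin d₁) (Fin d₂) ℝ × ℝ)}
    {π : Measure (Matrix (Fin d₁) (Fin d₂) ℝ)} {σ : ℝ} (h : IsNoiseLaw P π σ)
    {p : Matrix (Fin d₁) (Fin d₂) ℝ → Prop} (hp : ∀ᵐ A ∂π, p A) : ∀ᵐ z ∂P, p z.1 := by
  rw [← h.map_fst] at hp
  exact ae_of_ae_map measurable_fst.aemeasurable hp

section

variable {P : Measure (Matrix (Fin d₁) (Fin d₂) ℝ × ℝ)}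
  {π : Measure (Matrix (Fin d₁) (Fin d₂) ℝ)} {σ : ℝ}
  {a g : Matrix (Fin d₁) (Fin d₂) ℝ → ℝ}

lemma IsNoiseLaw.integrable_sq_mul (h : IsNoiseLaw P π σ) (hg : AEBounded π g) :
    Integrable (fun z => z.2 ^ 2 * g z.1) P := by
  obtain ⟨mg, K, hK⟩ := hg
  exact h.integrable_sq.mul_bdd (mg.comp measurable_fst).aestronglyMeasurable (h.ae_fst hK)

variable [IsProbabilityMeasure P]

lemma IsNoiseLaw.integrable_fst (h : IsNoiseLaw P π σ) (hg : AEBounded π g) :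
    Integrable (fun z => g z.1) P := by
  obtain ⟨mg, K, hK⟩ := hg
  exact (integrable_const K).mono' (mg.comp measurable_fst).aestronglyMeasurable (h.ae_fst hK)

lemma IsNoiseLaw.integrable_snd (h : IsNoiseLaw P π σ) : Integrable (fun z => z.2) P :=
  ((memLp_two_iff_integrable_sq measurable_snd.aestronglyMeasurable).mpr
    h.integrable_sq).integrable one_le_two

lemma IsNoiseLaw.integrable_snd_mul (h : IsNoiseLaw P π σ) (hg : AEBounded π g) :
    Integrable (fun z => z.2 * g z.1) P := by
  obtain ⟨mg, K, hK⟩ := hg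
  exact h.integrable_snd.mul_bdd (mg.comp measurable_fst).aestronglyMeasurable (h.ae_fst hK)

lemma IsNoiseLaw.integral_snd_mul (h : IsNoiseLaw P π σ) (hg : AEBounded π g) :
    ∫ z, z.2 * g z.1 ∂P = 0 := by
  obtain ⟨mg, K, hK⟩ := hg
  -- The hypothesis covers only nonnegative weights, so `g` is shifted by `K`. The constant is in
  -- turn the difference of the nonnegative constants `|K|` and `|K| - K`.
  have h1 := h.integral_mul_eq_zero (fun A => g A + K) (mg.add_const K) (K + K)
    (by filter_upwards [hK] with A hA; linarith [(abs_le.mp hA).1])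
    (by filter_upwards [hK] with A hA; linarith [(abs_le.mp hA).2])
  have h2 := h.integral_mul_eq_zero (fun _ => |K|) measurable_const |K| (by simp) (by simp)
  have h3 := h.integral_mul_eq_zero (fun _ => |K| - K) measurable_const (|K| - K)
    (by simp [le_abs_self]) (by simp)
  have i1 := h.integrable_snd_mul (g := fun A => g A + K) (AEBounded.add ⟨mg, K, hK⟩ (.const K))
  have i2 := h.integrable_snd_mul (g := fun _ => |K|) (.const _)
  have i3 := h.integrable_snd_mul (g := fun _ => |K| - K) (.const _)
  have e : ∀ z : Matrix (Fin d₁) (Fin d₂) ℝ × ℝ, z.2 * g z.1 =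
      z.2 * (g z.1 + K) - (z.2 * |K| - z.2 * (|K| - K)) := fun z => by ring
  simp_rw [e]
  have i23 : Integrable (fun z : Matrix (Fin d₁) (Fin d₂) ℝ × ℝ =>
    z.2 * |K| - z.2 * (|K| - K)) P := i2.sub i3
  rw [integral_sub i1 i23, integral_sub i2 i3, h1, h2, h3]
  simp

lemma IsNoiseLaw.integrable_add_snd_mul (h : IsNoiseLaw P π σ) (ha : AEBounded π a)
    (hg : AEBounded π g) : Integrable (fun z => (a z.1 + z.2) * g z.1) P := by
  simp only [add_mul]
  exact (h.integrable_fst (ha.mul hg)).add (h.integrable_snd_mul hg)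

lemma IsNoiseLaw.integral_add_snd_mul (h : IsNoiseLaw P π σ) (ha : AEBounded π a)
    (hg : AEBounded π g) : ∫ z, (a z.1 + z.2) * g z.1 ∂P = ∫ A, a A * g A ∂π := by
  simp only [add_mul]
  rw [integral_add (h.integrable_fst (ha.mul hg)) (h.integrable_snd_mul hg),
    h.integral_snd_mul hg, add_zero, h.integral_comp_fst (ha.mul hg).1]

lemma add_sq_mul_eq (a x g : ℝ) : (a + x) ^ 2 * g = a * a * g + x * (2 * a * g) + x ^ 2 * g := by
  ring

lemma IsNoiseLaw.integrable_add_snd_sq_mul (h : IsNoiseLaw P π σ) (ha : AEBounded π a)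
    (hg : AEBounded π g) : Integrable (fun z => (a z.1 + z.2) ^ 2 * g z.1) P := by
  simp only [add_sq_mul_eq]
  exact ((h.integrable_fst ((ha.mul ha).mul hg)).add
    (h.integrable_snd_mul (((AEBounded.const 2).mul ha).mul hg))).add (h.integrable_sq_mul hg)

/-- The cross term vanishes by conditional centring, so the bias and noise variances simply add up
to `σ² + R²`. -/
lemma IsNoiseLaw.integral_add_snd_sq_mul_le [IsFiniteMeasure π] (h : IsNoiseLaw P π σ) (ha : AEBounded π a)
    (hg : AEBounded π g) (hg0 : ∀ A, 0 ≤ g A) {R : ℝ} (hR : ∀ᵐ A ∂π, |a A| ≤ R) :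
    ∫ z, (a z.1 + z.2) ^ 2 * g z.1 ∂P ≤ (σ ^ 2 + R ^ 2) * ∫ A, g A ∂π := by
  simp only [add_sq_mul_eq]
  have i1 := h.integrable_fst ((ha.mul ha).mul hg)
  have i2 := h.integrable_snd_mul (((AEBounded.const 2).mul ha).mul hg)
  have i12 : Integrable (fun z : Matrix (Fin d₁) (Fin d₂) ℝ × ℝ =>
    a z.1 * a z.1 * g z.1 + z.2 * (2 * a z.1 * g z.1)) P := i1.add i2
  rw [integral_add i12 (h.integrable_sq_mul hg), integral_add i1 i2,
    h.integral_snd_mul (((AEBounded.const 2).mul ha).mul hg),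
    h.integral_comp_fst (g := fun A => a A * a A * g A) ((ha.mul ha).mul hg).1]
  obtain ⟨mg, K, hK⟩ := id hg
  have h1 := h.integral_sq_mul_le g mg K (Filter.Eventually.of_forall hg0)
    (by filter_upwards [hK] with A hA; exact (le_abs_self _).trans hA)
  have h2 : ∫ A, a A * a A * g A ∂π ≤ ∫ A, R ^ 2 * g A ∂π := by
    refine integral_mono_ae ((ha.mul ha).mul hg).integrable (hg.integrable.const_mul _) ?_
    filter_upwards [hR] with A hA
    refine mul_le_mul_of_nonneg_right ?_ (hg0 A)
    rw [← abs_mul_abs_self, ← sq]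
    exact pow_le_pow_left₀ (abs_nonneg _) hA 2
  rw [integral_const_mul] at h2
  linarith

end

lemma opNorm_entry_le (A : Matrix (Fin d₁) (Fin d₂) ℝ) (i : Fin d₁) (j : Fin d₂) :
    |A i j| ≤ opNorm A := by
  have h := (LinearMap.toContinuousLinearMap (Matrix.toEuclideanLin A)).le_opNorm
    (EuclideanSpace.single j (1 : ℝ))
  rw [PiLp.norm_single, norm_one, mul_one] at h
  refine le_trans ?_ h
  refine le_trans (le_of_eq ?_) (PiLp.norm_apply_le _ i)
  simp [Matrix.toLpLin_apply]

/-- The vectorized arm after whitening, `reshape (Q⁻¹ vec x)`. -/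
noncomputable def whiten (Q : Matrix (Fin d₂ × Fin d₁) (Fin d₂ × Fin d₁) ℝ)
    (x : Matrix (Fin d₁) (Fin d₂) ℝ) : Matrix (Fin d₁) (Fin d₂) ℝ :=
  reshape (Q⁻¹ *ᵥ Matrix.vec x)

lemma whiten_apply (Q : Matrix (Fin d₂ × Fin d₁) (Fin d₂ × Fin d₁) ℝ)
    (x : Matrix (Fin d₁) (Fin d₂) ℝ) (i : Fin d₁) (j : Fin d₂) :
    whiten Q x i j = ∑ q, Q⁻¹ (j, i) q * Matrix.vec x q := rfl

lemma oneSample_eq (Q : Matrix (Fin d₂ × Fin d₁) (Fin d₂ × Fin d₁) ℝ)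
    (Θ₀ x : Matrix (Fin d₁) (Fin d₂) ℝ) (y : ℝ) :
    oneSample Q Θ₀ x y = (y - matInner Θ₀ x) • whiten Q x := by
  rw [oneSample, Matrix.mulVec_smul]
  rfl

lemma matInner_eq_sum (A B : Matrix (Fin d₁) (Fin d₂) ℝ) :
    matInner A B = ∑ p, Matrix.vec A p * Matrix.vec B p := by
  rw [Fintype.sum_prod_type]
  simp [matInner, Matrix.trace, Matrix.mul_apply, Matrix.vec]

lemma matInner_sub (A B C : Matrix (Fin d₁) (Fin d₂) ℝ) :
    matInner (A - B) C = matInner A C - matInner B C := by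
  simp [matInner, Matrix.sub_mul]

lemma dilation_smul (c : ℝ) (A : Matrix (Fin d₁) (Fin d₂) ℝ) :
    dilation (c • A) = c • dilation A := by
  simp [dilation, Matrix.fromBlocks_smul]

lemma isHermitian_dilation (A : Matrix (Fin d₁) (Fin d₂) ℝ) : (dilation A).IsHermitian := by
  rw [Matrix.IsHermitian, Matrix.conjTranspose_eq_transpose_of_trivial, dilation,
    Matrix.fromBlocks_transpose]
  simp

variable {π : Measure (Matrix (Fin d₁) (Fin d₂) ℝ)}

lemma aeBounded_vec (hπ : ∀ᵐ A ∂π, opNorm A ≤ 1) (p : Fin d₂ × Fin d₁) :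
    AEBounded π fun A => Matrix.vec A p := by
  refine ⟨(measurable_pi_apply p.1).comp (measurable_pi_apply p.2), 1, ?_⟩
  filter_upwards [hπ] with A hA
  exact (opNorm_entry_le A p.2 p.1).trans hA

lemma aeBounded_whiten (hπ : ∀ᵐ A ∂π, opNorm A ≤ 1)
    (Q : Matrix (Fin d₂ × Fin d₁) (Fin d₂ × Fin d₁) ℝ) (i : Fin d₁) (j : Fin d₂) :
    AEBounded π fun A => whiten Q A i j := by
  simp only [whiten_apply]
  exact AEBounded.sum _ fun q => (AEBounded.const _).mul (aeBounded_vec hπ q)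

lemma aeBounded_matInner (hπ : ∀ᵐ A ∂π, opNorm A ≤ 1) (D : Matrix (Fin d₁) (Fin d₂) ℝ) :
    AEBounded π fun A => matInner D A := by
  simp only [matInner_eq_sum]
  exact AEBounded.sum _ fun q => (AEBounded.const _).mul (aeBounded_vec hπ q)

lemma aeBounded_dilation_whiten (hπ : ∀ᵐ A ∂π, opNorm A ≤ 1)
    (Q : Matrix (Fin d₂ × Fin d₁) (Fin d₂ × Fin d₁) ℝ) (i j : Fin d₁ ⊕ Fin d₂) :
    AEBounded π fun A => dilation (whiten Q A) i j := by
  rcases i with i | i <;> rcases j with j | j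
  · exact .const 0
  · exact aeBounded_whiten hπ Q i j
  · exact aeBounded_whiten hπ Q j i
  · exact .const 0

variable [IsProbabilityMeasure π]

/-- This is `Q⁻¹ Q = 1` read entrywise; the unbiasedness and covariance identities below follow from
it by linearity. -/
lemma integral_vec_mul_whiten (hπ : ∀ᵐ A ∂π, opNorm A ≤ 1)
    (hQ : IsUnit (covMatrix π).det) (p : Fin d₂ × Fin d₁) (i : Fin d₁) (j : Fin d₂) :
    ∫ A, Matrix.vec A p * whiten (covMatrix π) A i j ∂π = if (j, i) = p then 1 else 0 := by
  set Q := covMatrix π with hQdef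
  have e : ∀ A, Matrix.vec A p * whiten Q A i j =
      ∑ q, Q⁻¹ (j, i) q * (Matrix.vec A q * Matrix.vec A p) := fun A => by
    rw [whiten_apply, Finset.mul_sum]
    exact Finset.sum_congr rfl fun q _ => by ring
  simp_rw [e]
  rw [integral_finsetSum _ fun q _ =>
    (((aeBounded_vec hπ q).mul (aeBounded_vec hπ p)).integrable.const_mul _)]
  simp_rw [integral_const_mul]
  have h := congrFun (congrFun (Matrix.nonsing_inv_mul Q hQ) (j, i)) p
  rw [Matrix.mul_apply, Matrix.one_apply] at h
  exact h

lemma integral_whiten_mul_whiten (hπ : ∀ᵐ A ∂π, opNorm A ≤ 1)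
    (hQ : IsUnit (covMatrix π).det) (i i' : Fin d₁) (j j' : Fin d₂) :
    ∫ A, whiten (covMatrix π) A i' j' * whiten (covMatrix π) A i j ∂π =
      (covMatrix π)⁻¹ (j', i') (j, i) := by
  have e : ∀ A, whiten (covMatrix π) A i' j' * whiten (covMatrix π) A i j =
      ∑ p, (covMatrix π)⁻¹ (j', i') p *
        (Matrix.vec A p * whiten (covMatrix π) A i j) := fun A => by
    rw [whiten_apply _ _ i', Finset.sum_mul]
    exact Finset.sum_congr rfl fun q _ => by ring
  simp_rw [e]
  rw [integral_finsetSum _ fun q _ =>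
    (((aeBounded_vec hπ q).mul (aeBounded_whiten hπ _ i j)).integrable.const_mul _)]
  simp_rw [integral_const_mul, integral_vec_mul_whiten hπ hQ]
  simp

lemma integral_matInner_mul_whiten (hπ : ∀ᵐ A ∂π, opNorm A ≤ 1)
    (hQ : IsUnit (covMatrix π).det) (D : Matrix (Fin d₁) (Fin d₂) ℝ) (i : Fin d₁) (j : Fin d₂) :
    ∫ A, matInner D A * whiten (covMatrix π) A i j ∂π = D i j := by
  have e : ∀ A, matInner D A * whiten (covMatrix π) A i j =
      ∑ p, Matrix.vec D p * (Matrix.vec A p * whiten (covMatrix π) A i j) := fun A => by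
    rw [matInner_eq_sum, Finset.sum_mul]
    exact Finset.sum_congr rfl fun q _ => by ring
  simp_rw [e]
  rw [integral_finsetSum _ fun q _ =>
    (((aeBounded_vec hπ q).mul (aeBounded_whiten hπ _ i j)).integrable.const_mul _)]
  simp_rw [integral_const_mul, integral_vec_mul_whiten hπ hQ]
  simp [Matrix.vec]

lemma le_lambdaMax {n : Type*} [Fintype n] [DecidableEq n] {M : Matrix n n ℝ}
    (hM : M.IsHermitian) (v : n → ℝ) : v ⬝ᵥ (M *ᵥ v) ≤ lambdaMax M * (v ⬝ᵥ v) := by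
  have h : (lambdaMax M • (1 : Matrix n n ℝ) - M).PosSemidef := by
    have e := cfc_sub_eq (fun _ => lambdaMax M) (fun x => x) M
    rw [cfc_id_eq_self hM, cfc_const_eq_smul_one hM] at e
    rw [← e]
    exact posSemidef_cfc hM fun i => sub_nonneg.mpr
      (le_csSup (Matrix.finite_real_spectrum (A := M)).bddAbove (hM.eigenvalues_mem_spectrum_real i))
  have := (posSemidef_iff_dotProduct h.1).mp h v
  rw [Matrix.sub_mulVec, Matrix.smul_mulVec, Matrix.one_mulVec, dotProduct_sub, dotProduct_smul,
    smul_eq_mul] at this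
  linarith

lemma posSemidef_covMatrix (hπ : ∀ᵐ A ∂π, opNorm A ≤ 1) : (covMatrix π).PosSemidef := by
  have hi : ∀ p q : Fin d₂ × Fin d₁, Integrable (fun A : Matrix (Fin d₁) (Fin d₂) ℝ =>
      Matrix.vecMulVec (Matrix.vec A) (Matrix.vec A) p q) π := fun p q =>
    ((aeBounded_vec hπ p).mul (aeBounded_vec hπ q)).integrable
  have hh : (covMatrix π).IsHermitian := by
    ext p q
    simp only [covMatrix, Matrix.conjTranspose_apply, Matrix.of_apply, star_trivial, mul_comm]
  rw [posSemidef_iff_dotProduct hh]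
  intro v
  have := (integral_dotProduct_mulVec hi v).2
  have e : covMatrix π = Matrix.of fun p q => ∫ A : Matrix (Fin d₁) (Fin d₂) ℝ,
    Matrix.vecMulVec (Matrix.vec A) (Matrix.vec A) p q ∂π := rfl
  rw [e, ← this]
  refine integral_nonneg fun A => ?_
  rw [Matrix.vecMulVec_mulVec]
  simp only [dotProduct_smul, Pi.zero_apply]
  rw [dotProduct_comm]
  exact mul_self_nonneg _

lemma posDef_inv_covMatrix (hπ : ∀ᵐ A ∂π, opNorm A ≤ 1) (hQ : IsUnit (covMatrix π).det) :
    (covMatrix π)⁻¹.PosDef :=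
  ((posSemidef_covMatrix hπ).posDef_iff_det_ne_zero.mpr hQ.ne_zero).inv

lemma isHermitian_sum_colBlock (hπ : ∀ᵐ A ∂π, opNorm A ≤ 1) :
    (∑ j, colBlock (covMatrix π) j).IsHermitian :=
  isSelfAdjoint_sum _ fun _ _ => ((posSemidef_covMatrix hπ).inv.submatrix _).1

lemma isHermitian_sum_rowBlock (hπ : ∀ᵐ A ∂π, opNorm A ≤ 1) :
    (∑ i, rowBlock (covMatrix π) i).IsHermitian :=
  isSelfAdjoint_sum _ fun _ _ => ((posSemidef_covMatrix hπ).inv.submatrix _).1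

lemma bQ_pos (hπ : ∀ᵐ A ∂π, opNorm A ≤ 1) (hQ : IsUnit (covMatrix π).det) (h₁ : 0 < d₁)
    (h₂ : 0 < d₂) : 0 < bQ (covMatrix π) := by
  refine lt_of_lt_of_le ?_ (le_max_left _ _)
  have hpos : (∑ j, colBlock (covMatrix π) j).PosDef := by
    refine Matrix.posDef_sum ⟨⟨0, h₂⟩, Finset.mem_univ _⟩ fun j _ => ?_
    exact (posDef_inv_covMatrix hπ hQ).submatrix (fun i i' h => by simpa using h)
  have hv : (Pi.single ⟨0, h₁⟩ 1 : Fin d₁ → ℝ) ≠ 0 := by simp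
  have h := hpos.dotProduct_mulVec_pos hv
  rw [star_trivial] at h
  have h2 := h.trans_le (le_lambdaMax (isHermitian_sum_colBlock hπ) _)
  simpa using h2

/-- The square of a dilation is block diagonal with blocks `W Wᵀ` and `Wᵀ W`. As the whitened arm
has second moment `Q⁻¹ Q Q⁻¹ = Q⁻¹`, their means add up the column and row blocks of `Q⁻¹`; this is
where `B(Q)` comes from. -/
lemma integral_dilation_sq (hπ : ∀ᵐ A ∂π, opNorm A ≤ 1) (hQ : IsUnit (covMatrix π).det) :
    (Matrix.of fun i j => ∫ A, (dilation (whiten (covMatrix π) A) *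
      dilation (whiten (covMatrix π) A)) i j ∂π) =
    Matrix.fromBlocks (∑ j, colBlock (covMatrix π) j) 0 0 (∑ i, rowBlock (covMatrix π) i) := by
  have hi : ∀ i i' j j', Integrable (fun A => whiten (covMatrix π) A i' j' *
      whiten (covMatrix π) A i j) π := fun i i' j j' =>
    ((aeBounded_whiten hπ _ i' j').mul (aeBounded_whiten hπ _ i j)).integrable
  ext i j
  simp only [dilation, Matrix.fromBlocks_multiply, Matrix.of_apply]
  rcases i with i | i <;> rcases j with j | j
  · simp only [Matrix.zero_mul, zero_add, Matrix.fromBlocks_apply₁₁, Matrix.mul_apply,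
      Matrix.transpose_apply, Matrix.sum_apply]
    rw [integral_finsetSum _ fun q _ => hi _ _ _ _]
    simp_rw [integral_whiten_mul_whiten hπ hQ]
    rfl
  · simp
  · simp
  · simp only [Matrix.zero_mul, add_zero, Matrix.fromBlocks_apply₂₂, Matrix.mul_apply,
      Matrix.transpose_apply, Matrix.sum_apply]
    rw [integral_finsetSum _ fun q _ => hi _ _ _ _]
    simp_rw [integral_whiten_mul_whiten hπ hQ]
    rfl

lemma dotProduct_fromBlocks_le_bQ (hπ : ∀ᵐ A ∂π, opNorm A ≤ 1) (v : Fin d₁ ⊕ Fin d₂ → ℝ) :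
    v ⬝ᵥ (Matrix.fromBlocks (∑ j, colBlock (covMatrix π) j) 0 0
      (∑ i, rowBlock (covMatrix π) i) *ᵥ v) ≤ bQ (covMatrix π) * (v ⬝ᵥ v) := by
  obtain ⟨u, w, rfl⟩ : ∃ u w, v = Sum.elim u w :=
    ⟨v ∘ Sum.inl, v ∘ Sum.inr, (Sum.elim_comp_inl_inr v).symm⟩
  rw [Matrix.fromBlocks_mulVec]
  simp only [Sum.elim_comp_inl, Sum.elim_comp_inr, Matrix.zero_mulVec, add_zero, zero_add,
    sumElim_dotProduct_sumElim]
  have h1 := le_lambdaMax (isHermitian_sum_colBlock hπ) u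
  have h2 := le_lambdaMax (isHermitian_sum_rowBlock hπ) w
  have hu : 0 ≤ u ⬝ᵥ u := by simpa using dotProduct_star_self_nonneg u
  have hw : 0 ≤ w ⬝ᵥ w := by simpa using dotProduct_star_self_nonneg w
  have h3 := mul_le_mul_of_nonneg_right (le_max_left (lambdaMax (∑ j, colBlock (covMatrix π) j))
    (lambdaMax (∑ i, rowBlock (covMatrix π) i))) hu
  have h4 := mul_le_mul_of_nonneg_right (le_max_right (lambdaMax (∑ j, colBlock (covMatrix π) j))
    (lambdaMax (∑ i, rowBlock (covMatrix π) i))) hw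
  rw [mul_add, bQ]
  linarith

/-- The moments of the dilated one-sample estimator. -/
theorem hasMoments_dilation_oneSample {P : Measure (Matrix (Fin d₁) (Fin d₂) ℝ × ℝ)}
    [IsProbabilityMeasure P] {σ : ℝ} (hP : IsNoiseLaw P π σ) (hπ : ∀ᵐ A ∂π, opNorm A ≤ 1)
    (hQ : IsUnit (covMatrix π).det) (Θstar Θ₀ : Matrix (Fin d₁) (Fin d₂) ℝ) {R : ℝ}
    (hR : ∀ᵐ A ∂π, |matInner (Θstar - Θ₀) A| ≤ R) :
    HasMoments P (fun z => dilation (oneSample (covMatrix π) Θ₀ z.1 (matInner Θstar z.1 + z.2)))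
      (dilation (Θstar - Θ₀)) ((σ ^ 2 + R ^ 2) * bQ (covMatrix π)) := by
  set D : Matrix (Fin d₁) (Fin d₂) ℝ → Matrix (Fin d₁ ⊕ Fin d₂) (Fin d₁ ⊕ Fin d₂) ℝ :=
    fun x => dilation (whiten (covMatrix π) x) with hD
  have ha := aeBounded_matInner hπ (Θstar - Θ₀)
  have hDb : ∀ i j, AEBounded π fun A => D A i j := aeBounded_dilation_whiten hπ _
  have hDDb : ∀ i j, AEBounded π fun A => (D A * D A) i j := fun i j =>
    by simpa only [Matrix.mul_apply] using AEBounded.sum _ fun k => (hDb i k).mul (hDb k j)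
  have hY : (fun z : Matrix (Fin d₁) (Fin d₂) ℝ × ℝ =>
      dilation (oneSample (covMatrix π) Θ₀ z.1 (matInner Θstar z.1 + z.2))) =
      fun z => (matInner (Θstar - Θ₀) z.1 + z.2) • D z.1 := by
    ext1 z
    rw [oneSample_eq, dilation_smul, matInner_sub]
    congr 1
    ring
  have hYY : ∀ z : Matrix (Fin d₁) (Fin d₂) ℝ × ℝ,
      ((matInner (Θstar - Θ₀) z.1 + z.2) • D z.1) * ((matInner (Θstar - Θ₀) z.1 + z.2) • D z.1) =
      (matInner (Θstar - Θ₀) z.1 + z.2) ^ 2 • (D z.1 * D z.1) := fun z => by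
    rw [Matrix.smul_mul, Matrix.mul_smul, smul_smul, sq]
  rw [hY]
  have hint2 : ∀ i j, Integrable (fun z : Matrix (Fin d₁) (Fin d₂) ℝ × ℝ =>
      (((matInner (Θstar - Θ₀) z.1 + z.2) • D z.1) *
        ((matInner (Θstar - Θ₀) z.1 + z.2) • D z.1)) i j) P := by
    intro i j
    simp only [hYY, Matrix.smul_apply, smul_eq_mul]
    exact hP.integrable_add_snd_sq_mul ha (hDDb i j)
  refine ⟨?_, fun z => (isHermitian_dilation _).smul (IsSelfAdjoint.all _), fun i j => ?_, hint2,
    fun i j => ?_, fun v => ?_⟩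
  · refine measurable_pi_iff.mpr fun i => measurable_pi_iff.mpr fun j => ?_
    exact ((ha.1.comp measurable_fst).add measurable_snd).mul ((hDb i j).1.comp measurable_fst)
  · simp only [Matrix.smul_apply, smul_eq_mul]
    exact hP.integrable_add_snd_mul ha (hDb i j)
  · simp only [Matrix.smul_apply, smul_eq_mul]
    rw [hP.integral_add_snd_mul ha (hDb i j)]
    rcases i with i | i <;> rcases j with j | j
    · simp [hD, dilation]
    · exact integral_matInner_mul_whiten hπ hQ _ i j
    · exact integral_matInner_mul_whiten hπ hQ _ j i
    · simp [hD, dilation]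
  · have h1 := (integral_dotProduct_mulVec hint2 v).2
    rw [← h1]
    have e : ∀ z : Matrix (Fin d₁) (Fin d₂) ℝ × ℝ,
        v ⬝ᵥ ((((matInner (Θstar - Θ₀) z.1 + z.2) • D z.1) *
          ((matInner (Θstar - Θ₀) z.1 + z.2) • D z.1)) *ᵥ v) =
        (matInner (Θstar - Θ₀) z.1 + z.2) ^ 2 * (v ⬝ᵥ ((D z.1 * D z.1) *ᵥ v)) := fun z => by
      rw [hYY, Matrix.smul_mulVec, dotProduct_smul, smul_eq_mul]
    simp_rw [e]
    have hgb : AEBounded π fun A => v ⬝ᵥ ((D A * D A) *ᵥ v) := by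
      simp only [dotProduct, Matrix.mulVec]
      exact AEBounded.sum _ fun i => (AEBounded.const _).mul
        (AEBounded.sum _ fun j => (hDDb i j).mul (.const _))
    -- Testing the matrix variance against `v` reduces it to the scalar estimate with this
    -- nonnegative weight.
    have hg0 : ∀ A, 0 ≤ v ⬝ᵥ ((D A * D A) *ᵥ v) := fun A => by
      have h := Matrix.posSemidef_conjTranspose_mul_self (D A)
      rw [(isHermitian_dilation (whiten (covMatrix π) A)).eq] at h
      exact (posSemidef_iff_dotProduct h.1).mp h v
    refine (hP.integral_add_snd_sq_mul_le ha hgb hg0 hR).trans ?_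
    rw [(integral_dotProduct_mulVec (fun i j => (hDDb i j).integrable) v).2, mul_assoc]
    refine mul_le_mul_of_nonneg_left ?_ (by positivity)
    have h2 := integral_dilation_sq hπ hQ
    simp only [hD]
    rw [h2]
    exact dotProduct_fromBlocks_le_bQ hπ v

end Moments

end LowPop

/-! ### Operator norm, singular value thresholding and trace duality. -/

namespace LowPop

section OperatorNorm

variable {d₁ d₂ : ℕ}

lemma opNorm_nonneg (A : Matrix (Fin d₁) (Fin d₂) ℝ) : 0 ≤ opNorm A := norm_nonneg _

lemma norm_toLp_mulVec_le (A : Matrix (Fin d₁) (Fin d₂) ℝ) (v : Fin d₂ → ℝ) :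
    ‖WithLp.toLp 2 (A *ᵥ v)‖ ≤ opNorm A * ‖WithLp.toLp 2 v‖ :=
  (LinearMap.toContinuousLinearMap (Matrix.toEuclideanLin A)).le_opNorm (WithLp.toLp 2 v)

lemma norm_toLp_sq {ι : Type*} [Fintype ι] (v : ι → ℝ) : ‖WithLp.toLp 2 v‖ ^ 2 = v ⬝ᵥ v := by
  rw [EuclideanSpace.real_norm_sq_eq]
  simp [dotProduct, sq]

lemma dotProduct_le_norm_mul_norm {ι : Type*} [Fintype ι] (v w : ι → ℝ) :
    |v ⬝ᵥ w| ≤ ‖WithLp.toLp 2 v‖ * ‖WithLp.toLp 2 w‖ := by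
  refine abs_le_of_sq_le_sq ?_ (by positivity)
  rw [mul_pow, norm_toLp_sq, norm_toLp_sq]
  have := Finset.sum_mul_sq_le_sq_mul_sq Finset.univ v w
  simpa [dotProduct, sq] using this

lemma opNorm_le_of_forall {A : Matrix (Fin d₁) (Fin d₂) ℝ} {s : ℝ} (hs : 0 ≤ s)
    (h : ∀ v, (A *ᵥ v) ⬝ᵥ (A *ᵥ v) ≤ s ^ 2 * (v ⬝ᵥ v)) : opNorm A ≤ s := by
  refine ContinuousLinearMap.opNorm_le_bound _ hs fun v => ?_
  change ‖WithLp.toLp 2 (A *ᵥ v.ofLp)‖ ≤ s * ‖WithLp.toLp 2 v.ofLp‖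
  refine le_of_sq_le_sq ?_ (by positivity)
  rw [mul_pow, norm_toLp_sq, norm_toLp_sq]
  exact h v.ofLp

lemma dotProduct_mulVec_self_le (A : Matrix (Fin d₁) (Fin d₂) ℝ) (v : Fin d₂ → ℝ) :
    (A *ᵥ v) ⬝ᵥ (A *ᵥ v) ≤ opNorm A ^ 2 * (v ⬝ᵥ v) := by
  rw [← norm_toLp_sq, ← norm_toLp_sq, ← mul_pow]
  exact pow_le_pow_left₀ (norm_nonneg _) (norm_toLp_mulVec_le A v) 2

lemma opNorm_add_le (A B : Matrix (Fin d₁) (Fin d₂) ℝ) : opNorm (A + B) ≤ opNorm A + opNorm B := by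
  unfold opNorm
  rw [map_add, map_add]
  exact norm_add_le _ _

lemma continuous_opNorm : Continuous (opNorm : Matrix (Fin d₁) (Fin d₂) ℝ → ℝ) := by
  have : Continuous fun A : Matrix (Fin d₁) (Fin d₂) ℝ =>
      LinearMap.toContinuousLinearMap (Matrix.toEuclideanLin A) :=
    ((LinearMap.toContinuousLinearMap (𝕜 := ℝ) (E := EuclideanSpace ℝ (Fin d₂))
      (F' := EuclideanSpace ℝ (Fin d₁))).toLinearMap.comp
      (Matrix.toEuclideanLin (𝕜 := ℝ) (m := Fin d₁) (n := Fin d₂)).toLinearMap).continuous_of_finiteDimensional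
  exact this.norm

/-- The operator norm of an off-diagonal block is bounded by two-sided spectral bounds. -/
lemma opNorm_toBlocks₁₂_le {W : Matrix (Fin d₁ ⊕ Fin d₂) (Fin d₁ ⊕ Fin d₂) ℝ} {s : ℝ}
    (hs : 0 < s) (h1 : (s • (1 : Matrix _ _ ℝ) - W).PosSemidef)
    (h2 : (s • (1 : Matrix _ _ ℝ) - -W).PosSemidef) : opNorm W.toBlocks₁₂ ≤ s := by
  have hW : W.IsHermitian := by
    have h3 : (s • (1 : Matrix (Fin d₁ ⊕ Fin d₂) (Fin d₁ ⊕ Fin d₂) ℝ)).IsHermitian :=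
      Matrix.isHermitian_one.smul (IsSelfAdjoint.all _)
    have := h3.sub h1.1
    rwa [sub_sub_cancel] at this
  have hb1 : ∀ v, v ⬝ᵥ (W *ᵥ v) ≤ s * (v ⬝ᵥ v) := fun v => by
    have := (posSemidef_iff_dotProduct h1.1).mp h1 v
    rw [Matrix.sub_mulVec, Matrix.smul_mulVec, Matrix.one_mulVec, dotProduct_sub, dotProduct_smul,
      smul_eq_mul] at this
    linarith
  have hb2 : ∀ v, -(v ⬝ᵥ (W *ᵥ v)) ≤ s * (v ⬝ᵥ v) := fun v => by
    have := (posSemidef_iff_dotProduct h2.1).mp h2 v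
    rw [sub_neg_eq_add, Matrix.add_mulVec, Matrix.smul_mulVec, Matrix.one_mulVec, dotProduct_add,
      dotProduct_smul, smul_eq_mul] at this
    linarith
  have h21 : W.toBlocks₂₁ = W.toBlocks₁₂ᵀ := by
    ext i j
    simpa [Matrix.toBlocks₂₁, Matrix.toBlocks₁₂] using (hW.apply (Sum.inr i) (Sum.inl j)).symm
  have hquad : ∀ (u : Fin d₁ → ℝ) (w : Fin d₂ → ℝ),
      Sum.elim u w ⬝ᵥ (W *ᵥ Sum.elim u w) = u ⬝ᵥ (W.toBlocks₁₁ *ᵥ u) +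
        2 * (u ⬝ᵥ (W.toBlocks₁₂ *ᵥ w)) + w ⬝ᵥ (W.toBlocks₂₂ *ᵥ w) := by
    intro u w
    conv_lhs => rw [← Matrix.fromBlocks_toBlocks W, Matrix.fromBlocks_mulVec]
    simp only [Sum.elim_comp_inl, Sum.elim_comp_inr, sumElim_dotProduct_sumElim, dotProduct_add]
    have : w ⬝ᵥ (W.toBlocks₂₁ *ᵥ u) = u ⬝ᵥ (W.toBlocks₁₂ *ᵥ w) := by
      rw [h21, Matrix.mulVec_transpose, dotProduct_comm, Matrix.dotProduct_mulVec]
    rw [this]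
    ring
  -- Adding the bound for `W` at `(u, w)` to the bound for `-W` at `(u, -w)` cancels the diagonal
  -- blocks and doubles the off-diagonal term.
  have hkey : ∀ (u : Fin d₁ → ℝ) (w : Fin d₂ → ℝ),
      2 * (u ⬝ᵥ (W.toBlocks₁₂ *ᵥ w)) ≤ s * (u ⬝ᵥ u + w ⬝ᵥ w) := by
    intro u w
    have e1 := hb1 (Sum.elim u w)
    have e2 := hb2 (Sum.elim u (-w))
    rw [hquad, sumElim_dotProduct_sumElim] at e1 e2
    simp only [Matrix.mulVec_neg, dotProduct_neg, neg_dotProduct] at e2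
    linarith
  refine opNorm_le_of_forall hs.le fun w => ?_
  -- This choice of `u` balances the quadratic inequality and yields the constant `s` without loss.
  have h := hkey (s⁻¹ • (W.toBlocks₁₂ *ᵥ w)) w
  simp only [smul_dotProduct, dotProduct_smul, smul_eq_mul] at h
  have h' := mul_le_mul_of_nonneg_left h hs.le
  field_simp at h'
  linarith

lemma isHermitian_transpose_mul (A : Matrix (Fin d₁) (Fin d₂) ℝ) : (Aᵀ * A).IsHermitian := by
  rw [← Matrix.conjTranspose_eq_transpose_of_trivial]
  exact Matrix.isHermitian_conjTranspose_mul_self A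

lemma posSemidef_transpose_mul (A : Matrix (Fin d₁) (Fin d₂) ℝ) : (Aᵀ * A).PosSemidef := by
  rw [← Matrix.conjTranspose_eq_transpose_of_trivial]
  exact Matrix.posSemidef_conjTranspose_mul_self A

lemma mulVec_dotProduct_mulVec (A B : Matrix (Fin d₁) (Fin d₂) ℝ) (v : Fin d₂ → ℝ) :
    (A *ᵥ v) ⬝ᵥ (B *ᵥ v) = v ⬝ᵥ ((Aᵀ * B) *ᵥ v) := by
  rw [← Matrix.mulVec_mulVec, Matrix.dotProduct_mulVec v, Matrix.vecMul_transpose]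

/-- Hard thresholding moves a matrix by at most the threshold. -/
lemma opNorm_hardThreshold_sub_le {τ : ℝ} (hτ : 0 ≤ τ) (A : Matrix (Fin d₁) (Fin d₂) ℝ) :
    opNorm (hardThreshold τ A - A) ≤ τ := by
  set p : ℝ → ℝ := fun x => if τ < √x then (1 : ℝ) else 0 with hp
  have hG := isHermitian_transpose_mul A
  have hGp := posSemidef_transpose_mul A
  refine opNorm_le_of_forall hτ fun v => ?_
  have hc := continuousOn_spectrum (n := Fin d₂)
  have e1 : hardThreshold τ A - A = A * cfc (fun x => p x - 1) (Aᵀ * A) := by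
    rw [cfc_sub_eq p (fun _ => 1), cfc_const_eq_smul_one hG, one_smul, Matrix.mul_sub,
      Matrix.mul_one]
    rfl
  -- The Gram matrix of the removed part is a function of `Aᵀ A`: an eigenvalue `x` contributes `0`
  -- if kept and `x ≤ τ²` if removed.
  have e2 : (hardThreshold τ A - A)ᵀ * (hardThreshold τ A - A) =
      cfc (fun x => (p x - 1) * (x * (p x - 1))) (Aᵀ * A) := by
    have ht : (cfc (fun x => p x - 1) (Aᵀ * A))ᵀ = cfc (fun x => p x - 1) (Aᵀ * A) := by
      have := isHermitian_cfc (fun x => p x - 1) (Aᵀ * A)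
      rwa [Matrix.IsHermitian, Matrix.conjTranspose_eq_transpose_of_trivial] at this
    rw [e1, Matrix.transpose_mul, ht, Matrix.mul_assoc, ← Matrix.mul_assoc Aᵀ, self_mul_cfc hG,
      ← cfc_mul _ _ _ (hc _ _) (hc _ _)]
  have hps : (τ ^ 2 • (1 : Matrix (Fin d₂) (Fin d₂) ℝ) -
      (hardThreshold τ A - A)ᵀ * (hardThreshold τ A - A)).PosSemidef := by
    rw [e2, ← cfc_const_eq_smul_one hG, ← cfc_sub_eq]
    refine posSemidef_cfc hG fun i => sub_nonneg.mpr ?_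
    have h0 := hGp.eigenvalues_nonneg i
    simp only [hp]
    split_ifs with h
    · simpa using sq_nonneg τ
    · have := Real.sqrt_le_iff.mp (not_lt.mp h)
      linarith [this.2]
  have := (posSemidef_iff_dotProduct hps.1).mp hps v
  rw [Matrix.sub_mulVec, Matrix.smul_mulVec, Matrix.one_mulVec, dotProduct_sub, dotProduct_smul,
    smul_eq_mul, ← mulVec_dotProduct_mulVec] at this
  linarith

/-- If `A` is `τ`-close to a matrix of rank at most `r`, then thresholding `A` at `τ` gives a matrix
of rank at most `r`. -/
lemma rank_hardThreshold_le {τ : ℝ} (hτ : 0 ≤ τ) {A B : Matrix (Fin d₁) (Fin d₂) ℝ}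
    (h : opNorm (A - B) ≤ τ) : (hardThreshold τ A).rank ≤ B.rank := by
  set p : ℝ → ℝ := fun x => if τ < √x then (1 : ℝ) else 0 with hp
  have hG := isHermitian_transpose_mul A
  set Pr := cfc p (Aᵀ * A) with hPr
  have hc := continuousOn_spectrum (n := Fin d₂)
  have hidem : Pr * Pr = Pr := by
    rw [hPr, ← cfc_mul _ _ _ (hc _ _) (hc _ _)]
    congr 1
    ext x
    simp only [hp]
    split_ifs <;> simp
  refine (Matrix.rank_mul_le_right A Pr).trans ?_
  -- A subspace meeting `ker B` only in zero has dimension at most `rank B`. On the range of the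
  -- projection `A` stretches nonzero vectors by more than `τ`, while on `ker B` it agrees with `A -
  -- B` and stretches by at most `τ`.
  have hdisj : Disjoint (LinearMap.range Pr.mulVecLin) (LinearMap.ker B.mulVecLin) := by
    rw [Submodule.disjoint_def]
    rintro v ⟨w, rfl⟩ hB
    simp only [Matrix.mulVecLin_apply, LinearMap.mem_ker] at hB ⊢
    set v := Pr *ᵥ w with hv
    have hPv : Pr *ᵥ v = v := by rw [hv, Matrix.mulVec_mulVec, hidem]
    by_contra hv0
    have hpos : 0 < v ⬝ᵥ v := by
      simpa using Matrix.dotProduct_star_self_pos_iff.mpr hv0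
    have h1 : (A *ᵥ v) ⬝ᵥ (A *ᵥ v) ≤ τ ^ 2 * (v ⬝ᵥ v) := by
      have h2 := dotProduct_mulVec_self_le (A - B) v
      rw [Matrix.sub_mulVec, hB, sub_zero] at h2
      refine h2.trans (mul_le_mul_of_nonneg_right ?_ hpos.le)
      exact pow_le_pow_left₀ (opNorm_nonneg _) h 2
    -- Finitely many eigenvalues and the strict inequality in the threshold give a uniform gap above
    -- `τ²`, so the two stretching bounds contradict each other strictly.
    obtain ⟨ε, hε, hgap⟩ : ∃ ε > 0, ∀ i, p (hG.eigenvalues i) = 1 →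
        τ ^ 2 + ε ≤ hG.eigenvalues i := by
      have hfin : ∀ i, ∃ ε > 0, p (hG.eigenvalues i) = 1 → τ ^ 2 + ε ≤ hG.eigenvalues i := by
        intro i
        by_cases hi : τ < √(hG.eigenvalues i)
        · have := (Real.lt_sqrt hτ).mp hi
          exact ⟨hG.eigenvalues i - τ ^ 2, by linarith, fun _ => by linarith⟩
        · exact ⟨1, one_pos, fun h => by simp [hp, hi] at h⟩
      choose ε hε hεi using hfin
      rcases isEmpty_or_nonempty (Fin d₂) with he | he
      · exact ⟨1, one_pos, fun i => he.elim i⟩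
      · refine ⟨Finset.univ.inf' Finset.univ_nonempty ε, ?_, fun i hi => ?_⟩
        · exact (Finset.lt_inf'_iff _).mpr fun i _ => hε i
        · have := Finset.inf'_le ε (Finset.mem_univ i)
          linarith [hεi i hi]
    have hps : (cfc (fun x => p x * (x * p x)) (Aᵀ * A) -
        cfc (fun x => (τ ^ 2 + ε) * p x) (Aᵀ * A)).PosSemidef := by
      rw [← cfc_sub_eq]
      refine posSemidef_cfc hG fun i => sub_nonneg.mpr ?_
      by_cases hi : τ < √(hG.eigenvalues i)
      · have e : p (hG.eigenvalues i) = 1 := by simp [hp, hi]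
        rw [e]
        linarith [hgap i e]
      · have e : p (hG.eigenvalues i) = 0 := by simp [hp, hi]
        simp [e]
    have h3 := (posSemidef_iff_dotProduct hps.1).mp hps v
    rw [cfc_mul p (fun x => x * p x) _ (hc _ _) (hc _ _), ← self_mul_cfc hG,
      cfc_const_mul _ _ _ (hc _ _), Matrix.sub_mulVec, dotProduct_sub, Matrix.smul_mulVec,
      dotProduct_smul, ← hPr, hPv, smul_eq_mul, ← Matrix.mulVec_mulVec, ← Matrix.mulVec_mulVec,
      hPv, Matrix.dotProduct_mulVec, ← Matrix.mulVec_transpose] at h3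
    have ht : Prᵀ = Pr := by
      have := isHermitian_cfc p (Aᵀ * A)
      rwa [Matrix.IsHermitian, Matrix.conjTranspose_eq_transpose_of_trivial] at this
    rw [ht, hPv, ← mulVec_dotProduct_mulVec] at h3
    nlinarith
  have h1 := Submodule.finrank_add_finrank_le_of_disjoint hdisj
  have h2 := LinearMap.finrank_range_add_finrank_ker B.mulVecLin
  simp only [Matrix.rank]
  omega

lemma matInner_eq_sum_dotProduct {G : Matrix (Fin d₂) (Fin d₂) ℝ} (hG : G.IsHermitian)
    (A B : Matrix (Fin d₁) (Fin d₂) ℝ) :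
    matInner A B = ∑ i, (A *ᵥ (hG.eigenvectorBasis i).ofLp) ⬝ᵥ
      (B *ᵥ (hG.eigenvectorBasis i).ofLp) := by
  simp only [mulVec_dotProduct_mulVec]
  set U : Matrix (Fin d₂) (Fin d₂) ℝ := (hG.eigenvectorUnitary : Matrix (Fin d₂) (Fin d₂) ℝ) with hU
  have h : matInner A B = (Uᵀ * ((Aᵀ * B) * U)).trace := by
    rw [Matrix.trace_mul_comm, Matrix.mul_assoc, hU, eigenvectorUnitary_mul_transpose,
      Matrix.mul_one]
    rfl
  rw [h]
  rfl

lemma mulVec_eigenvectorBasis_norm_sq (A : Matrix (Fin d₁) (Fin d₂) ℝ)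
    (hG : (Aᵀ * A).IsHermitian) (i : Fin d₂) :
    ‖WithLp.toLp 2 (A *ᵥ (hG.eigenvectorBasis i).ofLp)‖ ^ 2 = hG.eigenvalues i := by
  rw [norm_toLp_sq, mulVec_dotProduct_mulVec, hG.mulVec_eigenvectorBasis, dotProduct_smul,
    ← norm_toLp_sq, WithLp.toLp_ofLp, hG.eigenvectorBasis.norm_eq_one]
  simp

/-- Trace duality against the operator norm, in terms of the eigenvalues of `AᵀA`. -/
lemma abs_matInner_le_sum_sqrt (A B : Matrix (Fin d₁) (Fin d₂) ℝ) (hG : (Aᵀ * A).IsHermitian) :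
    |matInner A B| ≤ (∑ i, √(hG.eigenvalues i)) * opNorm B := by
  rw [matInner_eq_sum_dotProduct hG, Finset.sum_mul]
  refine (Finset.abs_sum_le_sum_abs _ _).trans (Finset.sum_le_sum fun i _ => ?_)
  refine (dotProduct_le_norm_mul_norm _ _).trans ?_
  have h1 := mulVec_eigenvectorBasis_norm_sq A hG i
  rw [← h1, Real.sqrt_sq (norm_nonneg _)]
  refine mul_le_mul_of_nonneg_left ?_ (norm_nonneg _)
  have := norm_toLp_mulVec_le B (hG.eigenvectorBasis i).ofLp
  rwa [WithLp.toLp_ofLp, hG.eigenvectorBasis.norm_eq_one, mul_one] at this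

/-- Only `rank A` of the singular values are nonzero, and each is at most the operator norm. This is
the source of the factor `r` in the pilot bound, hence of `r²` in the sample size. -/
lemma abs_matInner_le_rank_mul (A B : Matrix (Fin d₁) (Fin d₂) ℝ) :
    |matInner A B| ≤ A.rank * opNorm A * opNorm B := by
  have hG := isHermitian_transpose_mul A
  refine (abs_matInner_le_sum_sqrt A B hG).trans
    (mul_le_mul_of_nonneg_right ?_ (opNorm_nonneg _))
  have hrank : (A.rank : ℝ) = ∑ i, if hG.eigenvalues i ≠ 0 then (1 : ℝ) else 0 := by
    have h1 := hG.rank_eq_card_non_zero_eigs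
    rw [Matrix.rank_transpose_mul_self] at h1
    rw [h1, Fintype.card_subtype, Finset.sum_boole]
  rw [hrank, Finset.sum_mul]
  refine Finset.sum_le_sum fun i _ => ?_
  by_cases hi : hG.eigenvalues i = 0
  · simp [hi]
  · rw [if_pos hi, one_mul, ← mulVec_eigenvectorBasis_norm_sq A hG i, Real.sqrt_sq (norm_nonneg _)]
    have := norm_toLp_mulVec_le A (hG.eigenvectorBasis i).ofLp
    rwa [WithLp.toLp_ofLp, hG.eigenvectorBasis.norm_eq_one, mul_one] at this

lemma isSymmetric_eigenvalues_congr {E : Type*} [NormedAddCommGroup E] [InnerProductSpace ℝ E]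
    [FiniteDimensional ℝ E] {S T : E →ₗ[ℝ] E} (h : S = T) (hS : S.IsSymmetric) (hT : T.IsSymmetric)
    {k : ℕ} (hk : Module.finrank ℝ E = k) : hS.eigenvalues hk = hT.eigenvalues hk := by
  subst h
  rfl

lemma nuclearNorm_eq_sum_sqrt (A : Matrix (Fin d₁) (Fin d₂) ℝ) (hG : (Aᵀ * A).IsHermitian) :
    nuclearNorm A = ∑ i, √(hG.eigenvalues i) := by
  set T := Matrix.toEuclideanLin A with hT
  have hcomp : Matrix.toEuclideanLin (Aᵀ * A) = LinearMap.adjoint T ∘ₗ T := by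
    rw [hT, ← Matrix.toEuclideanLin_conjTranspose_eq_adjoint,
      Matrix.conjTranspose_eq_transpose_of_trivial]
    ext v i
    simp [Matrix.toLpLin_apply, Matrix.mulVec_mulVec]
  have h0 : ∀ i, √(hG.eigenvalues₀ i) = T.singularValues i := by
    intro i
    rw [T.singularValues_fin finrank_euclideanSpace i, Matrix.IsHermitian.eigenvalues₀,
      isSymmetric_eigenvalues_congr hcomp _ T.isSymmetric_adjoint_comp_self]
  -- The two eigenvalue families differ by a reindexing; the sorted one matches the singular values
  -- index by index.
  have h1 : ∑ i, √(hG.eigenvalues i) = ∑ i, √(hG.eigenvalues₀ i) :=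
    Equiv.sum_comp (Fintype.equivOfCardEq (Fintype.card_fin _)).symm fun i => √(hG.eigenvalues₀ i)
  rw [h1, nuclearNorm]
  simp_rw [h0]
  rw [Fin.sum_univ_eq_sum_range (fun i => T.singularValues i)]
  refine Finsupp.sum_of_support_subset _ ?_ _ (fun _ _ => rfl)
  intro i hi
  rw [Finset.mem_range]
  by_contra hcon
  exact (Finsupp.mem_support_iff.mp hi) (T.singularValues_of_finrank_le
    (finrank_euclideanSpace.le.trans (not_lt.mp hcon)))

lemma abs_matInner_le_nuclearNorm_mul (A B : Matrix (Fin d₁) (Fin d₂) ℝ) :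
    |matInner A B| ≤ nuclearNorm A * opNorm B := by
  have hG := isHermitian_transpose_mul A
  rw [nuclearNorm_eq_sum_sqrt A hG]
  exact abs_matInner_le_sum_sqrt A B hG

end OperatorNorm

end LowPop

/-! ### The LowPopArt guarantee for a fixed pilot. -/

namespace LowPop

section Guarantee

variable {d₁ d₂ : ℕ}

lemma nuclearNorm_nonneg (A : Matrix (Fin d₁) (Fin d₂) ℝ) : 0 ≤ nuclearNorm A :=
  Finset.sum_nonneg fun i _ => LinearMap.singularValues_nonneg _ i

lemma opNorm_smul (c : ℝ) (A : Matrix (Fin d₁) (Fin d₂) ℝ) : opNorm (c • A) = |c| * opNorm A := by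
  unfold opNorm
  rw [map_smul, map_smul, norm_smul, Real.norm_eq_abs]

lemma threshold_nonneg (Q : Matrix (Fin d₂ × Fin d₁) (Fin d₂ × Fin d₁) ℝ) (n : ℕ) (R σ δ : ℝ) :
    0 ≤ threshold Q n R σ δ := by
  unfold threshold
  positivity

/-- The deterministic part of the LowPopArt guarantee. -/
lemma rank_and_opNorm_lowPopArt_le {n : ℕ} {Q : Matrix (Fin d₂ × Fin d₁) (Fin d₂ × Fin d₁) ℝ}
    {Θ₀ Θstar : Matrix (Fin d₁) (Fin d₂) ℝ} {R σ δ : ℝ}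
    {x : Fin n → Matrix (Fin d₁) (Fin d₂) ℝ} {y : Fin n → ℝ}
    (h : opNorm (lowPopArtPre Q Θ₀ R σ δ x y - Θstar) ≤ threshold Q n R σ δ) :
    (lowPopArt Q Θ₀ R σ δ x y).rank ≤ Θstar.rank ∧
      opNorm (lowPopArt Q Θ₀ R σ δ x y - Θstar) ≤ 2 * threshold Q n R σ δ := by
  have h0 := threshold_nonneg Q n R σ δ
  refine ⟨rank_hardThreshold_le h0 h, ?_⟩
  have h1 := opNorm_hardThreshold_sub_le h0 (lowPopArtPre Q Θ₀ R σ δ x y)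
  have h2 := opNorm_add_le (lowPopArt Q Θ₀ R σ δ x y - lowPopArtPre Q Θ₀ R σ δ x y)
    (lowPopArtPre Q Θ₀ R σ δ x y - Θstar)
  rw [sub_add_sub_cancel] at h2
  have h3 : opNorm (lowPopArt Q Θ₀ R σ δ x y - lowPopArtPre Q Θ₀ R σ δ x y) ≤
    threshold Q n R σ δ := h1
  linarith

lemma continuous_dilation_oneSample (Q : Matrix (Fin d₂ × Fin d₁) (Fin d₂ × Fin d₁) ℝ) :
    Continuous fun p : Matrix (Fin d₁) (Fin d₂) ℝ × Matrix (Fin d₁) (Fin d₂) ℝ × ℝ =>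
      dilation (oneSample Q p.1 p.2.1 p.2.2) := by
  have h : Continuous fun p : Matrix (Fin d₁) (Fin d₂) ℝ × Matrix (Fin d₁) (Fin d₂) ℝ × ℝ =>
      oneSample Q p.1 p.2.1 p.2.2 := by
    refine continuous_matrix fun i j => ?_
    simp only [oneSample_eq, Matrix.smul_apply, whiten_apply, matInner_eq_sum, Matrix.vec,
      smul_eq_mul]
    fun_prop
  unfold dilation
  exact continuous_const.matrix_fromBlocks h h.matrix_transpose continuous_const

/-- The pilot varies together with the samples: joint measurability is what makes the failure event
of the second stage admissible for Fubini. -/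
lemma measurable_lowPopArtPre {β : Type*} [MeasurableSpace β] {n : ℕ}
    (Q : Matrix (Fin d₂ × Fin d₁) (Fin d₂ × Fin d₁) ℝ) (R σ δ : ℝ)
    {Θ₀ : β → Matrix (Fin d₁) (Fin d₂) ℝ} {x : Fin n → β → Matrix (Fin d₁) (Fin d₂) ℝ}
    {y : Fin n → β → ℝ} (hΘ : Measurable Θ₀) (hx : ∀ i, Measurable (x i))
    (hy : ∀ i, Measurable (y i)) :
    Measurable fun b => lowPopArtPre Q (Θ₀ b) R σ δ (fun i => x i b) (fun i => y i b) := by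
  have hY : ∀ i, Measurable fun b => influenceScale Q n R σ δ •
      dilation (oneSample Q (Θ₀ b) (x i b) (y i b)) := by
    intro i
    generalize influenceScale Q n R σ δ = c
    have h0 : Measurable fun p : Matrix (Fin d₁) (Fin d₂) ℝ × Matrix (Fin d₁) (Fin d₂) ℝ × ℝ =>
      dilation (oneSample Q p.1 p.2.1 p.2.2) := (continuous_dilation_oneSample Q).measurable
    have h3 : Measurable fun b => (Θ₀ b, x i b, y i b) := hΘ.prodMk ((hx i).prodMk (hy i))
    have h1 : Measurable fun b => dilation (oneSample Q (Θ₀ b) (x i b) (y i b)) := by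
      have h4 := h0.comp h3
      simpa only [Function.comp_def] using h4
    have h2 : Measurable fun M : Matrix (Fin d₁ ⊕ Fin d₂) (Fin d₁ ⊕ Fin d₂) ℝ => c • M :=
      Continuous.measurable (by fun_prop)
    exact h2.comp h1
  have hs : Measurable fun b => ∑ i, cfc influence (influenceScale Q n R σ δ •
      dilation (oneSample Q (Θ₀ b) (x i b) (y i b))) :=
    measurable_matrix_sum _ fun i => measurable_cfc (hY i)
      (fun b => (isHermitian_dilation _).smul (IsSelfAdjoint.all _)) measurable_influence
  have hc : Continuous fun M : Matrix (Fin d₁ ⊕ Fin d₂) (Fin d₁ ⊕ Fin d₂) ℝ =>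
      (1 / ((n : ℝ) * influenceScale Q n R σ δ)) • M.toBlocks₁₂ := by
    refine continuous_matrix fun i j => ?_
    simp only [Matrix.smul_apply, Matrix.toBlocks₁₂, Matrix.of_apply]
    fun_prop
  exact measurable_matrix_add hΘ (hc.measurable.comp hs)

lemma measurable_lowPopArt {β : Type*} [MeasurableSpace β] {n : ℕ}
    (Q : Matrix (Fin d₂ × Fin d₁) (Fin d₂ × Fin d₁) ℝ) (R σ δ : ℝ)
    {Θ₀ : β → Matrix (Fin d₁) (Fin d₂) ℝ} {x : Fin n → β → Matrix (Fin d₁) (Fin d₂) ℝ}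
    {y : Fin n → β → ℝ} (hΘ : Measurable Θ₀) (hx : ∀ i, Measurable (x i))
    (hy : ∀ i, Measurable (y i)) :
    Measurable fun b => lowPopArt Q (Θ₀ b) R σ δ (fun i => x i b) (fun i => y i b) := by
  have h := measurable_lowPopArtPre Q R σ δ hΘ hx hy
  unfold lowPopArt hardThreshold
  have hf : Measurable fun x : ℝ => if threshold Q n R σ δ < √x then (1 : ℝ) else 0 :=
    Measurable.ite (measurableSet_lt measurable_const (by fun_prop)) measurable_const
      measurable_const
  have hg := (Continuous.measurable (by fun_prop :
    Continuous fun M : Matrix (Fin d₁) (Fin d₂) ℝ => Mᵀ * M)).comp h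
  have hc := measurable_cfc hg (fun b => isHermitian_transpose_mul _) hf
  exact (Continuous.measurable (by fun_prop : Continuous fun p :
    Matrix (Fin d₁) (Fin d₂) ℝ × Matrix (Fin d₂) (Fin d₂) ℝ => p.1 * p.2)).comp (h.prodMk hc)

/-- The numerical relations between the scale, the threshold and the confidence level. -/
lemma influenceScale_relations {Q : Matrix (Fin d₂ × Fin d₁) (Fin d₂ × Fin d₁) ℝ} {n : ℕ}
    {R σ δ : ℝ} (hn : 0 < n) (hV : 0 < (σ ^ 2 + R ^ 2) * bQ Q)
    (hL : 0 < Real.log (2 * ((d₁ : ℝ) + d₂) / δ)) :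
    0 < influenceScale Q n R σ δ ∧
    n * (influenceScale Q n R σ δ ^ 2 * ((σ ^ 2 + R ^ 2) * bQ Q)) =
      Real.log (2 * ((d₁ : ℝ) + d₂) / δ) ∧
    n * influenceScale Q n R σ δ * threshold Q n R σ δ =
      2 * Real.log (2 * ((d₁ : ℝ) + d₂) / δ) := by
  unfold influenceScale threshold
  set L := Real.log (2 * ((d₁ : ℝ) + d₂) / δ)
  set V := (σ ^ 2 + R ^ 2) * bQ Q
  have hn' : (0 : ℝ) < n := by exact_mod_cast hn
  refine ⟨by positivity, ?_, ?_⟩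
  · rw [Real.sq_sqrt (by positivity)]
    field_simp
  · have h : √(L / (V * n)) * √(V * L / n) = L / n := by
      rw [← Real.sqrt_mul (by positivity), show L / (V * n) * (V * L / n) = (L / n) ^ 2 by
        field_simp, Real.sqrt_sq (by positivity)]
    calc n * √(L / (V * n)) * (2 * √(V * L / n)) = 2 * n * (√(L / (V * n)) * √(V * L / n)) := by ring
      _ = 2 * L := by rw [h]; field_simp

/-- The LowPopArt estimate before thresholding is within the threshold of the target with
probability at least `1 - δ`. -/
theorem measure_threshold_lt_opNorm_le {π : Measure (Matrix (Fin d₁) (Fin d₂) ℝ)}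
    [IsProbabilityMeasure π] {σ : ℝ} {n : ℕ}
    {P : Fin n → Measure (Matrix (Fin d₁) (Fin d₂) ℝ × ℝ)} [∀ i, IsProbabilityMeasure (P i)]
    (hP : ∀ i, IsNoiseLaw (P i) π σ) (hπ : ∀ᵐ A ∂π, opNorm A ≤ 1)
    (hQ : IsUnit (covMatrix π).det) (h₁ : 0 < d₁) (h₂ : 0 < d₂) (hσ : 0 < σ) (hn : 0 < n)
    {δ : ℝ} (hδ : 0 < δ) (hδ1 : δ < 1) (Θstar Θ₀ : Matrix (Fin d₁) (Fin d₂) ℝ) {R : ℝ}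
    (hR : ∀ᵐ A ∂π, |matInner (Θstar - Θ₀) A| ≤ R) :
    Measure.pi P {z | threshold (covMatrix π) n R σ δ <
      opNorm (lowPopArtPre (covMatrix π) Θ₀ R σ δ (fun i => (z i).1)
        (fun i => matInner Θstar (z i).1 + (z i).2) - Θstar)} ≤ ENNReal.ofReal δ := by
  have hB := bQ_pos hπ hQ h₁ h₂
  have hd : (1 : ℝ) ≤ (d₁ : ℝ) + d₂ := by
    have : (1 : ℝ) ≤ d₁ := by exact_mod_cast h₁
    have : (0 : ℝ) ≤ d₂ := by positivity
    linarith
  have hV : 0 < (σ ^ 2 + R ^ 2) * bQ (covMatrix π) := by positivity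
  have harg : 1 < 2 * ((d₁ : ℝ) + d₂) / δ := by
    rw [lt_div_iff₀ hδ]
    linarith
  have hL := Real.log_pos harg
  obtain ⟨hν, hνV, hνt⟩ := influenceScale_relations hn hV hL
  set L := Real.log (2 * ((d₁ : ℝ) + d₂) / δ) with hLdef
  set ν := influenceScale (covMatrix π) n R σ δ with hνdef
  set Q := covMatrix π with hQdef
  have hn' : (0 : ℝ) < n := by exact_mod_cast hn
  have hm := fun i => (hasMoments_dilation_oneSample (hP i) hπ hQ Θstar Θ₀ hR).smul ν
  have hM : (ν • dilation (Θstar - Θ₀)).IsHermitian :=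
    (isHermitian_dilation _).smul (IsSelfAdjoint.all _)
  -- The deviation level `2 L` is the threshold multiplied by `n ν`.
  have b1 := measure_not_posSemidef_le hm hM (2 * L)
  have b2 := measure_not_posSemidef_le (fun i => (hm i).neg) hM.neg (2 * L)
  have hnum : (Fintype.card (Fin d₁ ⊕ Fin d₂) : ℝ) *
      Real.exp (n * (ν ^ 2 * ((σ ^ 2 + R ^ 2) * bQ Q)) / 2 - 2 * L) ≤ δ / 2 := by
    rw [hνV]
    -- The exponent is `-3L/2`; weakening it to `-L` already gives `δ / 2` after multiplication by
    -- the dimension, one half for each sign.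
    have h1 : Real.exp (L / 2 - 2 * L) ≤ Real.exp (-L) := Real.exp_le_exp.mpr (by linarith)
    have h2 : Real.exp (-L) = δ / (2 * ((d₁ : ℝ) + d₂)) := by
      rw [Real.exp_neg, hLdef, Real.exp_log (by linarith), inv_div]
    rw [h2] at h1
    have h3 : (Fintype.card (Fin d₁ ⊕ Fin d₂) : ℝ) = (d₁ : ℝ) + d₂ := by simp
    rw [h3]
    calc ((d₁ : ℝ) + d₂) * Real.exp (L / 2 - 2 * L) ≤
        ((d₁ : ℝ) + d₂) * (δ / (2 * ((d₁ : ℝ) + d₂))) := by gcongr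
      _ = δ / 2 := by field_simp
  set Y : Matrix (Fin d₁) (Fin d₂) ℝ × ℝ → Matrix (Fin d₁ ⊕ Fin d₂) (Fin d₁ ⊕ Fin d₂) ℝ :=
    fun x => ν • dilation (oneSample Q Θ₀ x.1 (matInner Θstar x.1 + x.2)) with hY
  have hsub : {z : Fin n → Matrix (Fin d₁) (Fin d₂) ℝ × ℝ | threshold Q n R σ δ <
      opNorm (lowPopArtPre Q Θ₀ R σ δ (fun i => (z i).1)
        (fun i => matInner Θstar (z i).1 + (z i).2) - Θstar)} ⊆
      {z | ¬ ((2 * L) • (1 : Matrix _ _ ℝ) - (∑ i, cfc influence (Y (z i)) - (n : ℝ) •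
          (ν • dilation (Θstar - Θ₀)))).PosSemidef} ∪
      {z | ¬ ((2 * L) • (1 : Matrix _ _ ℝ) - (∑ i, cfc influence (-Y (z i)) - (n : ℝ) •
          -(ν • dilation (Θstar - Θ₀)))).PosSemidef} := by
    intro z hz
    by_contra hcon
    rw [Set.mem_union, not_or] at hcon
    obtain ⟨c1, c2⟩ := hcon
    simp only [Set.mem_ofPred_eq, not_not] at c1 c2
    have hneg : ∀ i, cfc influence (-Y (z i)) = -cfc influence (Y (z i)) := fun i =>
      cfc_influence_neg ((isHermitian_dilation _).smul (IsSelfAdjoint.all _))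
    simp only [hneg, Finset.sum_neg_distrib, smul_neg] at c2
    rw [← neg_sub', sub_neg_eq_add] at c2
    set F := ∑ i, cfc influence (Y (z i)) with hF
    have hop := opNorm_toBlocks₁₂_le (W := F - (n : ℝ) • (ν • dilation (Θstar - Θ₀)))
      (by positivity) c1 (by rwa [sub_neg_eq_add])
    rw [Set.mem_ofPred_eq] at hz
    refine absurd hz (not_lt.mpr ?_)
    have e : lowPopArtPre Q Θ₀ R σ δ (fun i => (z i).1)
        (fun i => matInner Θstar (z i).1 + (z i).2) - Θstar =
        (1 / ((n : ℝ) * ν)) • (F - (n : ℝ) • (ν • dilation (Θstar - Θ₀))).toBlocks₁₂ := by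
      ext i j
      have hpre : lowPopArtPre Q Θ₀ R σ δ (fun i => (z i).1)
        (fun i => matInner Θstar (z i).1 + (z i).2) =
          Θ₀ + (1 / ((n : ℝ) * ν)) • F.toBlocks₁₂ := rfl
      simp only [hpre, Matrix.sub_apply, Matrix.add_apply,
        Matrix.smul_apply, Matrix.toBlocks₁₂, Matrix.of_apply, smul_eq_mul, dilation,
        Matrix.fromBlocks_apply₁₂]
      field_simp
      ring
    rw [e, opNorm_smul, abs_of_pos (by positivity), one_div, inv_mul_le_iff₀ (by positivity), hνt]
    exact hop
  refine (measure_mono hsub).trans ((measure_union_le _ _).trans ?_)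
  refine (add_le_add b1 b2).trans ?_
  rw [← ENNReal.ofReal_add (by positivity) (by positivity)]
  exact ENNReal.ofReal_le_ofReal (by linarith)

end Guarantee

end LowPop

/-! ### Pilot accuracy, rates and independence of the two batches. -/

namespace LowPop

section WarmStart

variable {d₁ d₂ : ℕ}

lemma matrix_rank_sub_le (A B : Matrix (Fin d₁) (Fin d₂) ℝ) : (A - B).rank ≤ A.rank + B.rank := by
  have h : LinearMap.range (A - B).mulVecLin ≤
      LinearMap.range A.mulVecLin ⊔ LinearMap.range B.mulVecLin := by
    rintro _ ⟨v, rfl⟩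
    rw [Matrix.mulVecLin_apply, Matrix.sub_mulVec]
    exact Submodule.sub_mem_sup ⟨v, rfl⟩ ⟨v, rfl⟩
  exact (Submodule.finrank_mono h).trans (Submodule.finrank_add_le_finrank_add_finrank _ _)

lemma matInner_neg_left (A B : Matrix (Fin d₁) (Fin d₂) ℝ) : matInner (-A) B = -matInner A B := by
  simp [matInner]

/-- The pilot is uniformly accurate on arms of operator norm at most one. -/
lemma abs_matInner_sub_le {Θ₀ Θstar A : Matrix (Fin d₁) (Fin d₂) ℝ} {r : ℕ} {ε σ : ℝ}
    (h0 : Θ₀.rank ≤ r) (hs : Θstar.rank ≤ r) (hop : opNorm (Θ₀ - Θstar) ≤ ε)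
    (hε : 2 * r * ε ≤ σ) (hA : opNorm A ≤ 1) : |matInner (Θ₀ - Θstar) A| ≤ σ := by
  have h1 := abs_matInner_le_rank_mul (Θ₀ - Θstar) A
  have h2 : ((Θ₀ - Θstar).rank : ℝ) ≤ 2 * r := by
    have := (matrix_rank_sub_le Θ₀ Θstar).trans (add_le_add h0 hs)
    have h3 : ((Θ₀ - Θstar).rank : ℝ) ≤ ((r + r : ℕ) : ℝ) := by exact_mod_cast this
    push_cast at h3
    linarith
  have h3 := opNorm_nonneg (Θ₀ - Θstar)
  have h4 := opNorm_nonneg A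
  calc |matInner (Θ₀ - Θstar) A| ≤ (Θ₀ - Θstar).rank * opNorm (Θ₀ - Θstar) * opNorm A := h1
    _ ≤ (2 * r) * ε * 1 := by
      have hε0 : 0 ≤ ε := h3.trans hop
      gcongr
    _ ≤ σ := by linarith

lemma two_mul_div_half (x δ : ℝ) : 2 * x / (δ / 2) = 4 * x / δ := by
  rw [div_div_eq_mul_div]
  ring

/-- The pilot sample size makes the pilot error at most `σ`. -/
lemma pilot_error_le {Q : Matrix (Fin d₂ × Fin d₁) (Fin d₂ × Fin d₁) ℝ} {κ σ S δ : ℝ} {r n₀ m : ℕ}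
    (hκ : 1 ≤ κ) (hσ : 0 < σ) (hS : 0 ≤ S) (hB : 0 < bQ Q) (hm : 0 < m)
    (hL : 0 < Real.log (4 * ((d₁ : ℝ) + d₂) / δ)) (hnm : (n₀ : ℝ) ≤ κ * m)
    (hn : 64 * κ * ((r : ℝ) ^ 2 * bQ Q * ((σ + S) / σ) ^ 2 *
      Real.log (4 * ((d₁ : ℝ) + d₂) / δ)) ≤ n₀) :
    2 * r * (2 * threshold Q m S σ (δ / 2)) ≤ σ := by
  have hm' : (0 : ℝ) < m := by exact_mod_cast hm
  rw [threshold, two_mul_div_half]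
  set L := Real.log (4 * ((d₁ : ℝ) + d₂) / δ)
  set B := bQ Q
  -- The constant is `64 = 8²`, where `8 = 2 · 2 · 2` collects the rank `2r`, the thresholding loss
  -- and the factor in the threshold; `κ` pays for passing from `n₀` to `m`.
  have h1 : 64 * ((r : ℝ) ^ 2 * B * ((σ + S) / σ) ^ 2 * L) ≤ m := by
    have := hn.trans hnm
    have hκ0 : 0 < κ := by linarith
    refine le_of_mul_le_mul_left ?_ hκ0
    linarith
  have h2 : (8 * r * √((σ ^ 2 + S ^ 2) * B * L / m)) ^ 2 ≤ σ ^ 2 := by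
    rw [mul_pow, Real.sq_sqrt (by positivity), ← mul_div_assoc, div_le_iff₀ hm']
    have h3 : 64 * ((r : ℝ) ^ 2 * B * (σ + S) ^ 2 * L) ≤ σ ^ 2 * m := by
      rw [div_pow] at h1
      have := mul_le_mul_of_nonneg_left h1 (sq_nonneg σ)
      refine le_trans (le_of_eq ?_) this
      field_simp
    refine le_trans ?_ h3
    have h4 : σ ^ 2 + S ^ 2 ≤ (σ + S) ^ 2 := by nlinarith
    have h5 : 0 ≤ 64 * ((r : ℝ) ^ 2 * B * L) := by positivity
    nlinarith [mul_le_mul_of_nonneg_left h4 h5]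
  have := abs_le_of_sq_le_sq' h2 hσ.le
  linarith [this.2]

/-- The rate of the final estimator in terms of the total sample size. -/
lemma final_rate_le {Q : Matrix (Fin d₂ × Fin d₁) (Fin d₂ × Fin d₁) ℝ} {κ σ δ : ℝ} {n₀ k : ℕ}
    (hκ : 1 ≤ κ) (hσ : 0 < σ) (hB : 0 < bQ Q) (hk : 0 < k) (hn₀ : 0 < n₀)
    (hL : 0 < Real.log (4 * ((d₁ : ℝ) + d₂) / δ)) (hnk : (n₀ : ℝ) ≤ κ * k) :
    2 * threshold Q k σ σ (δ / 2) ≤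
      64 * κ * σ * √(bQ Q * Real.log (4 * ((d₁ : ℝ) + d₂) / δ) / n₀) := by
  have hk' : (0 : ℝ) < k := by exact_mod_cast hk
  have hn' : (0 : ℝ) < n₀ := by exact_mod_cast hn₀
  rw [threshold, two_mul_div_half]
  set L := Real.log (4 * ((d₁ : ℝ) + d₂) / δ)
  set B := bQ Q
  -- The factor `√(2κ)` is relaxed to `2κ`, using `κ ≥ 1`. The final constant becomes `8κ`, well
  -- below the `64κ` needed for the pilot.
  have h1 : √((σ ^ 2 + σ ^ 2) * B * L / k) ≤ 2 * κ * σ * √(B * L / n₀) := by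
    refine Real.sqrt_le_iff.mpr ⟨by positivity, ?_⟩
    rw [mul_pow, Real.sq_sqrt (by positivity), ← mul_div_assoc, div_le_div_iff₀ hk' hn']
    have h2 : 0 ≤ 2 * σ ^ 2 * B * L := by positivity
    have h3 := mul_le_mul_of_nonneg_left hnk h2
    have h4 : κ * k ≤ 2 * κ ^ 2 * k := by nlinarith
    have h5 := mul_le_mul_of_nonneg_left h4 h2
    nlinarith
  have h6 : 0 ≤ κ * σ * √(B * L / n₀) := by positivity
  linarith

open ENNReal in
/-- A union bound over two consecutive independent stages. -/
lemma ofReal_one_sub_le_measure {Ω E F : Type*} [MeasurableSpace Ω] [MeasurableSpace E]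
    [MeasurableSpace F] {μ : Measure Ω} [IsProbabilityMeasure μ] {f : Ω → E} {g : Ω → F}
    (hf : Measurable f) (hg : Measurable g) (hfg : IndepFun f g μ) {δ : ℝ} (hδ : 0 ≤ δ)
    {G : Set E} (hG : MeasurableSet G) (hbad : μ.map f Gᶜ ≤ ENNReal.ofReal (δ / 2))
    {B : Set (E × F)} (hB : MeasurableSet B)
    (hsec : ∀ x ∈ G, μ.map g (Prod.mk x ⁻¹' B) ≤ ENNReal.ofReal (δ / 2))
    {T : Set Ω} (hT : ∀ ω, f ω ∈ G → (f ω, g ω) ∉ B → ω ∈ T) :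
    ENNReal.ofReal (1 - δ) ≤ μ T := by
  have := Measure.isProbabilityMeasure_map (μ := μ) hf.aemeasurable
  have := Measure.isProbabilityMeasure_map (μ := μ) hg.aemeasurable
  have h1 : μ (f ⁻¹' Gᶜ) ≤ ENNReal.ofReal (δ / 2) := by
    rwa [← Measure.map_apply hf hG.compl]
  -- Second-stage failure is controlled only for good pilots, so the event is cut down to them
  -- before disintegrating along the first batch.
  have hB' : MeasurableSet (B ∩ Prod.fst ⁻¹' G) := hB.inter (measurable_fst hG)
  have h2 : μ ((fun ω => (f ω, g ω)) ⁻¹' (B ∩ Prod.fst ⁻¹' G)) ≤ ENNReal.ofReal (δ / 2) := by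
    rw [← Measure.map_apply (hf.prodMk hg) hB',
      (indepFun_iff_map_prod_eq_prod_map_map hf.aemeasurable hg.aemeasurable).mp hfg,
      Measure.prod_apply hB']
    calc ∫⁻ x, μ.map g (Prod.mk x ⁻¹' (B ∩ Prod.fst ⁻¹' G)) ∂(μ.map f)
        ≤ ∫⁻ _, ENNReal.ofReal (δ / 2) ∂(μ.map f) := by
          refine lintegral_mono fun x => ?_
          by_cases hx : x ∈ G
          · exact (measure_mono (Set.preimage_mono Set.inter_subset_left)).trans (hsec x hx)
          · have : Prod.mk x ⁻¹' (B ∩ Prod.fst ⁻¹' G) = ∅ := by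
              ext y
              simp [hx]
            rw [this, measure_empty]
            exact zero_le
      _ = ENNReal.ofReal (δ / 2) := by simp
  -- Covering the whole space and using subadditivity avoids complements of `T`, which need not be
  -- measurable.
  have hcover : Set.univ ⊆ T ∪ (f ⁻¹' Gᶜ ∪ (fun ω => (f ω, g ω)) ⁻¹' (B ∩ Prod.fst ⁻¹' G)) := by
    intro ω _
    by_cases hG' : f ω ∈ G
    · by_cases hB' : (f ω, g ω) ∈ B
      · exact Or.inr (Or.inr ⟨hB', hG'⟩)
      · exact Or.inl (hT ω hG' hB')
    · exact Or.inr (Or.inl hG')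
  have h3 : (1 : ℝ≥0∞) ≤ μ T + ENNReal.ofReal δ := by
    calc (1 : ℝ≥0∞) = μ Set.univ := measure_univ.symm
      _ ≤ μ T + (μ (f ⁻¹' Gᶜ) + μ ((fun ω => (f ω, g ω)) ⁻¹' (B ∩ Prod.fst ⁻¹' G))) :=
        (measure_mono hcover).trans ((measure_union_le _ _).trans
          (add_le_add le_rfl (measure_union_le _ _)))
      _ ≤ μ T + (ENNReal.ofReal (δ / 2) + ENNReal.ofReal (δ / 2)) := by gcongr
      _ = μ T + ENNReal.ofReal δ := by
        rw [← ENNReal.ofReal_add (by positivity) (by positivity), add_halves]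
  rw [ENNReal.ofReal_sub _ hδ, ENNReal.ofReal_one]
  exact tsub_le_iff_right.mpr h3

section Batches

variable {Ω E : Type*} [MeasurableSpace Ω] [MeasurableSpace E] {μ : Measure Ω} {m k : ℕ} {Z : Fin (m + k) → Ω → E}

/-- The two batches of an independent sample are independent. -/
lemma indepFun_batches (hZ : ∀ i, Measurable (Z i)) (h : iIndepFun Z μ) :
    IndepFun (fun ω (i : Fin m) => Z (Fin.castAdd k i) ω)
      (fun ω (i : Fin k) => Z (Fin.natAdd m i) ω) μ := by
  classical
  have hd : Disjoint (Finset.univ.image (Fin.castAdd k : Fin m → Fin (m + k)))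
      (Finset.univ.image (Fin.natAdd m : Fin k → Fin (m + k))) := by
    rw [Finset.disjoint_left]
    intro i hi hj
    obtain ⟨a, -, rfl⟩ := Finset.mem_image.mp hi
    obtain ⟨b, -, hb⟩ := Finset.mem_image.mp hj
    have := congrArg Fin.val hb
    simp at this
    omega
  have h1 := h.indepFun_finset _ _ hd hZ
  exact h1.comp
    (φ := fun f (i : Fin m) => f ⟨Fin.castAdd k i, Finset.mem_image_of_mem _ (Finset.mem_univ i)⟩)
    (ψ := fun f (i : Fin k) => f ⟨Fin.natAdd m i, Finset.mem_image_of_mem _ (Finset.mem_univ i)⟩)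
    (by fun_prop) (by fun_prop)

lemma map_batch_eq_pi [IsProbabilityMeasure μ] {j : ℕ} (hZ : ∀ i, Measurable (Z i)) (h : iIndepFun Z μ)
    {e : Fin j → Fin (m + k)} (he : Function.Injective e) :
    μ.map (fun ω i => Z (e i) ω) = Measure.pi fun i => μ.map (Z (e i)) :=
  (iIndepFun_iff_map_fun_eq_pi_map fun i => (hZ (e i)).aemeasurable).mp (h.precomp he)

end Batches

end WarmStart

end LowPop

/-! ### The warm start theorem. -/

theorem mainTheorem4 (κ : ℝ) (hκ : 1 ≤ κ) :
    ∃ C : ℝ, 0 < C ∧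
      ∀ (d₁ d₂ r : ℕ), 0 < d₁ → 0 < d₂ → 0 < r →
      ∀ (𝒜 : Set (Matrix (Fin d₁) (Fin d₂) ℝ)), (∀ A ∈ 𝒜, LowPop.opNorm A ≤ 1) →
      ∀ (π : Measure (Matrix (Fin d₁) (Fin d₂) ℝ)), IsProbabilityMeasure π →
        (∀ᵐ A ∂π, A ∈ 𝒜) → IsUnit (LowPop.covMatrix π).det →
      ∀ (σ S δ : ℝ), 0 < σ → 0 < δ → δ < 1 →
      ∀ (Θstar : Matrix (Fin d₁) (Fin d₂) ℝ), Θstar.rank ≤ r → LowPop.nuclearNorm Θstar ≤ S →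
      ∀ (n₀ m k : ℕ), (n₀ : ℝ) ≤ κ * m → (n₀ : ℝ) ≤ κ * k →
        C * ((r : ℝ) ^ 2 * LowPop.bQ (LowPop.covMatrix π) * ((σ + S) / σ) ^ 2
          * Real.log (4 * ((d₁ : ℝ) + d₂) / δ)) ≤ n₀ →
      ∀ (Ω : Type*) [MeasurableSpace Ω] (μ : Measure Ω), IsProbabilityMeasure μ →
      ∀ (X : Fin (m + k) → Ω → Matrix (Fin d₁) (Fin d₂) ℝ) (η Y : Fin (m + k) → Ω → ℝ),
        LowPop.IsSample μ π Θstar σ X η Y →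
        ENNReal.ofReal (1 - δ) ≤ μ {ω |
          let Q := LowPop.covMatrix π
          let Θpilot := LowPop.warmPilot Q S σ δ (fun i => X i ω) (fun i => Y i ω)
          let Θhat := LowPop.warmLowPopArt Q S σ δ (fun i => X i ω) (fun i => Y i ω)
          (∀ A ∈ 𝒜, |LowPop.matInner (Θpilot - Θstar) A| ≤ σ) ∧
          Θhat.rank ≤ r ∧
          LowPop.opNorm (Θhat - Θstar) ≤ 2 * LowPop.threshold Q k σ σ (δ / 2) ∧
          LowPop.opNorm (Θhat - Θstar)
            ≤ C * σ * √(LowPop.bQ Q * Real.log (4 * ((d₁ : ℝ) + d₂) / δ) / n₀)} := by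
  refine ⟨64 * κ, by linarith, ?_⟩
  intro d₁ d₂ r h₁ h₂ hr 𝒜 h𝒜 π _ hπ𝒜 hQ σ S δ hσ hδ hδ1 Θstar hrank hnuc n₀ m k hm hk hn₀ Ω _ μ _
    X η Y hsample
  open LowPop in
  set Q := covMatrix π with hQdef
  have hπ : ∀ᵐ A ∂π, opNorm A ≤ 1 := hπ𝒜.mono h𝒜
  have hB : 0 < bQ Q := bQ_pos hπ hQ h₁ h₂
  have hS : 0 ≤ S := (nuclearNorm_nonneg Θstar).trans hnuc
  have hr' : (0 : ℝ) < r := by exact_mod_cast hr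
  have hL : 0 < Real.log (4 * ((d₁ : ℝ) + d₂) / δ) := by
    have h3 : (1 : ℝ) ≤ d₁ := by exact_mod_cast h₁
    have h4 : (0 : ℝ) ≤ d₂ := by positivity
    refine Real.log_pos ?_
    rw [lt_div_iff₀ hδ]
    linarith
  have hκ0 : 0 < κ := by linarith
  have hn₀pos : (0 : ℝ) < n₀ := lt_of_lt_of_le (by positivity) hn₀
  -- The sample size condition forces `n₀ > 0`, and then `n₀ ≤ κ m` excludes an empty batch.
  have hmpos : 0 < m := by
    rcases Nat.eq_zero_or_pos m with rfl | h
    · simp at hm; simp [hm] at hn₀pos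
    · exact h
  have hkpos : 0 < k := by
    rcases Nat.eq_zero_or_pos k with rfl | h
    · simp at hk; simp [hk] at hn₀pos
    · exact h
  have herr := pilot_error_le hκ hσ hS hB hmpos hL hm hn₀
  have hrate := final_rate_le hκ hσ hB hkpos (by exact_mod_cast hn₀pos) hL hk
  set Z : Fin (m + k) → Ω → Matrix (Fin d₁) (Fin d₂) ℝ × ℝ := fun i ω => (X i ω, η i ω) with hZdef
  have hZ : ∀ i, Measurable (Z i) := fun i =>
    (hsample.measurable_arm i).prodMk (hsample.measurable_noise i)
  have hlaw : ∀ i, IsNoiseLaw (μ.map (Z i)) π σ := fun i => by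
    have := isNoiseLaw_map (hsample.measurable_arm i) (hsample.measurable_noise i)
      (hsample.subgaussian i)
    rwa [hsample.law_arm i] at this
  have hprob : ∀ i, IsProbabilityMeasure (μ.map (Z i)) := fun i =>
    Measure.isProbabilityMeasure_map (hZ i).aemeasurable
  let pre₁ : (Fin m → Matrix (Fin d₁) (Fin d₂) ℝ × ℝ) → Matrix (Fin d₁) (Fin d₂) ℝ := fun f =>
    lowPopArtPre Q 0 S σ (δ / 2) (fun i => (f i).1) (fun i => matInner Θstar (f i).1 + (f i).2)
  let pilot : (Fin m → Matrix (Fin d₁) (Fin d₂) ℝ × ℝ) → Matrix (Fin d₁) (Fin d₂) ℝ := fun f =>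
    lowPopArt Q 0 S σ (δ / 2) (fun i => (f i).1) (fun i => matInner Θstar (f i).1 + (f i).2)
  let pre₂ : (Fin m → Matrix (Fin d₁) (Fin d₂) ℝ × ℝ) × (Fin k → Matrix (Fin d₁) (Fin d₂) ℝ × ℝ) →
      Matrix (Fin d₁) (Fin d₂) ℝ := fun p =>
    lowPopArtPre Q (pilot p.1) σ σ (δ / 2) (fun i => (p.2 i).1)
      (fun i => matInner Θstar (p.2 i).1 + (p.2 i).2)
  have hinner : Measurable fun A : Matrix (Fin d₁) (Fin d₂) ℝ => matInner Θstar A :=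
    (aeBounded_matInner hπ Θstar).1
  have hsub : Measurable fun A : Matrix (Fin d₁) (Fin d₂) ℝ => opNorm (A - Θstar) :=
    (continuous_opNorm.comp (by fun_prop : Continuous
      fun A : Matrix (Fin d₁) (Fin d₂) ℝ => A - Θstar)).measurable
  have hpre₁ : Measurable pre₁ := measurable_lowPopArtPre Q S σ (δ / 2) measurable_const
    (fun i => by fun_prop) (fun i => by fun_prop)
  have hpilot : Measurable pilot := measurable_lowPopArt Q S σ (δ / 2) measurable_const
    (fun i => by fun_prop) (fun i => by fun_prop)
  have hpre₂ : Measurable pre₂ := measurable_lowPopArtPre Q σ σ (δ / 2)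
    (hpilot.comp measurable_fst) (fun i => by fun_prop) (fun i => by fun_prop)
  set G : Set (Fin m → Matrix (Fin d₁) (Fin d₂) ℝ × ℝ) :=
    {f | opNorm (pre₁ f - Θstar) ≤ threshold Q m S σ (δ / 2)} with hG
  set B : Set ((Fin m → Matrix (Fin d₁) (Fin d₂) ℝ × ℝ) ×
      (Fin k → Matrix (Fin d₁) (Fin d₂) ℝ × ℝ)) :=
    {p | threshold Q k σ σ (δ / 2) < opNorm (pre₂ p - Θstar)} with hBdef
  -- This gives the claim on `𝒜` and also the hypothesis `R = σ` of the second stage.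
  have hpilot_good : ∀ f ∈ G, ∀ A, opNorm A ≤ 1 → |matInner (pilot f - Θstar) A| ≤ σ := by
    intro f hf A hA
    obtain ⟨g1, g2⟩ := rank_and_opNorm_lowPopArt_le hf
    exact abs_matInner_sub_le (g1.trans hrank) hrank g2 herr hA
  refine ofReal_one_sub_le_measure (measurable_pi_iff.mpr fun i => hZ (Fin.castAdd k i))
    (measurable_pi_iff.mpr fun i => hZ (Fin.natAdd m i)) (indepFun_batches hZ hsample.indep) hδ.le
    (G := G) (measurableSet_le (hsub.comp hpre₁) measurable_const) ?_
    (B := B) (measurableSet_lt measurable_const (hsub.comp hpre₂)) ?_ ?_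
  · rw [map_batch_eq_pi hZ hsample.indep (Fin.castAdd_injective m k)]
    have h0 : ∀ᵐ A ∂π, |matInner (Θstar - 0) A| ≤ S := by
      filter_upwards [hπ] with A hA
      rw [sub_zero]
      have h3 := abs_matInner_le_nuclearNorm_mul Θstar A
      have h4 := mul_le_mul hnuc hA (opNorm_nonneg A) hS
      linarith
    have h5 := measure_threshold_lt_opNorm_le (fun i => hlaw (Fin.castAdd k i)) hπ hQ h₁ h₂ hσ hmpos
      (half_pos hδ) (by linarith) Θstar 0 h0
    refine le_trans (measure_mono ?_) h5
    intro f hf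
    have hf' : ¬opNorm (pre₁ f - Θstar) ≤ threshold Q m S σ (δ / 2) := hf
    exact not_le.mp hf'
  · intro f hf
    rw [map_batch_eq_pi hZ hsample.indep (Fin.natAdd_injective k m)]
    -- With the first batch frozen at `f`, the pilot is a deterministic matrix and the fixed-pilot
    -- guarantee applies to the second batch.
    have h0 : ∀ᵐ A ∂π, |matInner (Θstar - pilot f) A| ≤ σ := by
      filter_upwards [hπ] with A hA
      rw [← neg_sub, matInner_neg_left, abs_neg]
      exact hpilot_good f hf A hA
    exact measure_threshold_lt_opNorm_le (fun i => hlaw (Fin.natAdd m i)) hπ hQ h₁ h₂ hσ hkpos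
      (half_pos hδ) (by linarith) Θstar (pilot f) h0
  · intro ω hf hb
    have hY : ∀ i, Y i ω = matInner Θstar (X i ω) + η i ω := fun i => hsample.reward i ω
    have e1 : warmPilot Q S σ δ (fun i => X i ω) (fun i => Y i ω) =
        pilot fun i => Z (Fin.castAdd k i) ω := by
      simp only [warmPilot, hY]
      rfl
    have e2 : warmLowPopArt Q S σ δ (fun i => X i ω) (fun i => Y i ω) =
        lowPopArt Q (pilot fun i => Z (Fin.castAdd k i) ω) σ σ (δ / 2)
          (fun i => X (Fin.natAdd m i) ω)
          (fun i => matInner Θstar (X (Fin.natAdd m i) ω) + η (Fin.natAdd m i) ω) := by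
      rw [warmLowPopArt, e1]
      simp only [hY]
    have hb' : opNorm (pre₂ (fun i => Z (Fin.castAdd k i) ω, fun i => Z (Fin.natAdd m i) ω) - Θstar)
        ≤ threshold Q k σ σ (δ / 2) := not_lt.mp hb
    obtain ⟨g1, g2⟩ := rank_and_opNorm_lowPopArt_le hb'
    simp only [Set.mem_ofPred_eq]
    rw [e1, e2]
    exact ⟨fun A hA => hpilot_good _ hf A (h𝒜 A hA), g1.trans hrank, g2, g2.trans hrate⟩
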